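/- Let $p,q\ge 2$ be integers. For $N\ge1$, $\beta,h\in\mathbb R$ let $\mathbb P_{\beta,h,N}$ be the probability measure on $\{1,\dots,q\}^N$ with $$\mathbb P_{\beta,h,N}(X)\propto\exp\Big(\beta N\sum_{r=1}^q\bar X_{\cdot r}^{\,p}+Nh\bar X_{\cdot1}\Big),\qquad \bar X_{\cdot r}=\tfrac1N\#\{i\le N:X_i=r\}.$$ For $h$ known, let $\hat\beta_N=\hat\beta_N(X)\in[-\infty,\infty]$ be a maximum likelihood estimator of $\beta$: whenever $b\mapsto\mathbb P_{b,h,N}(X)$ attains its maximum over $\mathbb R$, $\hat\beta_N(X)$ is a point where it does (otherwise its value in $[-\infty,\infty]$ is arbitrary). For probability vectors $\boldsymbol t\in\mathbb R^q$ let $H_{\beta,h}(\boldsymbol t)=\beta\sum_r t_r^p+ht_1-\sum_r t_r\log t_r$, and put $\boldsymbol x_s=\big(\frac{1+(q-1)s}q,\frac{1-s}q,\dots,\frac{1-s}q\big)$, $f_{\beta,h}(s)=H_{\beta,h}(\boldsymbol x_s)$. A point $(\beta,h)\in(0,\infty)\times[0,\infty)$ is *special* if $H_{\beta,h}$ has a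 unique maximizer $\boldsymbol m_*$ on the set of probability vectors and the quadratic form $\boldsymbol t\mapsto\sum_{r}\big(\beta p(p-1)m_{*,r}^{p-2}-1/m_{*,r}\big)t_r^2$ is singular on $\{\boldsymbol t:\sum_rt_r=0\}$. Writing $\boldsymbol m_*=\boldsymbol x_s$ with $s\in[0,1)$, a special point is of *type I* if $f^{(4)}_{\beta,h}(s)<0$ and of *type II* if $f^{(4)}_{\beta,h}(s)=0$. **Theorem.** Let $(\beta,h)$ be special with maximizer $\boldsymbol m_*=\boldsymbol x_s$ and let $X\sim\mathbb P_{\beta,h,N}$. Convergence in distribution is that of $[-\infty,\infty]$-valued random variables, as $N\to\infty$. 1. Suppose $(\beta,h)$ is of type I. Let $\boldsymbol u=(1-q,1,\dots,1)$ and, for $t\in\mathbb R$, let $T_{t,0}$ be the random variable whose Lebesgue density at $x$ is proportional to $$\exp\Big(\tfrac{x^4}{24}q^4f^{(4)}_{\beta,h}(s)+t\,p\,\Big(\sum_{r=1}^q m_{*,r}^{p-1}u_r\Big)x\Big),$$ with distribution function $F_{t,0}$; this density is normalizable, and the moments used below exist. - If $(p,q)\notin\{(2,2),(3,2)\}$,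 then $N^{3/4}(\hat\beta_N-\beta)\xrightarrow{D}L_1$, where $L_1$ is the probability law on $\mathbb R$ with distribution function $L_1(t)=F_{0,0}\big(-\int_{-\infty}^\infty u\,\mathrm dF_{t,0}(u)\big)$. - If $(p,q)\in\{(2,2),(3,2)\}$, then $N^{3/4}(\hat\beta_N-\beta)\xrightarrow{D}\alpha\delta_{-\infty}+(1-\alpha)\delta_{\infty}$, where $\alpha=\mathbb P(T_{0,0}^2\le\mathbb E\,T_{0,0}^2)$. 2. Suppose $(\beta,h)$ is of type II. Then $N^{5/6}(\hat\beta_N-\beta)\xrightarrow{D}\gamma_2\delta_{-\infty}+(1-\gamma_2)\delta_\infty$, where $\gamma_2=\mathbb P(F_0^2\le\mathbb E\,F_0^2)$ and $F_0$ has Lebesgue density proportional to $\exp(-\frac{32}{15}x^6)$; this density is normalizable and $\mathbb E F_0^2<\infty$. -/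

import Mathlib

open MeasureTheory Filter Topology

noncomputable section

namespace CWPotts

/-! ### The model -/

/-- The empirical magnetization vector: the `r`-th entry is the proportion of sites of colour `r`.
Colours are the elements of `Fin q`; the first colour is `0 : Fin q`. -/
def magnetization {q N : ℕ} (x : Fin N → Fin q) (r : Fin q) : ℝ :=
  (∑ i : Fin N, if x i = r then (1 : ℝ) else 0) / N

/-- The unnormalized weight `exp (β N ∑ᵣ (X̄ᵣ)^p + N h X̄₁)` of a configuration. -/
def weight (p q N : ℕ) [NeZero q] (β h : ℝ) (x : Fin N → Fin q) : ℝ :=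
  Real.exp (β * N * ∑ r : Fin q, magnetization x r ^ p + N * h * magnetization x 0)

/-- The probability of the configuration `x` under the `p`-tensor Curie-Weiss Potts model with
`q` colours, `N` sites and parameters `β`, `h`. -/
def prob (p q N : ℕ) [NeZero q] (β h : ℝ) (x : Fin N → Fin q) : ℝ :=
  weight p q N β h x / ∑ y : Fin N → Fin q, weight p q N β h y

/-- The Curie-Weiss Potts model as a measure on the finite space of configurations. -/
def pottsMeasure (p q N : ℕ) [NeZero q] (β h : ℝ) : Measure (Fin N → Fin q) :=
  ∑ x : Fin N → Fin q, ENNReal.ofReal (prob p q N β h x) • Measure.dirac x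

instance isProbabilityMeasure_pottsMeasure (p q N : ℕ) [NeZero q] (β h : ℝ) :
    IsProbabilityMeasure (pottsMeasure p q N β h) := by
  have hpos : 0 < ∑ y : Fin N → Fin q, weight p q N β h y :=
    Finset.sum_pos (fun _ _ => Real.exp_pos _) Finset.univ_nonempty
  refine ⟨?_⟩
  have h1 : pottsMeasure p q N β h Set.univ
      = ∑ x : Fin N → Fin q, ENNReal.ofReal (prob p q N β h x) := by
    simp [pottsMeasure]
  rw [h1, ← ENNReal.ofReal_sum_of_nonneg (s := Finset.univ) (f := prob p q N β h)
    (fun x _ => div_nonneg (Real.exp_pos _).le hpos.le)]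
  simp only [prob]
  rw [← Finset.sum_div, div_self hpos.ne', ENNReal.ofReal_one]

/-! ### Maximum likelihood estimation of `β` when `h` is known -/

/-- `b` maximizes the likelihood `β ↦ ℙ_{β,h,N}(x)` over the real line. -/
def IsMaximumLikelihood (p q N : ℕ) [NeZero q] (h : ℝ) (x : Fin N → Fin q) (b : ℝ) : Prop :=
  ∀ b' : ℝ, prob p q N b' h x ≤ prob p q N b h x

/-- A sequence of maximum likelihood estimators of `β` (for known `h`), with values in the extended
reals: for each sample at which the likelihood has a maximum over the real line, the estimate is
a real number at which it is attained. For the remaining samples (where the likelihood only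
approaches its supremum as `β → ±∞`) the value may be any extended real. -/
def IsMLE (p q : ℕ) [NeZero q] (h : ℝ) (βhat : (N : ℕ) → (Fin N → Fin q) → EReal) : Prop :=
  ∀ (N : ℕ) (x : Fin N → Fin q), (∃ b : ℝ, IsMaximumLikelihood p q N h x b) →
    ∃ b : ℝ, βhat N x = (b : EReal) ∧ IsMaximumLikelihood p q N h x b

/-! ### The negative free energy and special points -/

/-- The negative free energy `H_{β,h}(t) = β ∑ tᵣ^p + h t₁ - ∑ tᵣ log tᵣ` (with `0 log 0 = 0`). -/
def negFreeEnergy (p q : ℕ) [NeZero q] (β h : ℝ) (t : Fin q → ℝ) : ℝ :=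
  β * ∑ r, t r ^ p + h * t 0 - ∑ r, t r * Real.log (t r)

/-- `m` is the unique maximizer of `H_{β,h}` on the set of probability vectors. -/
def IsUniqueMaximizer (p q : ℕ) [NeZero q] (β h : ℝ) (m : Fin q → ℝ) : Prop :=
  m ∈ stdSimplex ℝ (Fin q) ∧
    ∀ t ∈ stdSimplex ℝ (Fin q), t ≠ m → negFreeEnergy p q β h t < negFreeEnergy p q β h m

/-- The symmetric bilinear form with quadratic form
`Q_{s,β}(t) = ∑ᵣ (β p (p-1) sᵣ^(p-2) - 1/sᵣ) tᵣ²`. -/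
def bilinQ (p q : ℕ) (β : ℝ) (s t w : Fin q → ℝ) : ℝ :=
  ∑ r, (β * p * (p - 1) * s r ^ (p - 2) - 1 / s r) * t r * w r

/-- The quadratic form `Q_{s,β}` is singular (degenerate) on `{t | ∑ tᵣ = 0}`. -/
def IsSingularQ (p q : ℕ) (β : ℝ) (s : Fin q → ℝ) : Prop :=
  ∃ t : Fin q → ℝ, t ≠ 0 ∧ ∑ r, t r = 0 ∧
    ∀ w : Fin q → ℝ, ∑ r, w r = 0 → bilinQ p q β s t w = 0

/-- Special points of the parameter space `(0,∞) × [0,∞)`. -/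
def IsSpecial (p q : ℕ) [NeZero q] (β h : ℝ) : Prop :=
  0 < β ∧ 0 ≤ h ∧ ∃ m : Fin q → ℝ, IsUniqueMaximizer p q β h m ∧ IsSingularQ p q β m

/-- The vector `x_s = ((1+(q-1)s)/q, (1-s)/q, …, (1-s)/q)`. -/
def xvec (q : ℕ) [NeZero q] (s : ℝ) (r : Fin q) : ℝ :=
  if r = 0 then (1 + (q - 1) * s) / q else (1 - s) / q

/-- The one-dimensional reduction `f_{β,h}(s) = H_{β,h}(x_s)`. -/
def fred (p q : ℕ) [NeZero q] (β h : ℝ) (s : ℝ) : ℝ :=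
  negFreeEnergy p q β h (xvec q s)

/-- Type-I special points: `f⁗(s) < 0`, where the unique maximizer is `x_s`, `s ∈ [0,1)`. -/
def IsTypeI (p q : ℕ) [NeZero q] (β h : ℝ) : Prop :=
  IsSpecial p q β h ∧ ∃ s ∈ Set.Ico (0 : ℝ) 1, IsUniqueMaximizer p q β h (xvec q s) ∧
    iteratedDeriv 4 (fred p q β h) s < 0

/-- Type-II special points: `f⁗(s) = 0`, where the unique maximizer is `x_s`, `s ∈ [0,1)`. -/
def IsTypeII (p q : ℕ) [NeZero q] (β h : ℝ) : Prop :=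
  IsSpecial p q β h ∧ ∃ s ∈ Set.Ico (0 : ℝ) 1, IsUniqueMaximizer p q β h (xvec q s) ∧
    iteratedDeriv 4 (fred p q β h) s = 0

/-! ### The limit laws -/

/-- The vector `u = (1-q, 1, …, 1)`. -/
def uvec (q : ℕ) [NeZero q] (r : Fin q) : ℝ := if r = 0 then 1 - q else 1

/-- The law of `T_{β̄,h̄}`: the probability measure on `ℝ` with Lebesgue density proportional to
`exp (x⁴/24 q⁴ f⁗(s) + (β̄ p ⟨m^(p-1), u⟩ + h̄ (1-q)) x)`, where `m = x_s`.
(`volume.tilted g` has density `exp (g x) / ∫ exp g`.) -/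
def lawT (p q : ℕ) [NeZero q] (β h s βbar hbar : ℝ) : Measure ℝ :=
  (volume : Measure ℝ).tilted fun x =>
    x ^ 4 / 24 * (q : ℝ) ^ 4 * iteratedDeriv 4 (fred p q β h) s
      + (βbar * p * (∑ r, xvec q s r ^ (p - 1) * uvec q r) + hbar * (1 - q)) * x

/-- The law of `F_{h̄}`: the probability measure on `ℝ` with Lebesgue density proportional to
`exp (-(32/15) x⁶ - h̄ x)`. -/
def lawF (hbar : ℝ) : Measure ℝ :=
  (volume : Measure ℝ).tilted fun x => -(32 / 15) * x ^ 6 - hbar * x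

/-- `P(Y² ≤ E Y²)` for a random variable `Y` with law `μ`. -/
def probSqLeMean (μ : Measure ℝ) : ℝ := μ.real {x | x ^ 2 ≤ ∫ y, y ^ 2 ∂μ}

/-- Under `ℙ_{β,h,N}`, the law of `N^a (β̂_N - β)`, a random variable with values in `[-∞,∞]`,
converges weakly on `[-∞,∞]` to the probability measure `L`. -/
def RescaledErrorTendsto (p q : ℕ) [NeZero q] (β h a : ℝ)
    (βhat : (N : ℕ) → (Fin N → Fin q) → EReal) (L : ProbabilityMeasure EReal) : Prop :=
  TendstoInDistribution
    (fun (N : ℕ) (x : Fin N → Fin q) =>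
      (((N : ℝ) ^ a : ℝ) : EReal) * (βhat N x - (β : EReal)))
    atTop (id : EReal → EReal) (fun N => pottsMeasure p q N β h) (L : Measure EReal)

/-- `L` is the two-point law `c δ_{-∞} + (1-c) δ_{∞}`. -/
def IsTwoPointLaw (c : ℝ) (L : ProbabilityMeasure EReal) : Prop :=
  c ∈ Set.Icc (0 : ℝ) 1 ∧ (L : Measure EReal) =
    ENNReal.ofReal c • Measure.dirac ⊥ + ENNReal.ofReal (1 - c) • Measure.dirac ⊤

end CWPotts

end

noncomputable section

set_option linter.unusedSectionVars false

namespace CWPotts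

/-! Write `(a, b, …, b)` for the maximizer `x_s`. Let `k` be the order of the first derivative of
the free energy that does not vanish there along the vectors `(x, (1-x)/(q-1), …)`, so that `k = 4`
for type I and `k = 6` for type II, and put `ε = N^(-1/k)`, `T = (X̄₁ - a)/ε`. Both normalizations
`N^(3/4)` and `N^(5/6)` equal `ε^(-(k-1))`, so the event that the rescaled error is at most `t`
compares the estimator with `β + t ε^(k-1)`.

The inverse likelihood is a sum of exponentials in `b`, hence convex, and its derivative has the
sign of `E_b S - S`, where `S = ∑ X̄ᵣ^p`. So the estimator is at most `b` exactly when `S ≤ E_b S`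
(`maximumLikelihood_le_iff`), apart from samples with extremal `S`, whose probability vanishes. If
`S`, suitably rescaled, has limiting distribution function `G` under `β` and its mean under `β + t
ε^(k-1)` tends to `e(t)`, the distribution function of the rescaled error tends to `G(e(t))`
(`tendsto_distribution_mle`).

Both limits come from Stein's method. Recolouring one site yields an exact exchange identity
(`expect_exchange`). Dividing out the energy turns it into `E[ψ_r(X̄_r) g] ≈ E[ψ_r'(X̄_r') (g ∘
shift)]`, where the values of the functions `ψ` agree at a stationary point. Tested on `X̄_r -
X̄_r'` for two colours other than the first, it shows that these non-degenerate directions fluctuate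
with variance `O(1/N)` (`exists_transverse_bound`). Tested on functions of `T` and summed over the
other colours, it becomes `E[g'(T) + (θ - κ T^(k-1)) g(T)] → 0` with `θ = t p (a^(p-1) - b^(p-1))`
(`tendsto_stein`), the Stein equation of the density `exp(-(κ/k) x^k + θ x)`. Together with a bound
on `E T^k` this gives convergence of expectations up to quadratic growth
(`CriticalPoint.tendsto_expect`). Exponential concentration near the maximizer, proved by comparison
with product measures, justifies the local expansions.

If `a > b`, then `S` is linear in `T` to leading order, and `e(t)` is the mean of the limit law
tilted by `θ`. It increases continuously from `-∞` to `∞`, so `L₁` is a law on the real line. If `a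
= b`, then `θ = 0` and `S` is quadratic in `T`, so `e(t) = E T²` does not depend on `t` and all mass
escapes to `±∞`.

Which case occurs is algebra with the derivatives of the free energy. A special point with `s = 0`
has `q = 2` (`symmetric_flat_point`), and the fourth derivative there has the sign of `p - 4`. For
`s > 0` the fourth derivative cannot vanish (`no_flat_asymmetric_point`), so type II means `p = 4`,
`q = 2`, `s = 0`, `β = 2/3`. -/

/-! ### Expectations of functions of the magnetization -/

/-- The expectation of `F (X̄)` under `ℙ_{b,h,N}`. -/
def expect (p q N : ℕ) [NeZero q] (b h : ℝ) (F : (Fin q → ℝ) → ℝ) : ℝ :=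
  ∑ x : Fin N → Fin q, prob p q N b h x * F (magnetization x)

section Expect

variable {p q N : ℕ} [NeZero q] {b h : ℝ}

theorem weight_pos (x : Fin N → Fin q) : 0 < weight p q N b h x := Real.exp_pos _

theorem partition_pos (p q N : ℕ) [NeZero q] (b h : ℝ) :
    0 < ∑ y : Fin N → Fin q, weight p q N b h y :=
  Finset.sum_pos (fun _ _ => Real.exp_pos _) Finset.univ_nonempty

theorem prob_pos (x : Fin N → Fin q) : 0 < prob p q N b h x :=
  div_pos (weight_pos x) (partition_pos p q N b h)

theorem sum_prob (p q N : ℕ) [NeZero q] (b h : ℝ) :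
    ∑ x : Fin N → Fin q, prob p q N b h x = 1 := by
  simp only [prob]
  rw [← Finset.sum_div, div_self (partition_pos p q N b h).ne']

theorem magnetization_nonneg (x : Fin N → Fin q) (r : Fin q) : 0 ≤ magnetization x r := by
  unfold magnetization
  exact div_nonneg (Finset.sum_nonneg fun i _ => by split_ifs <;> norm_num) (Nat.cast_nonneg _)

theorem sum_magnetization (hN : N ≠ 0) (x : Fin N → Fin q) : ∑ r, magnetization x r = 1 := by
  unfold magnetization
  rw [← Finset.sum_div, Finset.sum_comm]
  simp [hN]

theorem magnetization_mem_stdSimplex (hN : N ≠ 0) (x : Fin N → Fin q) :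
    magnetization x ∈ stdSimplex ℝ (Fin q) :=
  ⟨magnetization_nonneg x, sum_magnetization hN x⟩

theorem stdSimplex_le_one {t : Fin q → ℝ} (ht : t ∈ stdSimplex ℝ (Fin q)) (r : Fin q) :
    t r ≤ 1 := by
  rw [← ht.2]
  exact Finset.single_le_sum (fun i _ => ht.1 i) (Finset.mem_univ r)

theorem expect_add (F G : (Fin q → ℝ) → ℝ) :
    expect p q N b h (fun x => F x + G x) = expect p q N b h F + expect p q N b h G := by
  simp only [expect, mul_add, Finset.sum_add_distrib]

theorem expect_sub (F G : (Fin q → ℝ) → ℝ) :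
    expect p q N b h (fun x => F x - G x) = expect p q N b h F - expect p q N b h G := by
  simp only [expect, mul_sub, Finset.sum_sub_distrib]

theorem expect_const_mul (c : ℝ) (F : (Fin q → ℝ) → ℝ) :
    expect p q N b h (fun x => c * F x) = c * expect p q N b h F := by
  simp only [expect, Finset.mul_sum]
  exact Finset.sum_congr rfl fun _ _ => by ring

theorem expect_const (c : ℝ) : expect p q N b h (fun _ => c) = c := by
  simp only [expect]
  rw [← Finset.sum_mul, sum_prob, one_mul]

theorem expect_sum {ι : Type*} (s : Finset ι) (F : ι → (Fin q → ℝ) → ℝ) :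
    expect p q N b h (fun x => ∑ i ∈ s, F i x) = ∑ i ∈ s, expect p q N b h (F i) := by
  simp only [expect, Finset.mul_sum]
  exact Finset.sum_comm

theorem expect_mono_of_mem (hN : N ≠ 0) {F G : (Fin q → ℝ) → ℝ}
    (hFG : ∀ t ∈ stdSimplex ℝ (Fin q), F t ≤ G t) :
    expect p q N b h F ≤ expect p q N b h G :=
  Finset.sum_le_sum fun x _ => mul_le_mul_of_nonneg_left
    (hFG _ (magnetization_mem_stdSimplex hN x)) (prob_pos x).le

theorem expect_nonneg (hN : N ≠ 0) {F : (Fin q → ℝ) → ℝ}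
    (hF : ∀ t ∈ stdSimplex ℝ (Fin q), 0 ≤ F t) : 0 ≤ expect p q N b h F :=
  Finset.sum_nonneg fun x _ => mul_nonneg (prob_pos x).le
    (hF _ (magnetization_mem_stdSimplex hN x))

theorem abs_expect_le (F : (Fin q → ℝ) → ℝ) :
    |expect p q N b h F| ≤ expect p q N b h (fun x => |F x|) := by
  refine (Finset.abs_sum_le_sum_abs _ _).trans (Finset.sum_le_sum fun x _ => ?_)
  rw [abs_mul, abs_of_pos (prob_pos x)]

theorem abs_expect_le_of_mem (hN : N ≠ 0) {F G : (Fin q → ℝ) → ℝ}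
    (hFG : ∀ t ∈ stdSimplex ℝ (Fin q), |F t| ≤ G t) :
    |expect p q N b h F| ≤ expect p q N b h G :=
  (abs_expect_le F).trans (expect_mono_of_mem hN hFG)

/-! ### The exchange identity -/

/-- The magnetization after one site of colour `r'` gets colour `r`. -/
def shift (N : ℕ) (r r' : Fin q) (t : Fin q → ℝ) (s : Fin q) : ℝ :=
  t s + (if s = r then 1 / (N : ℝ) else 0) - (if s = r' then 1 / (N : ℝ) else 0)

/-- The energy per site. -/
def energy (p q : ℕ) [NeZero q] (b h : ℝ) (t : Fin q → ℝ) : ℝ := b * ∑ r, t r ^ p + h * t 0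

theorem weight_eq (x : Fin N → Fin q) :
    weight p q N b h x = Real.exp (N * energy p q b h (magnetization x)) := by
  unfold weight energy
  congr 1
  ring

theorem magnetization_update (x : Fin N → Fin q) (i : Fin N) {r r' : Fin q}
    (hx : x i = r') : magnetization (Function.update x i r) = shift N r r' (magnetization x) := by
  funext s
  unfold magnetization shift
  beta_reduce
  rw [← Finset.add_sum_erase _ _ (Finset.mem_univ i),
    ← Finset.add_sum_erase (Finset.univ) (fun j => if x j = s then (1 : ℝ) else 0)
      (Finset.mem_univ i)]
  have : ∑ j ∈ Finset.univ.erase i, (if Function.update x i r j = s then (1 : ℝ) else 0)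
      = ∑ j ∈ Finset.univ.erase i, (if x j = s then (1 : ℝ) else 0) :=
    Finset.sum_congr rfl fun j hj => by
      rw [Function.update_of_ne (Finset.ne_of_mem_erase hj)]
  rw [this, Function.update_self, hx]
  simp only [eq_comm (a := s)]
  split_ifs <;> ring

/-- Recolouring site `i` maps the configurations with colour `r'` there bijectively onto those with
colour `r`; recolouring back is the inverse. -/
theorem sum_filter_color (i : Fin N) (r r' : Fin q) (G : (Fin N → Fin q) → ℝ) :
    ∑ x : Fin N → Fin q, (if x i = r then 1 else 0) * G x
      = ∑ x : Fin N → Fin q, (if x i = r' then 1 else 0) * G (Function.update x i r) := by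
  simp only [ite_mul, one_mul, zero_mul]
  rw [← Finset.sum_filter, ← Finset.sum_filter]
  refine Finset.sum_nbij' (fun x => Function.update x i r') (fun x => Function.update x i r)
    ?_ ?_ ?_ ?_ ?_
  · intro x hx; simp
  · intro x hx; simp
  · intro x hx
    have : x i = r := by simpa using hx
    simp [← this]
  · intro x hx
    have : x i = r' := by simpa using hx
    simp [← this]
  · intro x hx
    have : x i = r := by simpa using hx
    simp [← this]

/-- The factor `t r` is the average over sites of the indicator of colour `r`. For each site the
configurations are reparametrized by recolouring that site from `r'`, and the exponential is the
resulting ratio of weights. -/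
theorem expect_exchange (r r' : Fin q) (F : (Fin q → ℝ) → ℝ) :
    expect p q N b h (fun t => t r * F t)
      = expect p q N b h (fun t => t r' *
        (Real.exp (N * (energy p q b h (shift N r r' t) - energy p q b h t))
          * F (shift N r r' t))) := by
  set Z := ∑ y : Fin N → Fin q, weight p q N b h y with hZ
  have key : ∀ i : Fin N,
      ∑ x : Fin N → Fin q, (if x i = r then 1 else 0) *
        (Real.exp (N * energy p q b h (magnetization x)) * F (magnetization x))
      = ∑ x : Fin N → Fin q, (if x i = r' then 1 else 0) *
        (Real.exp (N * energy p q b h (shift N r r' (magnetization x)))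
          * F (shift N r r' (magnetization x))) := by
    intro i
    rw [sum_filter_color i r r']
    refine Finset.sum_congr rfl fun x _ => ?_
    by_cases hx : x i = r'
    · rw [magnetization_update x i hx]
    · simp [hx]
  have hL : ∀ (G : (Fin q → ℝ) → ℝ) (s : Fin q),
      ∑ x : Fin N → Fin q, magnetization x s * G (magnetization x)
        = (∑ i : Fin N, ∑ x : Fin N → Fin q,
            (if x i = s then 1 else 0) * G (magnetization x)) / N := by
    intro G s
    rw [Finset.sum_comm, Finset.sum_div]
    refine Finset.sum_congr rfl fun x _ => ?_
    rw [← Finset.sum_mul]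
    unfold magnetization
    ring
  have h1 : expect p q N b h (fun t => t r * F t)
      = (∑ x : Fin N → Fin q, magnetization x r *
        (Real.exp (N * energy p q b h (magnetization x)) * F (magnetization x))) / Z := by
    simp only [expect, prob, ← hZ]
    rw [Finset.sum_div]
    refine Finset.sum_congr rfl fun x _ => ?_
    rw [weight_eq]; ring
  have h2 : expect p q N b h (fun t => t r' *
        (Real.exp (N * (energy p q b h (shift N r r' t) - energy p q b h t))
          * F (shift N r r' t)))
      = (∑ x : Fin N → Fin q, magnetization x r' *
        (Real.exp (N * energy p q b h (shift N r r' (magnetization x)))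
          * F (shift N r r' (magnetization x)))) / Z := by
    simp only [expect, prob, ← hZ]
    rw [Finset.sum_div]
    refine Finset.sum_congr rfl fun x _ => ?_
    rw [weight_eq, mul_sub, Real.exp_sub]
    have := (Real.exp_pos (N * energy p q b h (magnetization x))).ne'
    field_simp
  rw [h1, h2, hL (fun t => Real.exp (N * energy p q b h t) * F t),
    hL (fun t => Real.exp (N * energy p q b h (shift N r r' t)) * F (shift N r r' t)),
    Finset.sum_congr rfl fun i _ => key i]

end Expect

/-! ### A uniform second order Taylor bound -/

theorem exists_taylor_bound {f : ℝ → ℝ} (hf : ContDiff ℝ 2 f) (R : ℝ) :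
    ∃ C : ℝ, 0 ≤ C ∧ ∀ x ∈ Set.Icc (-R) R, ∀ y ∈ Set.Icc (-R) R,
      |f y - f x - deriv f x * (y - x)| ≤ C * (y - x) ^ 2 := by
  have hd : ContDiff ℝ 1 (deriv f) := by
    have : ContDiff ℝ (1 + 1) f := by rw [one_add_one_eq_two]; exact hf
    exact (contDiff_succ_iff_deriv.1 this).2.2
  have hc : ContinuousOn (deriv (deriv f)) (Set.Icc (-R) R) :=
    (hd.continuous_deriv le_rfl).continuousOn
  obtain ⟨C, hC⟩ := isCompact_Icc.exists_bound_of_continuousOn hc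
  refine ⟨|C|, abs_nonneg _, fun x hx y hy => ?_⟩
  have hlip : ∀ z ∈ Set.uIcc x y, |deriv f z - deriv f x| ≤ |C| * |y - x| := by
    intro z hz
    have hzR : z ∈ Set.Icc (-R) R := Set.uIcc_subset_Icc hx hy hz
    have := (convex_Icc (-R) R).norm_image_sub_le_of_norm_deriv_le (f := deriv f)
      (fun w _ => (hd.differentiable (by norm_num)).differentiableAt)
      (fun w hw => (hC w hw).trans (le_abs_self C)) hx hzR
    refine this.trans ?_
    gcongr
    simpa [Real.norm_eq_abs, abs_sub_comm] using Set.abs_sub_left_of_mem_uIcc hz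
  -- With the tangent slope at `x` removed, the derivative between `x` and `y` is at most `|C| |y -
  -- x|`, so a second mean value inequality gives the quadratic bound.
  have h := (convex_uIcc x y).norm_image_sub_le_of_norm_deriv_le
    (f := fun z => f z - deriv f x * z) (C := |C| * |y - x|) (x := x) (y := y)
    (fun w _ => by
      have := (hf.differentiable (by norm_num)) w
      fun_prop)
    (fun w hw => by
      have h1 := (hf.differentiable (by norm_num)) w
      rw [deriv_fun_sub h1 (by fun_prop), deriv_const_mul_field]
      simpa using hlip w hw) Set.left_mem_uIcc Set.right_mem_uIcc
  calc |f y - f x - deriv f x * (y - x)|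
      = ‖f y - deriv f x * y - (f x - deriv f x * x)‖ := by
        rw [Real.norm_eq_abs]; congr 1; ring
    _ ≤ |C| * |y - x| * ‖y - x‖ := h
    _ = |C| * (y - x) ^ 2 := by rw [Real.norm_eq_abs, mul_assoc, ← sq, sq_abs]

/-! ### The approximate exchange identity -/

/-- `ψ(t) = t exp (-(b p t^(p-1) + c))`. -/
def psi (p : ℕ) (b c t : ℝ) : ℝ := t * Real.exp (-(b * p * t ^ (p - 1) + c))

/-- The external field felt by colour `r`. -/
def field {q : ℕ} [NeZero q] (h : ℝ) (r : Fin q) : ℝ := if r = 0 then h else 0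

theorem abs_field_le {q : ℕ} [NeZero q] (h : ℝ) (r : Fin q) : |field h r| ≤ |h| := by
  unfold field
  split_ifs <;> simp

theorem abs_exp_sub_one_le_mul_exp (u : ℝ) : |Real.exp u - 1| ≤ |u| * Real.exp |u| := by
  have h1 := Real.add_one_le_exp u
  have h2 := Real.add_one_le_exp (-u)
  have h3 : 1 ≤ Real.exp |u| := Real.one_le_exp (abs_nonneg u)
  have h4 : Real.exp u ≤ Real.exp |u| := Real.exp_le_exp.2 (le_abs_self u)
  have h5 : Real.exp u * Real.exp (-u) = 1 := by rw [← Real.exp_add]; simp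
  have h6 := Real.exp_pos u
  rw [abs_le]
  constructor
  · nlinarith [neg_abs_le u, abs_nonneg u]
  · have : Real.exp u - 1 ≤ u * Real.exp u := by nlinarith
    nlinarith [le_abs_self u, abs_nonneg u]

/-- The tangent is taken at the upper end of the increment, and `y` runs up to `2`, because this is
used both at `t r'` and at `t r + 1 / N`, the proportion after the exchange. -/
theorem exists_pow_increment_bound (p : ℕ) :
    ∃ C : ℝ, 0 ≤ C ∧ ∀ N : ℕ, N ≠ 0 → ∀ y ∈ Set.Icc (0 : ℝ) 2,
      |N * (y ^ p - (y - 1 / N) ^ p) - p * y ^ (p - 1)| ≤ C / N := by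
  obtain ⟨C, hC0, hC⟩ := exists_taylor_bound (f := fun t : ℝ => t ^ p) (by fun_prop) 2
  refine ⟨C, hC0, fun N hN y hy => ?_⟩
  have hN1 : (1 : ℝ) ≤ N := by exact_mod_cast Nat.one_le_iff_ne_zero.2 hN
  have hN0 : (0 : ℝ) < N := by linarith
  have hinv : 1 / (N : ℝ) ≤ 1 := by rw [div_le_one hN0]; exact hN1
  have hinv0 : 0 < 1 / (N : ℝ) := by positivity
  have := hC y ⟨by linarith [hy.1], hy.2⟩ (y - 1 / N)
    ⟨by linarith [hy.1], by linarith [hy.2]⟩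
  rw [show deriv (fun t : ℝ => t ^ p) y = p * y ^ (p - 1) by simp] at this
  have e : N * (y ^ p - (y - 1 / N) ^ p) - p * y ^ (p - 1)
      = -N * ((y - 1 / N) ^ p - y ^ p - p * y ^ (p - 1) * (y - 1 / N - y)) := by
    field_simp
    ring
  rw [e, abs_mul, abs_neg, abs_of_pos hN0]
  calc (N : ℝ) * |(y - 1 / N) ^ p - y ^ p - p * y ^ (p - 1) * (y - 1 / N - y)|
      ≤ N * (C * (y - 1 / N - y) ^ 2) := by gcongr
    _ = C / N := by field_simp; ring

section Exchange

variable {p q N : ℕ} [NeZero q] {b h : ℝ}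

theorem energy_shift_sub (hN : N ≠ 0) {r r' : Fin q} (hr : r ≠ r') (t : Fin q → ℝ) :
    N * (energy p q b h (shift N r r' t) - energy p q b h t)
      = b * (N * ((t r + 1 / N) ^ p - t r ^ p)) - b * (N * (t r' ^ p - (t r' - 1 / N) ^ p))
        + field h r - field h r' := by
  have hN0 : (N : ℝ) ≠ 0 := by exact_mod_cast hN
  have h1 : ∑ s, shift N r r' t s ^ p - ∑ s, t s ^ p
      = ((t r + 1 / N) ^ p - t r ^ p) + ((t r' - 1 / N) ^ p - t r' ^ p) := by
    rw [← Finset.sum_sub_distrib, Finset.sum_eq_add r r' hr]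
    · simp [shift, hr, hr.symm]
    · intro s _ hs
      simp [shift, hs.1, hs.2]
    · simp
    · simp
  have h2 : N * (h * shift N r r' t 0 - h * t 0) = field h r - field h r' := by
    unfold shift field
    simp only [eq_comm (a := (0 : Fin q))]
    split_ifs <;> field_simp <;> ring
  unfold energy
  linear_combination N * b * h1 + h2

theorem shift_self {r r' : Fin q} (hr : r ≠ r') (t : Fin q → ℝ) :
    shift N r r' t r = t r + 1 / N := by
  simp [shift, hr]

end Exchange

/-- In the exact exchange identity the test function is `g` times the exponential inside `psi` for
colour `r`. After the exchange this factor cancels the change of energy from colour `r` up to `1 +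
O(1/N)`, and what remains of the energy is the exponential inside `psi` for colour `r'`. -/
theorem exists_exchange_bound (p q : ℕ) [NeZero q] (h B : ℝ) :
    ∃ C : ℝ, 0 ≤ C ∧ ∀ N : ℕ, N ≠ 0 → ∀ b : ℝ, |b| ≤ B → ∀ r r' : Fin q, r ≠ r' →
      ∀ g : (Fin q → ℝ) → ℝ,
        |expect p q N b h (fun t => psi p b (field h r) (t r) * g t)
          - expect p q N b h (fun t => psi p b (field h r') (t r') * g (shift N r r' t))|
        ≤ C / N * expect p q N b h (fun t => |g (shift N r r' t)|) := by
  obtain ⟨C, hC0, hC⟩ := exists_pow_increment_bound p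
  refine ⟨Real.exp (|B| * p + |h|) * (2 * |B| * C * Real.exp (2 * |B| * C)), by positivity,
    fun N hN b hb r r' hr g => ?_⟩
  have hb' : |b| ≤ |B| := hb.trans (le_abs_self B)
  have hN1 : (1 : ℝ) ≤ N := by exact_mod_cast Nat.one_le_iff_ne_zero.2 hN
  have hN0 : (0 : ℝ) < N := by linarith
  have hinv : 1 / (N : ℝ) ≤ 1 := by rw [div_le_one hN0]; exact hN1
  have hinv0 : 0 < 1 / (N : ℝ) := by positivity
  have e1 : expect p q N b h (fun t => psi p b (field h r) (t r) * g t)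
      = expect p q N b h (fun t => t r' *
        (Real.exp (N * (energy p q b h (shift N r r' t) - energy p q b h t))
          * (Real.exp (-(b * p * shift N r r' t r ^ (p - 1) + field h r))
            * g (shift N r r' t)))) := by
    rw [← expect_exchange r r'
      (fun t => Real.exp (-(b * p * t r ^ (p - 1) + field h r)) * g t)]
    simp only [psi, mul_assoc]
  rw [e1, ← expect_sub, ← expect_const_mul]
  refine abs_expect_le_of_mem hN fun t ht => ?_
  rw [shift_self hr, energy_shift_sub hN hr]
  have ht0 := ht.1 r'
  have ht1 := stdSimplex_le_one ht r'
  have hA := hC N hN (t r + 1 / N)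
    ⟨by linarith [ht.1 r], by linarith [stdSimplex_le_one ht r]⟩
  have hA' := hC N hN (t r') ⟨ht0, by linarith⟩
  rw [add_sub_cancel_right] at hA
  -- `A` and `A'` are the errors made when the finite differences of `t^p` are replaced by
  -- derivatives. Each is at most `C / N`, and `exp (b (A - A'))` is the only factor that does not
  -- cancel.
  set A := N * ((t r + 1 / N) ^ p - t r ^ p) - p * (t r + 1 / N) ^ (p - 1) with hAdef
  set A' := N * (t r' ^ p - (t r' - 1 / N) ^ p) - p * t r' ^ (p - 1) with hAdef'
  have hu : |b * (A - A')| ≤ 2 * |B| * C / N := by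
    rw [abs_mul]
    calc |b| * |A - A'| ≤ |B| * (|A| + |A'|) := by
          gcongr
          exact abs_sub _ _
      _ ≤ |B| * (C / N + C / N) := by gcongr
      _ = 2 * |B| * C / N := by ring
  have hu' : |b * (A - A')| ≤ 2 * |B| * C := by
    refine hu.trans ?_
    exact div_le_self (by positivity) hN1
  have hpw : |t r' ^ (p - 1)| ≤ 1 := by
    rw [abs_pow, abs_of_nonneg ht0]
    exact pow_le_one₀ ht0 ht1
  have e2 : t r' * (Real.exp (b * (N * ((t r + 1 / N) ^ p - t r ^ p))
        - b * (N * (t r' ^ p - (t r' - 1 / N) ^ p)) + field h r - field h r')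
        * (Real.exp (-(b * p * (t r + 1 / N) ^ (p - 1) + field h r)) * g (shift N r r' t)))
      - psi p b (field h r') (t r') * g (shift N r r' t)
      = t r' * Real.exp (-(b * p * t r' ^ (p - 1) + field h r')) *
        (Real.exp (b * (A - A')) - 1) * g (shift N r r' t) := by
    rw [psi, mul_sub (t r' * _), mul_assoc (t r') (Real.exp _) (Real.exp _), ← Real.exp_add,
      ← mul_assoc (Real.exp _) (Real.exp _), ← Real.exp_add, mul_one, sub_mul, ← mul_assoc]
    congr 4
    rw [hAdef, hAdef']
    ring
  rw [e2, abs_mul, abs_mul, abs_mul, abs_of_nonneg ht0, Real.abs_exp]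
  have e3 : Real.exp (-(b * p * t r' ^ (p - 1) + field h r')) ≤ Real.exp (|B| * p + |h|) := by
    refine Real.exp_le_exp.2 ((le_abs_self _).trans ?_)
    rw [abs_neg]
    refine (abs_add_le _ _).trans (add_le_add ?_ (abs_field_le h r'))
    rw [abs_mul, abs_mul, Nat.abs_cast]
    calc |b| * p * |t r' ^ (p - 1)| ≤ |B| * p * 1 := by gcongr
      _ = |B| * p := mul_one _
  have e4 : |Real.exp (b * (A - A')) - 1|
      ≤ 2 * |B| * C / N * Real.exp (2 * |B| * C) :=
    (abs_exp_sub_one_le_mul_exp _).trans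
      (mul_le_mul hu (Real.exp_le_exp.2 hu') (Real.exp_pos _).le (by positivity))
  calc t r' * Real.exp (-(b * p * t r' ^ (p - 1) + field h r'))
        * |Real.exp (b * (A - A')) - 1| * |g (shift N r r' t)|
      ≤ 1 * Real.exp (|B| * p + |h|) * (2 * |B| * C / N * Real.exp (2 * |B| * C))
        * |g (shift N r r' t)| := by gcongr
    _ = _ := by ring

theorem exists_psi_perturb_bound (p : ℕ) (β c R : ℝ) :
    ∃ C : ℝ, 0 ≤ C ∧ ∀ τ : ℝ, |τ| ≤ R → ∀ t ∈ Set.Icc (0 : ℝ) 1,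
      |psi p (β + τ) c t - psi p β c t * (1 - τ * p * t ^ (p - 1))| ≤ C * τ ^ 2 := by
  obtain ⟨C, hC0, hC⟩ := exists_taylor_bound Real.contDiff_exp (|R| * p)
  refine ⟨Real.exp (|β| * p + |c|) * (C * p ^ 2), by positivity, fun τ hτ t ht => ?_⟩
  have hpw : |t ^ (p - 1)| ≤ 1 := by
    rw [abs_pow, abs_of_nonneg ht.1]
    exact pow_le_one₀ ht.1 ht.2
  have hv : |τ * p * t ^ (p - 1)| ≤ |τ| * p := by
    rw [abs_mul, abs_mul, Nat.abs_cast]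
    calc |τ| * p * |t ^ (p - 1)| ≤ |τ| * p * 1 := by gcongr
      _ = |τ| * p := mul_one _
  have hv' : |τ * p * t ^ (p - 1)| ≤ |R| * p :=
    hv.trans
      (mul_le_mul_of_nonneg_right (hτ.trans (le_abs_self R)) (Nat.cast_nonneg p))
  have h1 := hC 0 ⟨by simpa using by positivity, by positivity⟩ (-(τ * p * t ^ (p - 1)))
    (by rw [abs_le] at hv'; exact ⟨by linarith [hv'.2], by linarith [hv'.1]⟩)
  rw [Real.deriv_exp, Real.exp_zero] at h1
  have e : psi p (β + τ) c t - psi p β c t * (1 - τ * p * t ^ (p - 1))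
      = t * Real.exp (-(β * p * t ^ (p - 1) + c)) *
        (Real.exp (-(τ * p * t ^ (p - 1))) - 1 - 1 * (-(τ * p * t ^ (p - 1)) - 0)) := by
    have : Real.exp (-((β + τ) * p * t ^ (p - 1) + c))
        = Real.exp (-(β * p * t ^ (p - 1) + c)) * Real.exp (-(τ * p * t ^ (p - 1))) := by
      rw [← Real.exp_add]; congr 1; ring
    rw [psi, psi, this]
    ring
  have e3 : Real.exp (-(β * p * t ^ (p - 1) + c)) ≤ Real.exp (|β| * p + |c|) := by
    refine Real.exp_le_exp.2 ((le_abs_self _).trans ?_)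
    rw [abs_neg]
    refine (abs_add_le _ _).trans (add_le_add ?_ le_rfl)
    rw [abs_mul, abs_mul, Nat.abs_cast]
    calc |β| * p * |t ^ (p - 1)| ≤ |β| * p * 1 := by gcongr
      _ = |β| * p := mul_one _
  rw [e, abs_mul, abs_mul, abs_of_nonneg ht.1, Real.abs_exp]
  calc t * Real.exp (-(β * p * t ^ (p - 1) + c)) *
        |Real.exp (-(τ * p * t ^ (p - 1))) - 1 - 1 * (-(τ * p * t ^ (p - 1)) - 0)|
      ≤ 1 * Real.exp (|β| * p + |c|) * (C * (|τ| * p) ^ 2) := by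
        gcongr
        · exact ht.2
        · refine h1.trans ?_
          rw [sub_zero, ← sq_abs, abs_neg]
          gcongr
    _ = Real.exp (|β| * p + |c|) * (C * p ^ 2) * τ ^ 2 := by
        rw [mul_pow, sq_abs]; ring

/-- Expressing the identity at `β + τ` through `psi` at `β` keeps the degenerate structure at `β`
available and isolates the first-order effect of `τ`. The error `τ ^ 2` is harmless at the scale `τ
= t ε^(k-1)`, where it is at most a multiple of `1 / N`. -/
theorem exists_perturbed_exchange_bound (p q : ℕ) [NeZero q] (β h R : ℝ) :
    ∃ C : ℝ, 0 ≤ C ∧ ∀ N : ℕ, N ≠ 0 → ∀ τ : ℝ, |τ| ≤ R → ∀ r r' : Fin q, r ≠ r' →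
      ∀ g : (Fin q → ℝ) → ℝ,
        |expect p q N (β + τ) h
            (fun t => psi p β (field h r) (t r) * (1 - τ * p * t r ^ (p - 1)) * g t)
          - expect p q N (β + τ) h (fun t => psi p β (field h r') (t r')
            * (1 - τ * p * t r' ^ (p - 1)) * g (shift N r r' t))|
        ≤ C * (1 / N + τ ^ 2) * (expect p q N (β + τ) h (fun t => |g t|)
          + expect p q N (β + τ) h (fun t => |g (shift N r r' t)|)) := by
  obtain ⟨C₁, hC₁, h₁⟩ := exists_exchange_bound p q h (|β| + R)
  choose C₂ hC₂ h₂ using fun r : Fin q => exists_psi_perturb_bound p β (field h r) R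
  have hS : ∀ r, C₂ r ≤ ∑ s, C₂ s := fun r =>
    Finset.single_le_sum (fun s _ => hC₂ s) (Finset.mem_univ r)
  have hS0 : 0 ≤ ∑ s, C₂ s := Finset.sum_nonneg fun s _ => hC₂ s
  refine ⟨C₁ + ∑ s, C₂ s, by positivity, fun N hN τ hτ r r' hr g => ?_⟩
  have hN0 : (0 : ℝ) < N := by exact_mod_cast Nat.pos_of_ne_zero hN
  have k1 := h₁ N hN (β + τ) ((abs_add_le _ _).trans (by gcongr)) r r' hr g
  have k2 : ∀ (s : Fin q) (G : (Fin q → ℝ) → ℝ),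
      |expect p q N (β + τ) h (fun t => psi p (β + τ) (field h s) (t s) * G t)
        - expect p q N (β + τ) h (fun t => psi p β (field h s) (t s)
            * (1 - τ * p * t s ^ (p - 1)) * G t)|
      ≤ (∑ s, C₂ s) * τ ^ 2 * expect p q N (β + τ) h (fun t => |G t|) := by
    intro s G
    rw [← expect_sub, ← expect_const_mul]
    refine abs_expect_le_of_mem hN fun t ht => ?_
    rw [← sub_mul, abs_mul]
    gcongr
    exact (h₂ s τ hτ (t s) ⟨ht.1 s, stdSimplex_le_one ht s⟩).trans (by gcongr; exact hS s)
  have k3 := k2 r g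
  have k4 := k2 r' (fun t => g (shift N r r' t))
  have n1 : 0 ≤ expect p q N (β + τ) h (fun t => |g t|) := expect_nonneg hN fun _ _ => abs_nonneg _
  have n2 : 0 ≤ expect p q N (β + τ) h (fun t => |g (shift N r r' t)|) :=
    expect_nonneg hN fun _ _ => abs_nonneg _
  set X1 := expect p q N (β + τ) h (fun t => |g t|)
  set X2 := expect p q N (β + τ) h (fun t => |g (shift N r r' t)|)
  set Y1 := expect p q N (β + τ) h (fun t => psi p (β + τ) (field h r) (t r) * g t)
  set Y2 := expect p q N (β + τ) h
    (fun t => psi p (β + τ) (field h r') (t r') * g (shift N r r' t))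
  set Z1 := expect p q N (β + τ) h
    (fun t => psi p β (field h r) (t r) * (1 - τ * p * t r ^ (p - 1)) * g t)
  set Z2 := expect p q N (β + τ) h (fun t => psi p β (field h r') (t r')
    * (1 - τ * p * t r' ^ (p - 1)) * g (shift N r r' t))
  have e : Z1 - Z2 = (Y1 - Y2) - (Y1 - Z1) + (Y2 - Z2) := by ring
  have a1 : 0 ≤ C₁ * τ ^ 2 * (X1 + X2) := by positivity
  have a2 : 0 ≤ (∑ s, C₂ s) * (1 / (N : ℝ)) * (X1 + X2) := by positivity
  have a3 : 0 ≤ C₁ * (1 / (N : ℝ)) * X1 := by positivity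
  calc |Z1 - Z2| ≤ |Y1 - Y2| + |Y1 - Z1| + |Y2 - Z2| := by
        rw [e]
        refine (abs_add_le _ _).trans ?_
        gcongr
        exact abs_sub _ _
    _ ≤ C₁ / N * X2 + (∑ s, C₂ s) * τ ^ 2 * X1 + (∑ s, C₂ s) * τ ^ 2 * X2 := by gcongr
    _ ≤ (C₁ + ∑ s, C₂ s) * (1 / N + τ ^ 2) * (X1 + X2) := by
        rw [div_eq_mul_one_div]
        nlinarith

/-! ### Exponential concentration of the magnetization -/

section Concentration

variable {p q N : ℕ} [NeZero q] {b h : ℝ}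

/-- The configurations of magnetization at distance at least `η` from `m`. -/
def farSet {q : ℕ} (m : Fin q → ℝ) (η : ℝ) : Set (Fin q → ℝ) := {t | ∃ r, η ≤ |t r - m r|}

theorem sum_comp_color (hN : N ≠ 0) (x : Fin N → Fin q) (f : Fin q → ℝ) :
    ∑ i, f (x i) = N * ∑ r, magnetization x r * f r := by
  have hN0 : (N : ℝ) ≠ 0 := by exact_mod_cast hN
  unfold magnetization
  rw [Finset.mul_sum]
  have : ∀ r : Fin q, (N : ℝ) * ((∑ i : Fin N, if x i = r then (1 : ℝ) else 0) / N * f r)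
      = ∑ i : Fin N, if x i = r then f r else 0 := by
    intro r
    rw [← mul_assoc, mul_div_cancel₀ _ hN0, Finset.sum_mul]
    simp only [ite_mul, one_mul, zero_mul]
  simp only [this]
  rw [Finset.sum_comm]
  simp

theorem magnetization_apply_pos (hN : N ≠ 0) (x : Fin N → Fin q) (i : Fin N) :
    0 < magnetization x (x i) := by
  unfold magnetization
  refine div_pos ?_ (by exact_mod_cast Nat.pos_of_ne_zero hN)
  refine Finset.sum_pos' (fun j _ => by split_ifs <;> norm_num) ⟨i, Finset.mem_univ i, by simp⟩

theorem prod_magnetization (hN : N ≠ 0) (x : Fin N → Fin q) {m : Fin q → ℝ}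
    (hm : ∀ i, 0 < m (x i)) :
    ∏ i, m (x i) = Real.exp (N * ∑ r, magnetization x r * Real.log (m r)) := by
  rw [← sum_comp_color hN x (fun r => Real.log (m r)), Real.exp_sum]
  exact Finset.prod_congr rfl fun i _ => (Real.exp_log (hm i)).symm

theorem sum_prod_eq_pow (m : Fin q → ℝ) :
    ∑ x : Fin N → Fin q, ∏ i, m (x i) = (∑ r, m r) ^ N :=
  (Fintype.sum_pow m N).symm

/-- Method of types: for each fixed vector of proportions the products are the weights of a product
probability measure and sum to `1`. There are at most `(N + 1)^q` vectors of proportions, and each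
summand on the left is among the summands for its own vector. -/
theorem sum_prod_magnetization_le (hN : N ≠ 0) :
    ∑ x : Fin N → Fin q, ∏ i, magnetization x (x i) ≤ ((N : ℝ) + 1) ^ q := by
  classical
  have hN0 : (N : ℝ) ≠ 0 := by exact_mod_cast hN
  set T : Finset (Fin q → Fin (N + 1)) := Finset.univ.filter fun n => ∑ r, (n r : ℕ) = N
  have cnt : ∀ x : Fin N → Fin q, ∃ n ∈ T, ∀ r, magnetization x r = ((n r : ℕ) : ℝ) / N := by
    intro x
    refine ⟨fun r => ⟨(Finset.univ.filter fun i => x i = r).card, ?_⟩, ?_, fun r => ?_⟩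
    · exact Nat.lt_succ_of_le ((Finset.card_filter_le _ _).trans (by simp))
    · simp only [T, Finset.mem_filter, Finset.mem_univ, true_and]
      rw [← Finset.card_eq_sum_card_fiberwise (fun i _ => Finset.mem_coe.2 (Finset.mem_univ (x i)))]
      simp
    · simp [magnetization]
  calc ∑ x : Fin N → Fin q, ∏ i, magnetization x (x i)
      ≤ ∑ x : Fin N → Fin q, ∑ n ∈ T, ∏ i, ((n (x i) : ℕ) : ℝ) / N := by
        refine Finset.sum_le_sum fun x _ => ?_
        obtain ⟨n, hn, hx⟩ := cnt x
        simp only [hx]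
        exact Finset.single_le_sum (f := fun n : Fin q → Fin (N + 1) =>
          ∏ i, ((n (x i) : ℕ) : ℝ) / N) (fun n _ => Finset.prod_nonneg fun i _ => by positivity) hn
    _ = ∑ n ∈ T, (∑ r, ((n r : ℕ) : ℝ) / N) ^ N := by
        rw [Finset.sum_comm]
        exact Finset.sum_congr rfl fun n _ => sum_prod_eq_pow (fun r => ((n r : ℕ) : ℝ) / N)
    _ = ∑ n ∈ T, 1 := by
        refine Finset.sum_congr rfl fun n hn => ?_
        have : ∑ r, (n r : ℕ) = N := by simpa [T] using hn
        rw [← Finset.sum_div, ← Nat.cast_sum, this, div_self hN0, one_pow]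
    _ ≤ ((N : ℝ) + 1) ^ q := by
        simp only [Finset.sum_const, nsmul_eq_mul, mul_one]
        have : T.card ≤ (N + 1) ^ q := by
          refine (Finset.card_filter_le _ _).trans ?_
          simp
        exact_mod_cast this

/-- Bernoulli's inequality for `t / m = 1 + (t - m) / m`. -/
theorem pow_tangent_le (hp : 1 ≤ p) {m t : ℝ} (hm : 0 < m) (ht : 0 ≤ t) :
    m ^ p + p * m ^ (p - 1) * (t - m) ≤ t ^ p := by
  have h := one_add_mul_le_pow (a := (t - m) / m) (by
    rw [le_div_iff₀ hm]; linarith) p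
  have e : 1 + (t - m) / m = t / m := by field_simp; ring
  rw [e, div_pow, le_div_iff₀ (by positivity)] at h
  refine le_trans (le_of_eq ?_) h
  obtain ⟨k, rfl⟩ : ∃ k, p = k + 1 := ⟨p - 1, by omega⟩
  simp only [Nat.add_sub_cancel, pow_succ]
  field_simp

/-- Each weight dominates `exp (N H(m))` times the mass of the configuration under the product
measure with marginal `m`: the power sum lies above its tangent plane at `m`, and the remaining
linear terms cancel because `m` is stationary on the simplex. Summing over configurations gives the
bound with no Stirling estimate. -/
theorem partition_ge (hp : 1 ≤ p) (hN : N ≠ 0) (hb : 0 ≤ b) {m : Fin q → ℝ}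
    (hm : m ∈ stdSimplex ℝ (Fin q)) (hpos : ∀ r, 0 < m r) {c : ℝ}
    (hstat : ∀ r, b * p * m r ^ (p - 1) + field h r - Real.log (m r) = c) :
    Real.exp (N * negFreeEnergy p q b h m) ≤ ∑ x : Fin N → Fin q, weight p q N b h x := by
  have key : ∀ x : Fin N → Fin q,
      Real.exp (N * negFreeEnergy p q b h m) * ∏ i, m (x i) ≤ weight p q N b h x := by
    intro x
    rw [prod_magnetization hN x (fun i => hpos _), ← Real.exp_add, weight_eq]
    refine Real.exp_le_exp.2 ?_
    rw [← mul_add]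
    refine mul_le_mul_of_nonneg_left ?_ (Nat.cast_nonneg _)
    set t := magnetization x
    have h1 : ∑ r, (m r ^ p + p * m r ^ (p - 1) * (t r - m r)) ≤ ∑ r, t r ^ p :=
      Finset.sum_le_sum fun r _ => pow_tangent_le hp (hpos r) (magnetization_nonneg x r)
    have h2 : ∑ r, (b * p * m r ^ (p - 1) + field h r - Real.log (m r)) * (t r - m r) = 0 := by
      simp only [hstat]
      rw [← Finset.mul_sum, Finset.sum_sub_distrib, hm.2, sum_magnetization hN x, sub_self,
        mul_zero]
    have h3 : ∑ r, field h r * (t r - m r) = h * (t 0 - m 0) := by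
      simp [field]
    have h4 : ∑ r, (b * p * m r ^ (p - 1) + field h r - Real.log (m r)) * (t r - m r)
        = b * ∑ r, p * m r ^ (p - 1) * (t r - m r) + ∑ r, field h r * (t r - m r)
          - ∑ r, t r * Real.log (m r) + ∑ r, m r * Real.log (m r) := by
      rw [Finset.mul_sum, ← Finset.sum_add_distrib, ← Finset.sum_sub_distrib,
        ← Finset.sum_add_distrib]
      exact Finset.sum_congr rfl fun r _ => by ring
    rw [Finset.sum_add_distrib] at h1
    have h5 := mul_le_mul_of_nonneg_left h1 hb
    unfold negFreeEnergy energy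
    rw [h4, h3] at h2
    linarith
  calc Real.exp (N * negFreeEnergy p q b h m)
      = ∑ x : Fin N → Fin q, Real.exp (N * negFreeEnergy p q b h m) * ∏ i, m (x i) := by
        rw [← Finset.mul_sum, sum_prod_eq_pow, hm.2, one_pow, mul_one]
    _ ≤ _ := Finset.sum_le_sum fun x _ => key x

theorem continuous_negFreeEnergy : Continuous (negFreeEnergy p q b h) := by
  unfold negFreeEnergy
  have := Real.continuous_mul_log
  have h2 : ∀ r : Fin q, Continuous fun t : Fin q → ℝ => t r * Real.log (t r) :=
    fun r => this.comp (continuous_apply r)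
  fun_prop

theorem exists_gap {m : Fin q → ℝ} (hm : IsUniqueMaximizer p q b h m) {η : ℝ} (hη : 0 < η) :
    ∃ c : ℝ, 0 < c ∧ ∀ t ∈ stdSimplex ℝ (Fin q), t ∈ farSet m η →
      negFreeEnergy p q b h t ≤ negFreeEnergy p q b h m - c := by
  have hcl : IsClosed (farSet m η) := by
    have : farSet m η = ⋃ r, {t | η ≤ |t r - m r|} := by ext; simp [farSet]
    rw [this]
    exact isClosed_iUnion_of_finite fun r => isClosed_le continuous_const (by fun_prop)
  have hK : IsCompact (stdSimplex ℝ (Fin q) ∩ farSet m η) :=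
    (isCompact_stdSimplex ℝ (Fin q)).inter_right hcl
  rcases (stdSimplex ℝ (Fin q) ∩ farSet m η).eq_empty_or_nonempty with he | hne
  · refine ⟨1, one_pos, fun t ht ht' => ?_⟩
    have : t ∈ stdSimplex ℝ (Fin q) ∩ farSet m η := ⟨ht, ht'⟩
    simp [he] at this
  · obtain ⟨t₀, ht₀, hmax⟩ := hK.exists_isMaxOn hne continuous_negFreeEnergy.continuousOn
    have hlt : negFreeEnergy p q b h t₀ < negFreeEnergy p q b h m := by
      refine hm.2 t₀ ht₀.1 ?_
      rintro rfl
      obtain ⟨r, hr⟩ := ht₀.2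
      simp at hr
      linarith
    exact ⟨negFreeEnergy p q b h m - negFreeEnergy p q b h t₀, by linarith,
      fun t ht ht' => by have := hmax ⟨ht, ht'⟩; simp only [Set.mem_ofPred_eq] at this; linarith⟩

/-- The weight of a configuration with magnetization `t` is `exp (N H(t))` times its mass under the
product measure with marginal `t`. Away from `m` the first factor loses `exp (-dN)` by compactness,
and the second factors sum to at most a polynomial by counting types. -/
theorem expect_far_le (hp : 1 ≤ p) (hb : 0 ≤ b) {m : Fin q → ℝ}
    (hm : IsUniqueMaximizer p q b h m) (hpos : ∀ r, 0 < m r) {c : ℝ}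
    (hstat : ∀ r, b * p * m r ^ (p - 1) + field h r - Real.log (m r) = c) {η : ℝ} (hη : 0 < η) :
    ∃ c : ℝ, 0 < c ∧ ∀ N : ℕ, N ≠ 0 →
      expect p q N b h ((farSet m η).indicator 1) ≤ ((N : ℝ) + 1) ^ q * Real.exp (-(c * N)) := by
  obtain ⟨d, hd, hgap⟩ := exists_gap hm hη
  refine ⟨d, hd, fun N hN => ?_⟩
  have hZ := partition_ge hp hN hb hm.1 hpos hstat
  have key : ∀ x : Fin N → Fin q,
      weight p q N b h x * (farSet m η).indicator 1 (magnetization x)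
        ≤ Real.exp (N * (negFreeEnergy p q b h m - d)) * ∏ i, magnetization x (x i) := by
    intro x
    by_cases hx : magnetization x ∈ farSet m η
    · rw [Set.indicator_of_mem hx, Pi.one_apply, mul_one,
        prod_magnetization hN x (magnetization_apply_pos hN x), ← Real.exp_add, weight_eq]
      refine Real.exp_le_exp.2 ?_
      rw [← mul_add]
      refine mul_le_mul_of_nonneg_left ?_ (Nat.cast_nonneg _)
      have := hgap _ (magnetization_mem_stdSimplex hN x) hx
      unfold negFreeEnergy at this
      unfold energy negFreeEnergy
      linarith
    · rw [Set.indicator_of_notMem hx, mul_zero]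
      exact mul_nonneg (Real.exp_pos _).le
        (Finset.prod_nonneg fun i _ => magnetization_nonneg x _)
  have hsum : ∑ x : Fin N → Fin q, weight p q N b h x * (farSet m η).indicator 1 (magnetization x)
      ≤ Real.exp (N * (negFreeEnergy p q b h m - d)) * ((N : ℝ) + 1) ^ q := by
    refine (Finset.sum_le_sum fun x _ => key x).trans ?_
    rw [← Finset.mul_sum]
    exact mul_le_mul_of_nonneg_left (sum_prod_magnetization_le hN) (Real.exp_pos _).le
  have e : expect p q N b h ((farSet m η).indicator 1)
      = (∑ x : Fin N → Fin q, weight p q N b h x * (farSet m η).indicator 1 (magnetization x))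
        / ∑ x : Fin N → Fin q, weight p q N b h x := by
    rw [Finset.sum_div]
    exact Finset.sum_congr rfl fun x _ => by rw [prob]; ring
  rw [e, div_le_iff₀ (partition_pos p q N b h)]
  refine hsum.trans ?_
  calc Real.exp (N * (negFreeEnergy p q b h m - d)) * ((N : ℝ) + 1) ^ q
      = ((N : ℝ) + 1) ^ q * Real.exp (-(d * N)) * Real.exp (N * negFreeEnergy p q b h m) := by
        rw [mul_assoc, ← Real.exp_add, mul_comm]; congr 2; ring
    _ ≤ _ := by gcongr

theorem sum_pow_mem_Icc (hp : 1 ≤ p) {t : Fin q → ℝ} (ht : t ∈ stdSimplex ℝ (Fin q)) :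
    ∑ r, t r ^ p ∈ Set.Icc (0 : ℝ) 1 := by
  refine ⟨Finset.sum_nonneg fun r _ => pow_nonneg (ht.1 r) _, ?_⟩
  rw [← ht.2]
  exact Finset.sum_le_sum fun r _ =>
    pow_le_of_le_one (ht.1 r) (stdSimplex_le_one ht r) (by omega)

/-- The power sum lies in `[0, 1]`, so both a weight and the partition function change by at most a
factor `exp (|τ| N)`. -/
theorem expect_perturb_le (hp : 1 ≤ p) (hN : N ≠ 0) (τ : ℝ) {F : (Fin q → ℝ) → ℝ}
    (hF : ∀ t, 0 ≤ F t) :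
    expect p q N (b + τ) h F ≤ Real.exp (2 * (|τ| * N)) * expect p q N b h F := by
  have hw : ∀ (b τ : ℝ) (x : Fin N → Fin q),
      weight p q N (b + τ) h x ≤ Real.exp (|τ| * N) * weight p q N b h x := by
    intro b τ x
    unfold weight
    rw [← Real.exp_add]
    refine Real.exp_le_exp.2 ?_
    have hS := sum_pow_mem_Icc hp (magnetization_mem_stdSimplex hN x)
    have : τ * N * ∑ r, magnetization x r ^ p ≤ |τ| * N := by
      calc τ * N * ∑ r, magnetization x r ^ p ≤ |τ| * N * 1 := by
            gcongr
            · exact hS.1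
            · exact le_abs_self τ
            · exact hS.2
        _ = |τ| * N := mul_one _
    linarith
  have hZ : ∑ x : Fin N → Fin q, weight p q N b h x
      ≤ Real.exp (|τ| * N) * ∑ x : Fin N → Fin q, weight p q N (b + τ) h x := by
    rw [Finset.mul_sum]
    refine Finset.sum_le_sum fun x _ => ?_
    have := hw (b + τ) (-τ) x
    rwa [add_neg_cancel_right, abs_neg] at this
  unfold expect
  rw [Finset.mul_sum]
  refine Finset.sum_le_sum fun x _ => ?_
  rw [← mul_assoc]
  refine mul_le_mul_of_nonneg_right ?_ (hF _)
  unfold prob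
  rw [← mul_div_assoc, div_le_div_iff₀ (partition_pos p q N _ h) (partition_pos p q N b h)]
  calc weight p q N (b + τ) h x * ∑ x : Fin N → Fin q, weight p q N b h x
      ≤ (Real.exp (|τ| * N) * weight p q N b h x)
        * (Real.exp (|τ| * N) * ∑ x : Fin N → Fin q, weight p q N (b + τ) h x) :=
        mul_le_mul (hw b τ x) hZ (partition_pos p q N b h).le
          (mul_nonneg (Real.exp_pos _).le (weight_pos x).le)
    _ = _ := by
        rw [show 2 * (|τ| * N) = |τ| * N + |τ| * N by ring, Real.exp_add]; ring

theorem exists_expect_far_le_div (hp : 1 ≤ p) (hb : 0 ≤ b) {m : Fin q → ℝ}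
    (hm : IsUniqueMaximizer p q b h m) (hpos : ∀ r, 0 < m r) {c : ℝ}
    (hstat : ∀ r, b * p * m r ^ (p - 1) + field h r - Real.log (m r) = c) {η : ℝ} (hη : 0 < η)
    (R : ℝ) :
    ∃ C : ℝ, 0 ≤ C ∧ ∀ N : ℕ, N ≠ 0 → ∀ τ : ℝ, |τ| * N ≤ R * √N →
      expect p q N (b + τ) h ((farSet m η).indicator 1) ≤ C / N := by
  obtain ⟨d, hd, hfar⟩ := expect_far_le hp hb hm hpos hstat hη
  refine ⟨(q + 1).factorial * (2 / d) ^ (q + 1) * Real.exp (d / 2 + 2 * R ^ 2 / d),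
    by positivity, fun N hN τ hτ => ?_⟩
  have hN0 : (0 : ℝ) < N := by exact_mod_cast Nat.pos_of_ne_zero hN
  have h1 := expect_perturb_le (b := b) (h := h) (q := q) hp hN τ
    (F := (farSet m η).indicator 1) (fun t => Set.indicator_nonneg (fun _ _ => zero_le_one) t)
  have h2 := hfar N hN
  -- Completing the square in `√N`: the perturbation consumes at most half of the exponential rate
  -- `d`.
  have h3 : 2 * (|τ| * N) ≤ d * N / 2 + 2 * R ^ 2 / d := by
    have hs := Real.sq_sqrt hN0.le
    have : 2 * (R * √N) ≤ d * N / 2 + 2 * R ^ 2 / d := by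
      have : 0 ≤ (d * √N - 2 * R) ^ 2 / (2 * d) := by positivity
      have e : (d * √N - 2 * R) ^ 2 / (2 * d)
          = d * √N ^ 2 / 2 + 2 * R ^ 2 / d - 2 * (R * √N) := by field_simp; ring
      rw [e, hs] at this
      linarith
    linarith
  -- The other half of the rate absorbs `(N + 1)^(q + 1)`: the power `q` counts types and the
  -- additional one produces the factor `1 / N`.
  have h4 := Real.pow_div_factorial_le_exp (d / 2 * (N + 1)) (by positivity) (q + 1)
  rw [div_le_iff₀ (by positivity), mul_pow] at h4
  have h5 : ((N : ℝ) + 1) ^ (q + 1)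
      ≤ (2 / d) ^ (q + 1) * (Real.exp (d / 2 * (N + 1)) * (q + 1).factorial) := by
    calc ((N : ℝ) + 1) ^ (q + 1)
        = (2 / d) ^ (q + 1) * ((d / 2) ^ (q + 1) * ((N : ℝ) + 1) ^ (q + 1)) := by
          rw [← mul_assoc, ← mul_pow]; field_simp; simp
      _ ≤ _ := by gcongr
  rw [le_div_iff₀ hN0]
  calc expect p q N (b + τ) h ((farSet m η).indicator 1) * N
      ≤ Real.exp (d * N / 2 + 2 * R ^ 2 / d) * (((N : ℝ) + 1) ^ q * Real.exp (-(d * N)))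
        * (N + 1) := by
        gcongr
        · refine h1.trans ?_
          gcongr
          exact expect_nonneg hN fun t _ => Set.indicator_nonneg (fun _ _ => zero_le_one) t
        · linarith
    _ = Real.exp (2 * R ^ 2 / d - d * N / 2) * ((N : ℝ) + 1) ^ (q + 1) := by
        have : Real.exp (2 * R ^ 2 / d - d * N / 2)
            = Real.exp (d * N / 2 + 2 * R ^ 2 / d) * Real.exp (-(d * N)) := by
          rw [← Real.exp_add]; congr 1; ring
        rw [this, pow_succ]; ring
    _ ≤ Real.exp (2 * R ^ 2 / d - d * N / 2) *
        ((2 / d) ^ (q + 1) * (Real.exp (d / 2 * (N + 1)) * (q + 1).factorial)) := by gcongr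
    _ = _ := by
        have : Real.exp (d / 2 + 2 * R ^ 2 / d)
            = Real.exp (2 * R ^ 2 / d - d * N / 2) * Real.exp (d / 2 * (N + 1)) := by
          rw [← Real.exp_add]; congr 1; ring
        rw [this]; ring

end Concentration

/-! ### Critical points and moment bounds -/

/-- The vector `(a, b, …, b)`. -/
def twoLevel {q : ℕ} [NeZero q] (a b : ℝ) (r : Fin q) : ℝ := if r = 0 then a else b

/-- The difference of the functions `ψ` of the first and the other colours at the probability
vector with first entry `x` and all other entries equal. -/
def drift (p q : ℕ) (β h x : ℝ) : ℝ := psi p β h x - psi p β 0 ((1 - x) / (q - 1))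

/-- The unique maximizer of the negative free energy is `(a, b, …, b)`, the free energy is
degenerate to order `k` in the direction of the first colour with leading coefficient `κ`, and is
not degenerate in the transverse directions. -/
structure CriticalPoint (p q : ℕ) [NeZero q] (β h a b κ : ℝ) (k : ℕ) : Prop where
  two_le_p : 2 ≤ p
  two_le_q : 2 ≤ q
  beta_pos : 0 < β
  a_pos : 0 < a
  b_pos : 0 < b
  sum_eq : a + (q - 1) * b = 1
  isMax : IsUniqueMaximizer p q β h (twoLevel a b)
  stat : psi p β h a = psi p β 0 b
  nondeg : 3 ≤ q → β * p * (p - 1) * b ^ (p - 1) < 1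
  even_k : Even k
  four_le_k : 4 ≤ k
  kappa_pos : 0 < κ
  tendsto_drift : Tendsto (fun x => drift p q β h x / (x - a) ^ (k - 1)) (𝓝[≠] a)
    (𝓝 (κ * psi p β 0 b))

theorem psi_abs_le (p : ℕ) (β c : ℝ) {t : ℝ} (ht : t ∈ Set.Icc (0 : ℝ) 1) :
    |psi p β c t| ≤ Real.exp (|β| * p + |c|) := by
  have hpw : |t ^ (p - 1)| ≤ 1 := by
    rw [abs_pow, abs_of_nonneg ht.1]
    exact pow_le_one₀ ht.1 ht.2
  have e3 : Real.exp (-(β * p * t ^ (p - 1) + c)) ≤ Real.exp (|β| * p + |c|) := by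
    refine Real.exp_le_exp.2 ((le_abs_self _).trans ?_)
    rw [abs_neg]
    refine (abs_add_le _ _).trans (add_le_add ?_ le_rfl)
    rw [abs_mul, abs_mul, Nat.abs_cast]
    calc |β| * p * |t ^ (p - 1)| ≤ |β| * p * 1 := by gcongr
      _ = |β| * p := mul_one _
  rw [psi, abs_mul, abs_of_nonneg ht.1, Real.abs_exp]
  calc t * Real.exp (-(β * p * t ^ (p - 1) + c)) ≤ 1 * Real.exp (|β| * p + |c|) := by
        gcongr
        exact ht.2
    _ = _ := one_mul _

theorem contDiff_psi (p : ℕ) (β c : ℝ) {n : WithTop ℕ∞} : ContDiff ℝ n (psi p β c) := by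
  unfold psi
  fun_prop

theorem deriv_psi {p : ℕ} (hp : 2 ≤ p) (β c t : ℝ) :
    deriv (psi p β c) t
      = Real.exp (-(β * p * t ^ (p - 1) + c)) * (1 - β * p * (p - 1) * t ^ (p - 1)) := by
  obtain ⟨n, rfl⟩ : ∃ n, p = n + 2 := ⟨p - 2, by omega⟩
  have h1 : HasDerivAt (fun t : ℝ => -(β * (n + 2 : ℕ) * t ^ (n + 1) + c))
      (-(β * (n + 2 : ℕ) * ((n + 1 : ℕ) * t ^ n))) t := by
    have := (((hasDerivAt_pow (n + 1) t).const_mul (β * (n + 2 : ℕ))).add_const c).fun_neg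
    simpa only [Nat.add_sub_cancel] using this
  have h2 := (hasDerivAt_id t).mul h1.exp
  have h3 : HasDerivAt (psi (n + 2) β c) _ t := h2
  rw [h3.deriv]
  simp only [id, show n + 2 - 1 = n + 1 by omega]
  push_cast
  ring

theorem exists_local_monotone_bound {f : ℝ → ℝ} (hf : ContDiff ℝ 1 f) {b : ℝ}
    (hb : 0 < deriv f b) :
    ∃ c : ℝ, 0 < c ∧ ∃ η : ℝ, 0 < η ∧ ∀ x y : ℝ, |x - b| < η → |y - b| < η →
      c * (x - y) ^ 2 ≤ (f x - f y) * (x - y) := by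
  have hc : ContinuousAt (deriv f) b := (hf.continuous_deriv le_rfl).continuousAt
  obtain ⟨η, hη, hball⟩ := Metric.eventually_nhds_iff.1
    (hc.eventually (lt_mem_nhds (show deriv f b / 2 < deriv f b by linarith)))
  refine ⟨deriv f b / 2, by linarith, η, hη, ?_⟩
  have main : ∀ x y : ℝ, |x - b| < η → |y - b| < η → x ≤ y →
      deriv f b / 2 * (y - x) ≤ f y - f x := by
    intro x y hx hy hxy
    have hd : Differentiable ℝ f := hf.differentiable (by norm_num)
    refine (convex_Icc x y).mul_sub_le_image_sub_of_le_deriv hd.continuous.continuousOn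
      hd.differentiableOn (fun z hz => ?_) x (Set.left_mem_Icc.2 hxy) y
      (Set.right_mem_Icc.2 hxy) hxy
    have hz' := interior_subset hz
    refine (hball ?_).le
    rw [Real.dist_eq]
    rw [abs_lt] at *
    exact ⟨by linarith [hz'.1], by linarith [hz'.2]⟩
  intro x y hx hy
  rcases le_total x y with h | h
  · have := main x y hx hy h
    nlinarith
  · have := main y x hy hx h
    nlinarith

/-! ### Concentration and transverse fluctuations at a critical point. -/

/-- The sum of the squared differences of the entries other than the first one. -/
def spread {q : ℕ} [NeZero q] (t : Fin q → ℝ) : ℝ :=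
  ∑ r ∈ Finset.univ.erase (0 : Fin q), ∑ r' ∈ Finset.univ.erase (0 : Fin q), (t r - t r') ^ 2

theorem spread_nonneg {q : ℕ} [NeZero q] (t : Fin q → ℝ) : 0 ≤ spread t :=
  Finset.sum_nonneg fun _ _ => Finset.sum_nonneg fun _ _ => sq_nonneg _

section

variable {p q : ℕ} [NeZero q] {β h a b κ : ℝ} {k : ℕ}

theorem card_erase_zero (q : ℕ) [NeZero q] :
    ((Finset.univ.erase (0 : Fin q)).card : ℝ) = q - 1 := by
  rw [Finset.card_erase_of_mem (Finset.mem_univ _), Finset.card_univ, Fintype.card_fin,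
    Nat.cast_sub (Nat.one_le_iff_ne_zero.2 (NeZero.ne q)), Nat.cast_one]

theorem sum_erase_zero {t : Fin q → ℝ} (ht : t ∈ stdSimplex ℝ (Fin q)) :
    ∑ r ∈ Finset.univ.erase (0 : Fin q), t r = 1 - t 0 := by
  rw [← ht.2, ← Finset.add_sum_erase _ _ (Finset.mem_univ (0 : Fin q))]
  ring

namespace CriticalPoint

variable (H : CriticalPoint p q β h a b κ k)

include H

theorem one_le_q_sub_one : (1 : ℝ) ≤ q - 1 := by
  have : (2 : ℝ) ≤ q := by exact_mod_cast H.two_le_q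
  linarith

theorem twoLevel_pos (r : Fin q) : 0 < twoLevel a b r := by
  unfold twoLevel
  split_ifs
  exacts [H.a_pos, H.b_pos]

theorem psi_b_pos : 0 < psi p β 0 b := mul_pos H.b_pos (Real.exp_pos _)

/-- The Lagrange expression on the left is `-log psi`, so equality of the values of `psi` is the
first-order condition on the simplex. -/
theorem stationary (r : Fin q) :
    β * p * twoLevel a b r ^ (p - 1) + field h r - Real.log (twoLevel a b r)
      = -Real.log (psi p β 0 b) := by
  have key : ∀ c x : ℝ, 0 < x → β * p * x ^ (p - 1) + c - Real.log x
      = -Real.log (psi p β c x) := by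
    intro c x hx
    rw [psi, Real.log_mul hx.ne' (Real.exp_pos _).ne', Real.log_exp]
    ring
  unfold twoLevel field
  split_ifs
  · rw [key h a H.a_pos, H.stat]
  · exact key 0 b H.b_pos

theorem eps_le_one {N : ℕ} (hN : N ≠ 0) {ε : ℝ} (he : ε ^ k * N = 1) : ε ≤ 1 := by
  have hN1 : (1 : ℝ) ≤ N := by exact_mod_cast Nat.one_le_iff_ne_zero.2 hN
  by_contra hlt
  have : 1 < ε ^ k := one_lt_pow₀ (not_le.1 hlt) (by have := H.four_le_k; omega)
  nlinarith

theorem exists_expect_far_le {η : ℝ} (hη : 0 < η) (t : ℝ) :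
    ∃ C : ℝ, 0 ≤ C ∧ ∀ N : ℕ, N ≠ 0 → ∀ ε : ℝ, 0 < ε → ε ^ k * N = 1 →
      expect p q N (β + t * ε ^ (k - 1)) h ((farSet (twoLevel a b) η).indicator 1)
        ≤ C * ε ^ k := by
  obtain ⟨C, hC, hfar⟩ := exists_expect_far_le_div (by have := H.two_le_p; omega)
    H.beta_pos.le H.isMax H.twoLevel_pos H.stationary hη |t|
  refine ⟨C, hC, fun N hN ε hε he => ?_⟩
  have hk := H.four_le_k
  have hN0 : (0 : ℝ) < N := by exact_mod_cast Nat.pos_of_ne_zero hN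
  have hε1 := H.eps_le_one hN he
  have e1 : ε ^ k = 1 / N := by field_simp; linarith
  rw [e1, ← div_eq_mul_one_div]
  refine hfar N hN _ ?_
  rw [abs_mul, abs_of_pos (pow_pos hε _), mul_assoc]
  refine mul_le_mul_of_nonneg_left ?_ (abs_nonneg t)
  -- Here `ε ^ (k - 1) * N = 1 / ε`, and `1 / ε ^ 2 ≤ 1 / ε ^ k = N`; so the perturbation is within
  -- the range `O(√N)` that concentration tolerates.
  refine Real.le_sqrt_of_sq_le ?_
  have e2 : ε ^ (k - 1) * N * ε = 1 := by
    rw [← he]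
    obtain ⟨j, rfl⟩ : ∃ j, k = j + 1 := ⟨k - 1, by omega⟩
    simp only [Nat.add_sub_cancel, pow_succ]; ring
  have e3 : ε ^ (k - 1) * N = 1 / ε := by field_simp; linarith
  have e4 : (N : ℝ) = 1 / ε ^ k := by field_simp; linarith
  rw [e3, div_pow, one_pow, e4]
  exact one_div_le_one_div_of_le (pow_pos hε _) (pow_le_pow_of_le_one hε.le hε1 (by omega))

/-- Exchange between `r` and `r'` tested on `x r - x r'`. By `nondeg`, `psi` is strictly increasing
near `b`, so `(ψ(x r) - ψ(x r')) (x r - x r')` dominates a multiple of the square near the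
maximizer, while the exchange identity makes its mean `O(1/N)`. With two colours there is nothing to
prove. -/
theorem exists_transverse_bound (t : ℝ) (r r' : Fin q) (hr : r ≠ 0) (hr' : r' ≠ 0) :
    ∃ C : ℝ, 0 ≤ C ∧ ∀ N : ℕ, N ≠ 0 → ∀ ε : ℝ, 0 < ε → ε ^ k * N = 1 →
      expect p q N (β + t * ε ^ (k - 1)) h (fun x => (x r - x r') ^ 2) ≤ C * ε ^ k := by
  by_cases hrr : r = r'
  · refine ⟨0, le_rfl, fun N hN ε hε he => ?_⟩
    subst hrr
    simp [expect]
  have hq : 3 ≤ q := by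
    by_contra hlt
    have h2 : q = 2 := by have := H.two_le_q; omega
    subst h2
    have hr1 : r = 1 := by omega
    have hr1' : r' = 1 := by omega
    exact hrr (hr1.trans hr1'.symm)
  have hk := H.four_le_k
  have hd : 0 < deriv (psi p β 0) b := by
    rw [deriv_psi H.two_le_p]
    exact mul_pos (Real.exp_pos _) (by linarith [H.nondeg hq])
  obtain ⟨c, hc, η, hη, hmono⟩ := exists_local_monotone_bound (contDiff_psi p β 0) hd
  obtain ⟨Cf, hCf, hfar⟩ := H.exists_expect_far_le hη t
  obtain ⟨Ce, hCe, hex⟩ := exists_perturbed_exchange_bound p q β h |t|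
  set M := Real.exp (|β| * p + |(0 : ℝ)|) with hM
  have hM0 : 0 < M := Real.exp_pos _
  -- The constant: collect the error terms.
  refine ⟨(4 * Ce * (1 + t ^ 2) + 2 * M * (1 + |t| * p) + 2 * (M * p) ^ 2 * t ^ 2 / c
    + (c + 2 * M) * Cf) * (2 / c), by positivity, fun N hN ε hε he => ?_⟩
  have hN0 : (0 : ℝ) < N := by exact_mod_cast Nat.pos_of_ne_zero hN
  have hN1 : (1 : ℝ) ≤ N := by exact_mod_cast Nat.one_le_iff_ne_zero.2 hN
  have hε1 := H.eps_le_one hN he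
  have e1 : 1 / (N : ℝ) = ε ^ k := by field_simp; linarith
  have hek1 : ε ^ k ≤ 1 := pow_le_one₀ hε.le hε1
  have hek0 : 0 < ε ^ k := pow_pos hε _
  set τ := t * ε ^ (k - 1) with hτ
  have hτt : |τ| ≤ |t| := by
    rw [hτ, abs_mul, abs_of_pos (pow_pos hε _)]
    exact mul_le_of_le_one_right (abs_nonneg t) (pow_le_one₀ hε.le hε1)
  have hτ2 : τ ^ 2 ≤ t ^ 2 * ε ^ k := by
    rw [hτ, mul_pow, ← pow_mul]
    exact mul_le_mul_of_nonneg_left (pow_le_pow_of_le_one hε.le hε1 (by omega)) (sq_nonneg t)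
  have hfN := hfar N hN ε hε he
  have hx := hex N hN τ hτt r r' hrr (fun x => x r - x r')
  set E := expect p q N (β + τ) h with hE
  have hf : ∀ s : Fin q, s ≠ 0 → field h s = 0 := fun s hs => by simp [field, hs]
  rw [hf r hr, hf r' hr'] at hx
  -- The exchange raises one entry and lowers the other, so the difference moves by `2 / N`.
  have hsh : ∀ x : Fin q → ℝ, shift N r r' x r - shift N r r' x r' = x r - x r' + 2 * ε ^ k := by
    intro x
    rw [← e1]
    simp [shift, hrr, Ne.symm hrr]
    ring
  simp only [hsh] at hx
  have hcol : ∀ x ∈ stdSimplex ℝ (Fin q), |x r - x r'| ≤ 1 := by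
    intro x hx
    have h1 := stdSimplex_le_one hx r
    have h2 := stdSimplex_le_one hx r'
    rw [abs_le]
    exact ⟨by linarith [hx.1 r], by linarith [hx.1 r']⟩
  have hg1 : E (fun x => |x r - x r'|) ≤ 1 := by
    rw [← expect_const (p := p) (q := q) (N := N) (b := β + τ) (h := h) 1]
    exact expect_mono_of_mem hN hcol
  have hg2 : E (fun x => |x r - x r' + 2 * ε ^ k|) ≤ 3 := by
    rw [← expect_const (p := p) (q := q) (N := N) (b := β + τ) (h := h) 3]
    refine expect_mono_of_mem hN fun x hx => (abs_add_le _ _).trans ?_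
    rw [abs_of_pos (show 0 < 2 * ε ^ k by positivity)]
    linarith [hcol x hx]
  set χ : ℝ → ℝ := fun y => psi p β 0 y * (1 - τ * p * y ^ (p - 1)) with hχ
  have hχb : ∀ y ∈ Set.Icc (0 : ℝ) 1, |χ y| ≤ M * (1 + |t| * p) := by
    intro y hy
    rw [hχ, abs_mul]
    refine mul_le_mul (psi_abs_le p β 0 hy) ?_ (abs_nonneg _) hM0.le
    refine (abs_sub _ _).trans ?_
    rw [abs_one, abs_mul, abs_mul, Nat.abs_cast, abs_pow, abs_of_nonneg hy.1]
    refine add_le_add le_rfl ?_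
    calc |τ| * p * y ^ (p - 1) ≤ |t| * p * 1 :=
          mul_le_mul (mul_le_mul_of_nonneg_right hτt (Nat.cast_nonneg p))
            (pow_le_one₀ hy.1 hy.2) (pow_nonneg hy.1 _) (by positivity)
      _ = |t| * p := mul_one _
  -- The main inequality in expectation.
  have hmain : E (fun x => (χ (x r) - χ (x r')) * (x r - x r'))
      ≤ (4 * Ce * (1 + t ^ 2) + 2 * M * (1 + |t| * p)) * ε ^ k := by
    have e2 : E (fun x => (χ (x r) - χ (x r')) * (x r - x r'))
        = (E (fun x => psi p β 0 (x r) * (1 - τ * p * x r ^ (p - 1)) * (x r - x r'))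
          - E (fun x => psi p β 0 (x r') * (1 - τ * p * x r' ^ (p - 1))
            * (x r - x r' + 2 * ε ^ k))) + E (fun x => 2 * ε ^ k * χ (x r')) := by
      rw [hE, ← expect_sub, ← expect_add]
      congr 1
      funext x
      simp only [hχ]
      ring
    have e3 : E (fun x => 2 * ε ^ k * χ (x r')) ≤ 2 * M * (1 + |t| * p) * ε ^ k := by
      rw [← expect_const (p := p) (q := q) (N := N) (b := β + τ) (h := h)
        (2 * M * (1 + |t| * p) * ε ^ k)]
      refine expect_mono_of_mem hN fun x hx => ?_
      have := (le_abs_self _).trans (hχb (x r') ⟨hx.1 r', stdSimplex_le_one hx r'⟩)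
      nlinarith
    rw [e2]
    have e4 := (le_abs_self _).trans hx
    have e5 : Ce * (1 / N + τ ^ 2) * (E (fun x => |x r - x r'|)
        + E (fun x => |x r - x r' + 2 * ε ^ k|)) ≤ Ce * (ε ^ k + t ^ 2 * ε ^ k) * (1 + 3) := by
      have n1 : 0 ≤ E (fun x => |x r - x r'|) := expect_nonneg hN fun _ _ => abs_nonneg _
      have n2 : 0 ≤ E (fun x => |x r - x r' + 2 * ε ^ k|) :=
        expect_nonneg hN fun _ _ => abs_nonneg _
      rw [e1]
      gcongr
    linarith
  -- The pointwise lower bound.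
  have hpt : ∀ x ∈ stdSimplex ℝ (Fin q), c / 2 * (x r - x r') ^ 2
      ≤ (χ (x r) - χ (x r')) * (x r - x r') + 2 * (M * p) ^ 2 * t ^ 2 / c * ε ^ k
        + (c + 2 * M) * (farSet (twoLevel a b) η).indicator 1 x := by
    intro x hx
    have hxr : x r ∈ Set.Icc (0 : ℝ) 1 := ⟨hx.1 r, stdSimplex_le_one hx r⟩
    have hxr' : x r' ∈ Set.Icc (0 : ℝ) 1 := ⟨hx.1 r', stdSimplex_le_one hx r'⟩
    set d := x r - x r' with hdd
    have hd1 : |d| ≤ 1 := hcol x hx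
    have b1 : c * d ^ 2 ≤ (psi p β 0 (x r) - psi p β 0 (x r')) * d
        + (c + 2 * M) * (farSet (twoLevel a b) η).indicator 1 x := by
      by_cases hm : x ∈ farSet (twoLevel a b) η
      · rw [Set.indicator_of_mem hm, Pi.one_apply, mul_one]
        have h1 : |(psi p β 0 (x r) - psi p β 0 (x r')) * d| ≤ 2 * M * 1 := by
          rw [abs_mul]
          refine mul_le_mul ((abs_sub _ _).trans ?_) hd1 (abs_nonneg _) (by positivity)
          linarith [psi_abs_le p β 0 hxr, psi_abs_le p β 0 hxr']
        have h2 : d ^ 2 ≤ 1 := by rw [← sq_abs]; exact pow_le_one₀ (abs_nonneg _) hd1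
        have h3 := (abs_le.1 h1).1
        nlinarith
      · rw [Set.indicator_of_notMem hm, mul_zero, add_zero]
        simp only [farSet, Set.mem_ofPred_eq, not_exists, not_le] at hm
        refine hmono _ _ ?_ ?_
        · simpa [twoLevel, hr] using hm r
        · simpa [twoLevel, hr'] using hm r'
    -- Young's inequality: the term linear in `τ` is split between half of the coercive square and
    -- `O(τ ^ 2)`, which is `O(ε ^ k)`.
    have b2 : |τ * p * (psi p β 0 (x r) * x r ^ (p - 1) - psi p β 0 (x r') * x r' ^ (p - 1)) * d|
        ≤ c / 2 * d ^ 2 + 2 * (M * p) ^ 2 * t ^ 2 / c * ε ^ k := by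
      have b3 : ∀ y ∈ Set.Icc (0 : ℝ) 1, |psi p β 0 y * y ^ (p - 1)| ≤ M := by
        intro y hy
        rw [abs_mul, abs_pow, abs_of_nonneg hy.1]
        calc |psi p β 0 y| * y ^ (p - 1) ≤ M * 1 :=
              mul_le_mul (psi_abs_le p β 0 hy) (pow_le_one₀ hy.1 hy.2) (pow_nonneg hy.1 _) hM0.le
          _ = M := mul_one _
      have b4 : |τ * p * (psi p β 0 (x r) * x r ^ (p - 1) - psi p β 0 (x r') * x r' ^ (p - 1)) * d|
          ≤ |τ| * p * (2 * M) * |d| := by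
        rw [abs_mul, abs_mul, abs_mul, Nat.abs_cast]
        gcongr
        refine (abs_sub _ _).trans ?_
        linarith [b3 _ hxr, b3 _ hxr']
      have b5 : |τ| * p * (2 * M) * |d| ≤ c / 2 * d ^ 2 + 2 * (M * p) ^ 2 / c * τ ^ 2 := by
        have : 0 ≤ (c * |d| - 2 * (M * p) * |τ|) ^ 2 / (2 * c) := by positivity
        have e : (c * |d| - 2 * (M * p) * |τ|) ^ 2 / (2 * c)
            = c / 2 * |d| ^ 2 + 2 * (M * p) ^ 2 / c * |τ| ^ 2 - |τ| * p * (2 * M) * |d| := by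
          field_simp; ring
        rw [e, sq_abs, sq_abs] at this
        linarith
      have b6 : 2 * (M * p) ^ 2 / c * τ ^ 2 ≤ 2 * (M * p) ^ 2 / c * (t ^ 2 * ε ^ k) := by gcongr
      calc _ ≤ _ := b4
        _ ≤ _ := b5
        _ ≤ c / 2 * d ^ 2 + 2 * (M * p) ^ 2 / c * (t ^ 2 * ε ^ k) := by linarith
        _ = _ := by ring
    have b7 : (χ (x r) - χ (x r')) * d = (psi p β 0 (x r) - psi p β 0 (x r')) * d
        - τ * p * (psi p β 0 (x r) * x r ^ (p - 1) - psi p β 0 (x r') * x r' ^ (p - 1)) * d := by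
      simp only [hχ]; ring
    rw [b7]
    have b8 := (abs_le.1 b2).2
    linarith
  have hfin := expect_mono_of_mem (p := p) (b := β + τ) (h := h) hN hpt
  rw [expect_const_mul, expect_add, expect_add, expect_const, expect_const_mul] at hfin
  have h9 : (c + 2 * M) * E ((farSet (twoLevel a b) η).indicator 1) ≤ (c + 2 * M) * (Cf * ε ^ k) := by
    gcongr
  have h10 : c / 2 * E (fun x => (x r - x r') ^ 2)
      ≤ (4 * Ce * (1 + t ^ 2) + 2 * M * (1 + |t| * p) + 2 * (M * p) ^ 2 * t ^ 2 / c
        + (c + 2 * M) * Cf) * ε ^ k := by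
    linarith
  calc E (fun x => (x r - x r') ^ 2)
      = (c / 2 * E (fun x => (x r - x r') ^ 2)) * (2 / c) := by field_simp
    _ ≤ _ := mul_le_mul_of_nonneg_right h10 (by positivity)
    _ = _ := by ring

theorem exists_spread_bound (t : ℝ) :
    ∃ C : ℝ, 0 ≤ C ∧ ∀ N : ℕ, N ≠ 0 → ∀ ε : ℝ, 0 < ε → ε ^ k * N = 1 →
      expect p q N (β + t * ε ^ (k - 1)) h spread ≤ C * ε ^ k := by
  have key : ∀ r r' : Fin q, ∃ C : ℝ, 0 ≤ C ∧ (r ≠ 0 → r' ≠ 0 → ∀ N : ℕ, N ≠ 0 → ∀ ε : ℝ,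
      0 < ε → ε ^ k * N = 1 →
      expect p q N (β + t * ε ^ (k - 1)) h (fun x => (x r - x r') ^ 2) ≤ C * ε ^ k) := by
    intro r r'
    by_cases hr : r ≠ 0 ∧ r' ≠ 0
    · obtain ⟨C, hC, h1⟩ := H.exists_transverse_bound t r r' hr.1 hr.2
      exact ⟨C, hC, fun _ _ => h1⟩
    · exact ⟨0, le_rfl, fun h1 h2 => absurd ⟨h1, h2⟩ hr⟩
  choose C hC hb using key
  refine ⟨∑ r ∈ Finset.univ.erase (0 : Fin q), ∑ r' ∈ Finset.univ.erase (0 : Fin q), C r r',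
    Finset.sum_nonneg fun _ _ => Finset.sum_nonneg fun _ _ => hC _ _, fun N hN ε hε he => ?_⟩
  have : (spread : (Fin q → ℝ) → ℝ) = fun x => ∑ r ∈ Finset.univ.erase (0 : Fin q),
      ∑ r' ∈ Finset.univ.erase (0 : Fin q), (x r - x r') ^ 2 := rfl
  rw [this, expect_sum, Finset.sum_mul]
  refine Finset.sum_le_sum fun r hr => ?_
  rw [expect_sum, Finset.sum_mul]
  exact Finset.sum_le_sum fun r' hr' =>
    hb r r' (Finset.ne_of_mem_erase hr) (Finset.ne_of_mem_erase hr') N hN ε hε he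

end CriticalPoint

end

/-! ### The approximate Stein identity in the direction of the first colour. -/

theorem exists_lipschitz_bound {f : ℝ → ℝ} (hf : ContDiff ℝ 1 f) :
    ∃ C : ℝ, 0 ≤ C ∧ ∀ x ∈ Set.Icc (0 : ℝ) 1, ∀ y ∈ Set.Icc (0 : ℝ) 1,
      |f y - f x| ≤ C * |y - x| := by
  obtain ⟨C, hC⟩ := isCompact_Icc.exists_bound_of_continuousOn
    ((hf.continuous_deriv le_rfl).continuousOn (s := Set.Icc (0 : ℝ) 1))
  refine ⟨|C|, abs_nonneg _, fun x hx y hy => ?_⟩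
  exact (convex_Icc (0 : ℝ) 1).norm_image_sub_le_of_norm_deriv_le
    (fun w _ => (hf.differentiable (by norm_num)).differentiableAt)
    (fun w hw => (hC w hw).trans (le_abs_self C)) hx hy

/-- The `ℓ¹`-distance to `m`. -/
def ell1 {q : ℕ} (m x : Fin q → ℝ) : ℝ := ∑ r, |x r - m r|

theorem ell1_nonneg {q : ℕ} (m x : Fin q → ℝ) : 0 ≤ ell1 m x :=
  Finset.sum_nonneg fun _ _ => abs_nonneg _

theorem abs_sub_le_ell1 {q : ℕ} (m x : Fin q → ℝ) (r : Fin q) : |x r - m r| ≤ ell1 m x :=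
  Finset.single_le_sum (f := fun r => |x r - m r|) (fun _ _ => abs_nonneg _) (Finset.mem_univ r)

theorem abs_sub_le_one_of_mem_stdSimplex {q : ℕ} [NeZero q] {m x : Fin q → ℝ}
    (hm : m ∈ stdSimplex ℝ (Fin q)) (hx : x ∈ stdSimplex ℝ (Fin q)) (r : Fin q) :
    |x r - m r| ≤ 1 := by
  rw [abs_le]
  constructor <;> linarith [hm.1 r, hx.1 r, stdSimplex_le_one hm r, stdSimplex_le_one hx r]

theorem ell1_le {q : ℕ} [NeZero q] {m x : Fin q → ℝ} (hm : m ∈ stdSimplex ℝ (Fin q))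
    (hx : x ∈ stdSimplex ℝ (Fin q)) : ell1 m x ≤ q := by
  calc ell1 m x ≤ ∑ _r : Fin q, (1 : ℝ) :=
        Finset.sum_le_sum fun r _ => abs_sub_le_one_of_mem_stdSimplex hm hx r
    _ = q := by simp

/-- The scale `N^(-1/k)`. -/
def scale (k N : ℕ) : ℝ := (N : ℝ) ^ (-(1 / (k : ℝ)))

theorem scale_pos {k N : ℕ} (hN : N ≠ 0) : 0 < scale k N :=
  Real.rpow_pos_of_pos (by exact_mod_cast Nat.pos_of_ne_zero hN) _

theorem scale_pow_mul {k N : ℕ} (hk : k ≠ 0) (hN : N ≠ 0) : scale k N ^ k * N = 1 := by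
  have hN0 : (0 : ℝ) < N := by exact_mod_cast Nat.pos_of_ne_zero hN
  have hk0 : (k : ℝ) ≠ 0 := by exact_mod_cast hk
  rw [scale, ← Real.rpow_natCast, ← Real.rpow_mul hN0.le, neg_mul, one_div,
    inv_mul_cancel₀ hk0, Real.rpow_neg_one, inv_mul_cancel₀ hN0.ne']

theorem tendsto_scale {k : ℕ} (hk : k ≠ 0) : Tendsto (scale k) atTop (𝓝 0) := by
  have hk0 : (0 : ℝ) < 1 / k := by positivity
  exact (tendsto_rpow_neg_atTop hk0).comp tendsto_natCast_atTop_atTop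

section

variable {p q : ℕ} [NeZero q] {β h a b κ : ℝ} {k : ℕ}

namespace CriticalPoint

variable (H : CriticalPoint p q β h a b κ k)

include H

theorem mem_simplex : (twoLevel a b : Fin q → ℝ) ∈ stdSimplex ℝ (Fin q) := H.isMax.1

theorem a_mem : a ∈ Set.Icc (0 : ℝ) 1 :=
  ⟨H.a_pos.le, by nlinarith [H.sum_eq, H.one_le_q_sub_one, H.b_pos]⟩

theorem b_mem : b ∈ Set.Icc (0 : ℝ) 1 :=
  ⟨H.b_pos.le, by nlinarith [H.sum_eq, H.one_le_q_sub_one, H.b_pos, H.a_pos]⟩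

theorem abs_sub_a_le (x : Fin q → ℝ) : |x 0 - a| ≤ ell1 (twoLevel a b) x := by
  simpa [twoLevel] using abs_sub_le_ell1 (twoLevel a b) x 0

theorem abs_sub_b_le (x : Fin q → ℝ) {r : Fin q} (hr : r ≠ 0) :
    |x r - b| ≤ ell1 (twoLevel a b) x := by
  simpa [twoLevel, hr] using abs_sub_le_ell1 (twoLevel a b) x r

/-- The other entries are expanded around their mean `u`. The linear terms sum to zero, so only the
quadratic remainder, controlled by `spread`, separates the sum from its value on the line of
two-level vectors. -/
theorem exists_sum_psi_sub_bound : ∃ C : ℝ, 0 ≤ C ∧ ∀ x ∈ stdSimplex ℝ (Fin q),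
    |∑ r ∈ Finset.univ.erase (0 : Fin q), (psi p β h (x 0) - psi p β 0 (x r))
      - (q - 1) * drift p q β h (x 0)| ≤ C * spread x := by
  obtain ⟨C, hC, hT⟩ := exists_taylor_bound (contDiff_psi p β 0) 1
  refine ⟨C, hC, fun x hx => ?_⟩
  have hq := H.one_le_q_sub_one
  set u := (1 - x 0) / ((q : ℝ) - 1) with hu
  have hu0 : 0 ≤ u := div_nonneg (by linarith [stdSimplex_le_one hx 0]) (by linarith)
  have hu1 : u ≤ 1 := by
    rw [hu, div_le_one (by linarith)]
    linarith [hx.1 0]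
  have hsum : ∑ r ∈ Finset.univ.erase (0 : Fin q), (x r - u) = 0 := by
    rw [Finset.sum_sub_distrib, sum_erase_zero hx, Finset.sum_const, nsmul_eq_mul,
      card_erase_zero, hu]
    field_simp
    ring
  have e : ∑ r ∈ Finset.univ.erase (0 : Fin q), (psi p β h (x 0) - psi p β 0 (x r))
      - (q - 1) * drift p q β h (x 0)
      = -∑ r ∈ Finset.univ.erase (0 : Fin q),
        (psi p β 0 (x r) - psi p β 0 u - deriv (psi p β 0) u * (x r - u)) := by
    simp only [Finset.sum_sub_distrib, ← Finset.mul_sum, Finset.sum_const, nsmul_eq_mul,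
      card_erase_zero, drift, ← hu] at hsum ⊢
    linear_combination (-deriv (psi p β 0) u) * hsum
  rw [e, abs_neg]
  refine (Finset.abs_sum_le_sum_abs _ _).trans ?_
  have hr : ∀ r ∈ Finset.univ.erase (0 : Fin q),
      (x r - u) ^ 2 ≤ ∑ r' ∈ Finset.univ.erase (0 : Fin q), (x r - x r') ^ 2 := by
    intro r _
    -- Since `u` is the mean of the other entries, `x r - u` is an average of differences, and
    -- Cauchy–Schwarz bounds it by the spread.
    have e1 : (q - 1) * (x r - u) = ∑ r' ∈ Finset.univ.erase (0 : Fin q), (x r - x r') := by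
      rw [Finset.sum_sub_distrib, sum_erase_zero hx, Finset.sum_const, nsmul_eq_mul,
        card_erase_zero, hu]
      field_simp
    have e2 := sq_sum_le_card_mul_sum_sq (s := Finset.univ.erase (0 : Fin q))
      (f := fun r' => x r - x r')
    rw [← e1, card_erase_zero, mul_pow] at e2
    have : ((q : ℝ) - 1) * ((q - 1) * (x r - u) ^ 2)
        ≤ (q - 1) * ∑ r' ∈ Finset.univ.erase (0 : Fin q), (x r - x r') ^ 2 := by
      linarith
    have h3 := le_of_mul_le_mul_left this (by linarith)
    nlinarith [sq_nonneg (x r - u)]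
  calc ∑ r ∈ Finset.univ.erase (0 : Fin q),
        |psi p β 0 (x r) - psi p β 0 u - deriv (psi p β 0) u * (x r - u)|
      ≤ ∑ r ∈ Finset.univ.erase (0 : Fin q),
          C * ∑ r' ∈ Finset.univ.erase (0 : Fin q), (x r - x r') ^ 2 := by
        refine Finset.sum_le_sum fun r hr' => (hT u ⟨by linarith, hu1⟩ (x r)
          ⟨by linarith [hx.1 r], stdSimplex_le_one hx r⟩).trans ?_
        gcongr
        exact hr r hr'
    _ = C * spread x := by rw [← Finset.mul_sum]; rfl

/-- This sum is multiplied by `τ`, which already has the order `ε ^ (k - 1)` of the main terms, so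
freezing it at the maximizer with a Lipschitz error is enough. -/
theorem exists_sum_psi_pow_sub_bound : ∃ C : ℝ, 0 ≤ C ∧ ∀ x ∈ stdSimplex ℝ (Fin q),
    |∑ r ∈ Finset.univ.erase (0 : Fin q),
        (psi p β h (x 0) * x 0 ^ (p - 1) - psi p β 0 (x r) * x r ^ (p - 1))
      - (q - 1) * (psi p β 0 b * (a ^ (p - 1) - b ^ (p - 1)))| ≤ C * ell1 (twoLevel a b) x := by
  obtain ⟨C₁, hC₁, h₁⟩ := exists_lipschitz_bound
    (f := fun y => psi p β h y * y ^ (p - 1)) ((contDiff_psi p β h).mul (by fun_prop))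
  obtain ⟨C₂, hC₂, h₂⟩ := exists_lipschitz_bound
    (f := fun y => psi p β 0 y * y ^ (p - 1)) ((contDiff_psi p β 0).mul (by fun_prop))
  have hq := H.one_le_q_sub_one
  refine ⟨(q - 1) * (C₁ + C₂), by positivity, fun x hx => ?_⟩
  have e : ∑ r ∈ Finset.univ.erase (0 : Fin q),
        (psi p β h (x 0) * x 0 ^ (p - 1) - psi p β 0 (x r) * x r ^ (p - 1))
      - (q - 1) * (psi p β 0 b * (a ^ (p - 1) - b ^ (p - 1)))
      = ∑ r ∈ Finset.univ.erase (0 : Fin q),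
        ((psi p β h (x 0) * x 0 ^ (p - 1) - psi p β h a * a ^ (p - 1))
          - (psi p β 0 (x r) * x r ^ (p - 1) - psi p β 0 b * b ^ (p - 1))) := by
    rw [H.stat]
    simp only [Finset.sum_sub_distrib, Finset.sum_const, nsmul_eq_mul, card_erase_zero]
    ring
  rw [e]
  refine (Finset.abs_sum_le_sum_abs _ _).trans ?_
  calc _ ≤ ∑ r ∈ Finset.univ.erase (0 : Fin q), (C₁ + C₂) * ell1 (twoLevel a b) x := by
        refine Finset.sum_le_sum fun r hr => (abs_sub _ _).trans ?_
        rw [add_mul]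
        refine add_le_add ((h₁ a H.a_mem (x 0) ⟨hx.1 0, stdSimplex_le_one hx 0⟩).trans ?_)
          ((h₂ b H.b_mem (x r) ⟨hx.1 r, stdSimplex_le_one hx r⟩).trans ?_)
        · gcongr
          exact H.abs_sub_a_le x
        · gcongr
          exact H.abs_sub_b_le x (Finset.ne_of_mem_erase hr)
    _ = _ := by
        rw [Finset.sum_const, nsmul_eq_mul, card_erase_zero]; ring

theorem exists_sum_psi_bound : ∃ C : ℝ, 0 ≤ C ∧ ∀ x ∈ stdSimplex ℝ (Fin q), ∀ τ : ℝ,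
    |∑ r ∈ Finset.univ.erase (0 : Fin q), psi p β 0 (x r) * (1 - τ * p * x r ^ (p - 1))
      - (q - 1) * psi p β 0 b| ≤ C * (ell1 (twoLevel a b) x + |τ|) := by
  obtain ⟨C₂, hC₂, h₂⟩ := exists_lipschitz_bound (contDiff_psi p β 0)
  have hq := H.one_le_q_sub_one
  set M := Real.exp (|β| * p + |(0 : ℝ)|) with hM
  have hM0 : 0 < M := Real.exp_pos _
  refine ⟨(q - 1) * (C₂ + M * p), by positivity, fun x hx τ => ?_⟩
  have e : ∑ r ∈ Finset.univ.erase (0 : Fin q), psi p β 0 (x r) * (1 - τ * p * x r ^ (p - 1))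
      - (q - 1) * psi p β 0 b
      = ∑ r ∈ Finset.univ.erase (0 : Fin q), ((psi p β 0 (x r) - psi p β 0 b)
        - psi p β 0 (x r) * (τ * p * x r ^ (p - 1))) := by
    simp only [Finset.sum_sub_distrib, Finset.sum_const, nsmul_eq_mul, card_erase_zero, mul_sub,
      mul_one]
    ring
  rw [e]
  refine (Finset.abs_sum_le_sum_abs _ _).trans ?_
  have hl := ell1_nonneg (twoLevel a b) x
  calc _ ≤ ∑ r ∈ Finset.univ.erase (0 : Fin q),
          (C₂ + M * p) * (ell1 (twoLevel a b) x + |τ|) := by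
        refine Finset.sum_le_sum fun r hr => (abs_sub _ _).trans ?_
        have i1 : |psi p β 0 (x r) - psi p β 0 b| ≤ C₂ * ell1 (twoLevel a b) x :=
          (h₂ b H.b_mem (x r) ⟨hx.1 r, stdSimplex_le_one hx r⟩).trans (by
            gcongr
            exact H.abs_sub_b_le x (Finset.ne_of_mem_erase hr))
        have i2 : |psi p β 0 (x r) * (τ * p * x r ^ (p - 1))| ≤ M * p * |τ| := by
          have hx0 := hx.1 r
          rw [abs_mul, abs_mul, abs_mul, Nat.abs_cast, abs_pow, abs_of_nonneg hx0]
          calc |psi p β 0 (x r)| * (|τ| * p * x r ^ (p - 1)) ≤ M * (|τ| * p * 1) := by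
                gcongr
                · exact psi_abs_le p β 0 ⟨hx.1 r, stdSimplex_le_one hx r⟩
                · exact pow_le_one₀ (hx.1 r) (stdSimplex_le_one hx r)
            _ = M * p * |τ| := by ring
        have i3 : 0 ≤ C₂ * |τ| := by positivity
        have i4 : 0 ≤ M * p * ell1 (twoLevel a b) x := by positivity
        nlinarith
    _ = _ := by
        rw [Finset.sum_const, nsmul_eq_mul, card_erase_zero]; ring

set_option maxHeartbeats 1000000 in
/-- The approximate Stein identity for the rescaled first entry of the magnetization. -/
theorem exists_stein_bound (t : ℝ) : ∃ C : ℝ, 0 ≤ C ∧ ∀ N : ℕ, N ≠ 0 → ∀ ε : ℝ, 0 < ε →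
    ε ^ k * N = 1 → ∀ g : ℝ → ℝ,
      |expect p q N (β + t * ε ^ (k - 1)) h (fun x => (drift p q β h (x 0)
          - t * ε ^ (k - 1) * p * (psi p β 0 b * (a ^ (p - 1) - b ^ (p - 1))))
            * g ((x 0 - a) / ε))
        - expect p q N (β + t * ε ^ (k - 1)) h (fun x => psi p β 0 b *
          (g ((x 0 - a) / ε + ε ^ (k - 1)) - g ((x 0 - a) / ε)))|
      ≤ C * (expect p q N (β + t * ε ^ (k - 1)) h (fun x =>
            (spread x + ε ^ (k - 1) * ell1 (twoLevel a b) x) * |g ((x 0 - a) / ε)|)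
          + expect p q N (β + t * ε ^ (k - 1)) h (fun x =>
            (ell1 (twoLevel a b) x + ε ^ (k - 1))
              * |g ((x 0 - a) / ε + ε ^ (k - 1)) - g ((x 0 - a) / ε)|)
          + ε ^ k * (expect p q N (β + t * ε ^ (k - 1)) h (fun x => |g ((x 0 - a) / ε)|)
            + expect p q N (β + t * ε ^ (k - 1)) h
              (fun x => |g ((x 0 - a) / ε + ε ^ (k - 1))|))) := by
  obtain ⟨C₀, hC₀, h₀⟩ := exists_perturbed_exchange_bound p q β h |t|
  obtain ⟨C₁, hC₁, h₁⟩ := H.exists_sum_psi_sub_bound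
  obtain ⟨C₂, hC₂, h₂⟩ := H.exists_sum_psi_pow_sub_bound
  obtain ⟨C₃, hC₃, h₃⟩ := H.exists_sum_psi_bound
  have hq := H.one_le_q_sub_one
  refine ⟨C₁ + |t| * p * C₂ + C₃ * (1 + |t|) + (q - 1) * (C₀ * (1 + t ^ 2)), by positivity,
    fun N hN ε hε he g => ?_⟩
  have hk := H.four_le_k
  have hN0 : (0 : ℝ) < N := by exact_mod_cast Nat.pos_of_ne_zero hN
  have hε1 := H.eps_le_one hN he
  have e1 : 1 / (N : ℝ) = ε ^ k := by field_simp; linarith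
  have hek0 : 0 < ε ^ k := pow_pos hε _
  -- One exchange moves the first entry by `1 / N = ε ^ k`, hence the rescaled entry by `s = ε ^ (k
  -- - 1)`.
  have e2 : ε ^ k / ε = ε ^ (k - 1) := by
    obtain ⟨j, rfl⟩ : ∃ j, k = j + 1 := ⟨k - 1, by omega⟩
    simp only [Nat.add_sub_cancel, pow_succ]
    field_simp
  set s := ε ^ (k - 1) with hs
  have hs0 : 0 < s := pow_pos hε _
  have hs1 : s ≤ 1 := pow_le_one₀ hε.le hε1
  set τ := t * s with hτ
  have hτt : |τ| ≤ |t| := by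
    rw [hτ, abs_mul, abs_of_pos hs0]
    exact mul_le_of_le_one_right (abs_nonneg t) hs1
  have hτs : |τ| = |t| * s := by rw [hτ, abs_mul, abs_of_pos hs0]
  have hτ2 : τ ^ 2 ≤ t ^ 2 * ε ^ k := by
    rw [hτ, mul_pow, hs, ← pow_mul]
    exact mul_le_mul_of_nonneg_left (pow_le_pow_of_le_one hε.le hε1 (by omega)) (sq_nonneg t)
  set E := expect p q N (β + τ) h with hE
  set G : (Fin q → ℝ) → ℝ := fun x => g ((x 0 - a) / ε) with hG
  set G' : (Fin q → ℝ) → ℝ := fun x => g ((x 0 - a) / ε + s) with hG'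
  set lam := psi p β 0 b with hlam
  set R := Finset.univ.erase (0 : Fin q) with hR
  set c₀ : ℝ → ℝ := fun y => psi p β h y * (1 - τ * p * y ^ (p - 1)) with hc₀
  set c₁ : ℝ → ℝ := fun y => psi p β 0 y * (1 - τ * p * y ^ (p - 1)) with hc₁
  have n1 : 0 ≤ E (fun x => |G x|) := expect_nonneg hN fun _ _ => abs_nonneg _
  have n2 : 0 ≤ E (fun x => |G' x|) := expect_nonneg hN fun _ _ => abs_nonneg _
  have step1 : ∀ r ∈ R, |E (fun x => (c₀ (x 0) - c₁ (x r)) * G x - c₁ (x r) * (G' x - G x))|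
      ≤ C₀ * (1 + t ^ 2) * (ε ^ k * (E (fun x => |G x|) + E (fun x => |G' x|))) := by
    intro r hr
    have hr0 : r ≠ 0 := Finset.ne_of_mem_erase hr
    have hx := h₀ N hN τ hτt 0 r (Ne.symm hr0) G
    have hsh : ∀ x : Fin q → ℝ, G (shift N 0 r x) = G' x := by
      intro x
      simp only [hG, hG', shift_self (Ne.symm hr0), e1]
      congr 1
      rw [← e2]; ring
    simp only [hsh, field, if_true, hr0, if_false] at hx
    have e3 : E (fun x => (c₀ (x 0) - c₁ (x r)) * G x - c₁ (x r) * (G' x - G x))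
        = E (fun x => psi p β h (x 0) * (1 - τ * p * x 0 ^ (p - 1)) * G x)
          - E (fun x => psi p β 0 (x r) * (1 - τ * p * x r ^ (p - 1)) * G' x) := by
      rw [hE, ← expect_sub]
      congr 1
      funext x
      simp only [hc₀, hc₁]
      ring
    rw [e3]
    refine hx.trans ?_
    rw [e1]
    calc C₀ * (ε ^ k + τ ^ 2) * (E (fun t => |G t|) + E (fun t => |G' t|))
        ≤ C₀ * (ε ^ k + t ^ 2 * ε ^ k) * (E (fun t => |G t|) + E (fun t => |G' t|)) := by gcongr
      _ = _ := by ring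
  have step2 : |E (fun x => (∑ r ∈ R, (c₀ (x 0) - c₁ (x r))) * G x
      - (∑ r ∈ R, c₁ (x r)) * (G' x - G x))|
      ≤ (q - 1) * (C₀ * (1 + t ^ 2) * (ε ^ k * (E (fun x => |G x|) + E (fun x => |G' x|)))) := by
    have e3 : (fun x : Fin q → ℝ => (∑ r ∈ R, (c₀ (x 0) - c₁ (x r))) * G x
        - (∑ r ∈ R, c₁ (x r)) * (G' x - G x))
        = fun x => ∑ r ∈ R, ((c₀ (x 0) - c₁ (x r)) * G x - c₁ (x r) * (G' x - G x)) := by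
      funext x
      rw [Finset.sum_mul, Finset.sum_mul, ← Finset.sum_sub_distrib]
    rw [e3, hE, expect_sum]
    refine (Finset.abs_sum_le_sum_abs _ _).trans ?_
    refine (Finset.sum_le_sum step1).trans ?_
    rw [Finset.sum_const, nsmul_eq_mul, card_erase_zero]
  have step3 : |E (fun x => ((q : ℝ) - 1) * ((drift p q β h (x 0)
        - τ * p * (lam * (a ^ (p - 1) - b ^ (p - 1)))) * G x - lam * (G' x - G x)))
      - E (fun x => (∑ r ∈ R, (c₀ (x 0) - c₁ (x r))) * G x
        - (∑ r ∈ R, c₁ (x r)) * (G' x - G x))|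
      ≤ (C₁ + |t| * p * C₂) * E (fun x => (spread x + s * ell1 (twoLevel a b) x) * |G x|)
        + C₃ * (1 + |t|) * E (fun x => (ell1 (twoLevel a b) x + s) * |G' x - G x|) := by
    rw [hE, ← expect_sub, ← expect_const_mul, ← expect_const_mul, ← expect_add]
    refine abs_expect_le_of_mem hN fun x hx => ?_
    have b1 := h₁ x hx
    have b2 := h₂ x hx
    have b3 := h₃ x hx τ
    set S₁ := ∑ r ∈ R, (psi p β h (x 0) - psi p β 0 (x r))
    set S₂ := ∑ r ∈ R, (psi p β h (x 0) * x 0 ^ (p - 1) - psi p β 0 (x r) * x r ^ (p - 1))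
    have e4 : ∑ r ∈ R, (c₀ (x 0) - c₁ (x r)) = S₁ - τ * p * S₂ := by
      rw [Finset.mul_sum, ← Finset.sum_sub_distrib]
      exact Finset.sum_congr rfl fun r _ => by simp only [hc₀, hc₁]; ring
    rw [e4]
    set S₃ := ∑ r ∈ R, psi p β 0 (x r) * (1 - τ * p * x r ^ (p - 1))
    have hl := ell1_nonneg (twoLevel a b) x
    have hsp := spread_nonneg x
    have e5 : ((q : ℝ) - 1) * ((drift p q β h (x 0)
        - τ * p * (lam * (a ^ (p - 1) - b ^ (p - 1)))) * G x - lam * (G' x - G x))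
        - ((S₁ - τ * p * S₂) * G x - S₃ * (G' x - G x))
        = (-(S₁ - (q - 1) * drift p q β h (x 0))
          + τ * p * (S₂ - (q - 1) * (lam * (a ^ (p - 1) - b ^ (p - 1))))) * G x
          + (S₃ - (q - 1) * lam) * (G' x - G x) := by ring
    rw [e5]
    refine (abs_add_le _ _).trans (add_le_add ?_ ?_)
    · rw [abs_mul, ← mul_assoc (C₁ + |t| * p * C₂)]
      refine mul_le_mul_of_nonneg_right ?_ (abs_nonneg _)
      refine (abs_add_le _ _).trans ?_
      rw [abs_neg, abs_mul, abs_mul, Nat.abs_cast, hτs]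
      have b4 : |t| * s * p * |S₂ - (q - 1) * (lam * (a ^ (p - 1) - b ^ (p - 1)))|
          ≤ |t| * s * p * (C₂ * ell1 (twoLevel a b) x) := by gcongr
      have b5 : 0 ≤ C₁ * (s * ell1 (twoLevel a b) x) := by positivity
      have b6 : 0 ≤ |t| * p * C₂ * spread x := by positivity
      nlinarith
    · rw [abs_mul, ← mul_assoc (C₃ * (1 + |t|))]
      refine mul_le_mul_of_nonneg_right (b3.trans ?_) (abs_nonneg _)
      rw [hτs, mul_assoc]
      refine mul_le_mul_of_nonneg_left ?_ hC₃
      have : 0 ≤ |t| * ell1 (twoLevel a b) x := by positivity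
      nlinarith
  have e6 : E (fun x => (drift p q β h (x 0) - τ * p * (lam * (a ^ (p - 1) - b ^ (p - 1)))) * G x)
      - E (fun x => lam * (G' x - G x))
      = E (fun x => (drift p q β h (x 0)
        - τ * p * (lam * (a ^ (p - 1) - b ^ (p - 1)))) * G x - lam * (G' x - G x)) := by
    rw [hE, ← expect_sub]
  rw [e6]
  rw [hE, expect_const_mul, ← hE] at step3
  set Q := E (fun x => (drift p q β h (x 0)
        - τ * p * (lam * (a ^ (p - 1) - b ^ (p - 1)))) * G x - lam * (G' x - G x))
  set P := E (fun x => (∑ r ∈ R, (c₀ (x 0) - c₁ (x r))) * G x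
        - (∑ r ∈ R, c₁ (x r)) * (G' x - G x))
  have n3 : 0 ≤ E (fun x => (spread x + s * ell1 (twoLevel a b) x) * |G x|) :=
    expect_nonneg hN fun x _ => mul_nonneg
      (add_nonneg (spread_nonneg x) (mul_nonneg hs0.le (ell1_nonneg _ x))) (abs_nonneg _)
  have n4 : 0 ≤ E (fun x => (ell1 (twoLevel a b) x + s) * |G' x - G x|) :=
    expect_nonneg hN fun x _ => mul_nonneg (add_nonneg (ell1_nonneg _ x) hs0.le) (abs_nonneg _)
  -- Summing over the other colours multiplied the identity by `q - 1`; since `q - 1 ≥ 1`, the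
  -- factor can be dropped in an upper bound.
  have h7 : |Q| ≤ |(q - 1) * Q - P| + |P| := by
    have h8 : |Q| ≤ |((q : ℝ) - 1) * Q| := by
      rw [abs_mul, abs_of_pos (by linarith : (0 : ℝ) < q - 1)]
      nlinarith [abs_nonneg Q]
    refine h8.trans ?_
    have := abs_add_le ((q - 1) * Q - P) P
    rwa [sub_add_cancel] at this
  refine h7.trans ((add_le_add step3 step2).trans ?_)
  set X₁ := E (fun x => (spread x + s * ell1 (twoLevel a b) x) * |G x|)
  set X₂ := E (fun x => (ell1 (twoLevel a b) x + s) * |G' x - G x|)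
  set X₃ := ε ^ k * (E (fun x => |G x|) + E (fun x => |G' x|)) with hX₃
  have n5 : 0 ≤ X₃ := by positivity
  set A₁ := C₁ + |t| * p * C₂
  set A₂ := C₃ * (1 + |t|)
  set A₃ := (q - 1) * (C₀ * (1 + t ^ 2)) with hA₃
  have m1 : 0 ≤ A₁ := by positivity
  have m2 : 0 ≤ A₂ := by positivity
  have m3 : 0 ≤ A₃ := by positivity
  calc A₁ * X₁ + A₂ * X₂ + (q - 1) * (C₀ * (1 + t ^ 2) * X₃)
      = A₁ * X₁ + A₂ * X₂ + A₃ * X₃ := by rw [hA₃]; ring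
    _ ≤ (A₁ + A₂ + A₃) * X₁ + (A₁ + A₂ + A₃) * X₂ + (A₁ + A₂ + A₃) * X₃ := by
        have i1 := mul_nonneg m1 n3
        have i2 := mul_nonneg m1 n4
        have i3 := mul_nonneg m1 n5
        have i4 := mul_nonneg m2 n3
        have i5 := mul_nonneg m2 n5
        have i6 := mul_nonneg m3 n3
        have i7 := mul_nonneg m3 n4
        linarith
    _ = (A₁ + A₂ + A₃) * (X₁ + X₂ + X₃) := by ring

end CriticalPoint

end

/-! ### The moment bound at scale `ε` and the limiting Stein equation. -/

theorem tendsto_zero_of_forall_le {f B : ℕ → ℝ} {K : ℝ} (hB : Tendsto B atTop (𝓝 0))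
    (h : ∀ δ : ℝ, 0 < δ → ∀ᶠ N in atTop, |f N| ≤ K * δ + B N) : Tendsto f atTop (𝓝 0) := by
  rw [Metric.tendsto_atTop']
  intro e he
  have hδ : 0 < e / (2 * (|K| + 1)) := by positivity
  have h1 := h _ hδ
  have h2 := hB.eventually (gt_mem_nhds (show (0 : ℝ) < e / 2 by linarith))
  obtain ⟨n, hn⟩ := eventually_atTop.1 (h1.and h2)
  refine ⟨n, fun N hN => ?_⟩
  obtain ⟨h3, h4⟩ := hn N hN.le
  rw [Real.dist_eq, sub_zero]
  have h5 : K * (e / (2 * (|K| + 1))) ≤ e / 2 := by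
    have : K * (e / (2 * (|K| + 1))) = K / (|K| + 1) * (e / 2) := by field_simp
    rw [this]
    have h6 : K / (|K| + 1) ≤ 1 := by
      rw [div_le_one (by positivity)]
      linarith [le_abs_self K]
    nlinarith
  linarith

section

variable {p q : ℕ} [NeZero q] {β h a b κ : ℝ} {k : ℕ}

namespace CriticalPoint

variable (H : CriticalPoint p q β h a b κ k)

include H

theorem drift_self : drift p q β h a = 0 := by
  have hq := H.one_le_q_sub_one
  have : (1 - a) / ((q : ℝ) - 1) = b := by
    rw [div_eq_iff (by linarith)]
    linarith [H.sum_eq]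
  rw [drift, this, H.stat, sub_self]

theorem exists_drift_bound {δ : ℝ} (hδ : 0 < δ) : ∃ η : ℝ, 0 < η ∧ ∀ x : ℝ, |x - a| < η →
    |drift p q β h x - κ * psi p β 0 b * (x - a) ^ (k - 1)| ≤ δ * |x - a| ^ (k - 1) := by
  have h1 := Metric.tendsto_nhdsWithin_nhds.1 H.tendsto_drift δ hδ
  obtain ⟨η, hη, h2⟩ := h1
  refine ⟨η, hη, fun x hx => ?_⟩
  by_cases hxa : x = a
  · subst hxa
    have hk : k - 1 ≠ 0 := by have := H.four_le_k; omega
    simp [H.drift_self, hk]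
  · have h3 := (h2 (show x ∈ ({a}ᶜ : Set ℝ) from hxa) (by rwa [Real.dist_eq])).le
    rw [Real.dist_eq] at h3
    have hne : (x - a) ^ (k - 1) ≠ 0 := pow_ne_zero _ (sub_ne_zero.2 hxa)
    have e : drift p q β h x - κ * psi p β 0 b * (x - a) ^ (k - 1)
        = (drift p q β h x / (x - a) ^ (k - 1) - κ * psi p β 0 b) * (x - a) ^ (k - 1) := by
      field_simp
    rw [e, abs_mul, abs_pow]
    gcongr

/-- Because `k` is even, the leading term of the drift times `x 0 - a` is a positive multiple of `(x
0 - a) ^ k`. This is the coercivity behind the moment bound; far from the maximizer only boundedness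
is used. -/
theorem exists_drift_lower_bound : ∃ c : ℝ, 0 < c ∧ ∃ C : ℝ, 0 ≤ C ∧ ∃ η : ℝ, 0 < η ∧
    ∀ x ∈ stdSimplex ℝ (Fin q), c * (x 0 - a) ^ k ≤ drift p q β h (x 0) * (x 0 - a)
      + C * (farSet (twoLevel a b) η).indicator 1 x := by
  have hlam := mul_pos H.kappa_pos H.psi_b_pos
  obtain ⟨η, hη, hd⟩ := H.exists_drift_bound (half_pos hlam)
  have hq := H.one_le_q_sub_one
  have hk := H.four_le_k
  set M := Real.exp (|β| * p + |h|) + Real.exp (|β| * p + |(0 : ℝ)|)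
  have hM : 0 < M := by positivity
  refine ⟨κ * psi p β 0 b / 2, by positivity, κ * psi p β 0 b / 2 + M, by positivity, η, hη,
    fun x hx => ?_⟩
  have hx1 : |x 0 - a| ≤ 1 := by
    simpa [twoLevel] using abs_sub_le_one_of_mem_stdSimplex H.mem_simplex hx 0
  by_cases hf : x ∈ farSet (twoLevel a b) η
  · rw [Set.indicator_of_mem hf, Pi.one_apply, mul_one]
    have h0 := stdSimplex_le_one hx 0
    have h0' := hx.1 0
    have h1 : |drift p q β h (x 0)| ≤ M :=
      (abs_sub _ _).trans (add_le_add (psi_abs_le p β h ⟨h0', h0⟩) (psi_abs_le p β 0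
        ⟨div_nonneg (by linarith) (by linarith), by rw [div_le_one (by linarith)]; linarith⟩))
    have h2 : |drift p q β h (x 0) * (x 0 - a)| ≤ M * 1 := by
      rw [abs_mul]
      gcongr
    have h3 : (x 0 - a) ^ k ≤ 1 := by
      refine (le_abs_self _).trans ?_
      rw [abs_pow]
      exact pow_le_one₀ (abs_nonneg _) hx1
    have h4 := (abs_le.1 h2).1
    nlinarith
  · rw [Set.indicator_of_notMem hf, mul_zero, add_zero]
    simp only [farSet, Set.mem_ofPred_eq, not_exists, not_le] at hf
    have h1 := hd (x 0) (by simpa [twoLevel] using hf 0)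
    set y := x 0 - a
    have e1 : y ^ k = y ^ (k - 1) * y := by
      rw [← pow_succ]; congr 1; omega
    have e2 : |y| ^ (k - 1) * |y| = y ^ k := by
      rw [← pow_succ, show k - 1 + 1 = k by omega, H.even_k.pow_abs]
    have h2 : |(drift p q β h (x 0) - κ * psi p β 0 b * y ^ (k - 1)) * y|
        ≤ κ * psi p β 0 b / 2 * y ^ k := by
      rw [abs_mul, ← e2, ← mul_assoc]
      gcongr
    have h3 := (abs_le.1 h2).1
    have e3 : (drift p q β h (x 0) - κ * psi p β 0 b * y ^ (k - 1)) * y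
        = drift p q β h (x 0) * y - κ * psi p β 0 b * y ^ k := by rw [e1]; ring
    rw [e3] at h3
    linarith

set_option maxHeartbeats 1000000 in
-- The Stein identity tested on `g = id`: the drift term yields a multiple of `s E T^k`, and
-- everything else is at most `K s (1 + E|T|)`. Dividing by `s` and absorbing `E|T|` into `E T^k`
-- closes the bound.
theorem exists_moment_bound (t : ℝ) :
    ∃ C : ℝ, 0 ≤ C ∧ ∀ N : ℕ, N ≠ 0 → ∀ ε : ℝ, 0 < ε → ε ^ k * N = 1 →
      expect p q N (β + t * ε ^ (k - 1)) h (fun x => ((x 0 - a) / ε) ^ k) ≤ C := by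
  obtain ⟨C₀, hC₀, hstein⟩ := H.exists_stein_bound t
  obtain ⟨C₁, hC₁, hspread⟩ := H.exists_spread_bound t
  obtain ⟨c, hc, C₂, hC₂, η, hη, hlow⟩ := H.exists_drift_lower_bound
  obtain ⟨C₃, hC₃, hfar⟩ := H.exists_expect_far_le hη t
  have hq := H.one_le_q_sub_one
  have hk := H.four_le_k
  have hlam := H.psi_b_pos
  set lam := psi p β 0 b
  set θ' := |p * (lam * (a ^ (p - 1) - b ^ (p - 1)))| with hθ'
  -- all errors are at most `K s (1 + E|T|)`
  set K := |t| * θ' + lam + C₀ * (C₁ + q + (q + 1) + 3) + C₂ * C₃ with hK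
  have hK0 : 0 ≤ K := by positivity
  -- Chosen so that `|T| ≤ A + T ^ k / A` costs at most half of the coercive term, `K / A ≤ c / 2`.
  set A := max 1 (2 * K / c) with hA
  have hA1 : 1 ≤ A := le_max_left _ _
  have hA2 : 2 * K / c ≤ A := le_max_right _ _
  refine ⟨(2 / c) * (K * (1 + A)), by positivity, fun N hN ε hε he => ?_⟩
  have hN0 : (0 : ℝ) < N := by exact_mod_cast Nat.pos_of_ne_zero hN
  have hε1 := H.eps_le_one hN he
  have hst := hstein N hN ε hε he (fun y => y)
  have hsp := hspread N hN ε hε he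
  have hfr := hfar N hN ε hε he
  have e2 : ε ^ k = ε ^ (k - 1) * ε := by rw [← pow_succ]; congr 1; omega
  set s := ε ^ (k - 1) with hs
  have hs0 : 0 < s := pow_pos hε _
  have hs1 : s ≤ 1 := pow_le_one₀ hε.le hε1
  set E := expect p q N (β + t * s) h with hE
  set T : (Fin q → ℝ) → ℝ := fun x => (x 0 - a) / ε with hT
  have hxT : ∀ x : Fin q → ℝ, x 0 - a = ε * T x := fun x => by simp only [hT]; field_simp
  have hTb : ∀ x ∈ stdSimplex ℝ (Fin q), |T x| ≤ 1 / ε := by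
    intro x hx
    simp only [hT]
    rw [abs_div, abs_of_pos hε]
    gcongr
    simpa [twoLevel] using abs_sub_le_one_of_mem_stdSimplex H.mem_simplex hx 0
  set m₁ := E (fun x => |T x|) with hm₁
  have hm₁0 : 0 ≤ m₁ := expect_nonneg hN fun _ _ => abs_nonneg _
  -- the error terms
  have r1 : E (fun x => (spread x + s * ell1 (twoLevel a b) x) * |T x|) ≤ s * (C₁ + q * m₁) := by
    have : E (fun x => (spread x + s * ell1 (twoLevel a b) x) * |T x|)
        ≤ E (fun x => 1 / ε * spread x + s * q * |T x|) := by
      refine expect_mono_of_mem hN fun x hx => ?_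
      rw [add_mul]
      refine add_le_add ?_ ?_
      · rw [mul_comm]
        exact mul_le_mul_of_nonneg_right (hTb x hx) (spread_nonneg x)
      · gcongr
        exact ell1_le H.mem_simplex hx
    rw [hE, expect_add, expect_const_mul, expect_const_mul, ← hE] at this
    -- The crude bound `|T| ≤ 1 / ε` is affordable because the spread has mean `O(ε ^ k)`, which
    -- leaves the order `s = ε ^ (k - 1)`.
    have h4 : 1 / ε * E spread ≤ 1 / ε * (C₁ * ε ^ k) := by gcongr
    have e3 : 1 / ε * (C₁ * ε ^ k) = C₁ * s := by rw [e2]; field_simp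
    change _ ≤ 1 / ε * E spread + s * q * m₁ at this
    linarith
  have r2 : E (fun x => (ell1 (twoLevel a b) x + s) * |T x + s - T x|) ≤ s * (q + 1) := by
    rw [← expect_const (p := p) (q := q) (N := N) (b := β + t * s) (h := h) (s * (q + 1))]
    refine expect_mono_of_mem hN fun x hx => ?_
    rw [add_sub_cancel_left, abs_of_pos hs0, mul_comm]
    have := ell1_le H.mem_simplex hx
    gcongr
  have r3 : ε ^ k * (m₁ + E (fun x => |T x + s|)) ≤ s * (3 * (1 + m₁)) := by
    have h4 : E (fun x => |T x + s|) ≤ m₁ + s := by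
      have : E (fun x => |T x + s|) ≤ E (fun x => |T x| + s) :=
        expect_mono_of_mem hN fun x _ => (abs_add_le _ _).trans (by rw [abs_of_pos hs0])
      rwa [hE, expect_add, expect_const] at this
    have h5 : ε ^ k ≤ s := by rw [e2]; exact mul_le_of_le_one_right hs0.le hε1
    have h6 : 0 ≤ m₁ + E (fun x => |T x + s|) :=
      add_nonneg hm₁0 (expect_nonneg hN fun _ _ => abs_nonneg _)
    calc ε ^ k * (m₁ + E (fun x => |T x + s|)) ≤ s * (m₁ + (m₁ + s)) := by gcongr
      _ ≤ s * (3 * (1 + m₁)) := by gcongr; linarith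
  have r4 : E (fun x => lam * (T x + s - T x)) = lam * s := by
    simp only [add_sub_cancel_left]
    rw [hE, expect_const]
  -- the main term
  have r5 : E (fun x => (drift p q β h (x 0)
      - t * s * p * (lam * (a ^ (p - 1) - b ^ (p - 1)))) * T x)
      ≤ lam * s + C₀ * (s * (C₁ + q * m₁) + s * (q + 1) + s * (3 * (1 + m₁))) := by
    have h7 := (abs_le.1 hst).2
    have h8 : C₀ * (E (fun x => (spread x + s * ell1 (twoLevel a b) x) * |T x|)
        + E (fun x => (ell1 (twoLevel a b) x + s) * |T x + s - T x|)
        + ε ^ k * (m₁ + E (fun x => |T x + s|)))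
        ≤ C₀ * (s * (C₁ + q * m₁) + s * (q + 1) + s * (3 * (1 + m₁))) := by gcongr
    change E (fun x => (drift p q β h (x 0)
      - t * s * p * (lam * (a ^ (p - 1) - b ^ (p - 1)))) * T x)
      - E (fun x => lam * (T x + s - T x)) ≤ C₀ * (E (fun x => (spread x
        + s * ell1 (twoLevel a b) x) * |T x|)
        + E (fun x => (ell1 (twoLevel a b) x + s) * |T x + s - T x|)
        + ε ^ k * (m₁ + E (fun x => |T x + s|))) at h7
    rw [r4] at h7
    linarith
  have r6 : c * s * E (fun x => T x ^ k) ≤ E (fun x => (drift p q β h (x 0)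
      - t * s * p * (lam * (a ^ (p - 1) - b ^ (p - 1)))) * T x) + |t| * s * θ' * m₁
      + s * (C₂ * C₃) := by
    have h9 : E (fun x => c * s * T x ^ k) ≤ E (fun x => (drift p q β h (x 0)
        - t * s * p * (lam * (a ^ (p - 1) - b ^ (p - 1)))) * T x + |t| * s * θ' * |T x|
        + C₂ / ε * (farSet (twoLevel a b) η).indicator 1 x) := by
      refine expect_mono_of_mem hN fun x hx => ?_
      have h10 := hlow x hx
      rw [hxT x, mul_pow, e2] at h10
      have h11 : c * s * T x ^ k ≤ drift p q β h (x 0) * T x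
          + C₂ / ε * (farSet (twoLevel a b) η).indicator 1 x := by
        have h12 : (c * (s * ε * T x ^ k)) / ε ≤ (drift p q β h (x 0) * (ε * T x)
          + C₂ * (farSet (twoLevel a b) η).indicator 1 x) / ε := by gcongr
        calc c * s * T x ^ k = (c * (s * ε * T x ^ k)) / ε := by field_simp
          _ ≤ _ := h12
          _ = _ := by field_simp
      have h13 : t * s * p * (lam * (a ^ (p - 1) - b ^ (p - 1))) * T x
          ≤ |t| * s * θ' * |T x| := by
        refine (le_abs_self _).trans (le_of_eq ?_)
        rw [hθ', mul_assoc (t * s), abs_mul, abs_mul (t * s), abs_mul t, abs_of_pos hs0]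
      linarith
    rw [hE, expect_const_mul, expect_add, expect_add, expect_const_mul, expect_const_mul,
      ← hE] at h9
    have h14 : C₂ / ε * E ((farSet (twoLevel a b) η).indicator 1) ≤ C₂ / ε * (C₃ * ε ^ k) := by
      gcongr
    have e3 : C₂ / ε * (C₃ * ε ^ k) = s * (C₂ * C₃) := by rw [e2]; field_simp
    change c * s * E (fun x => T x ^ k) ≤ E (fun x => (drift p q β h (x 0)
        - t * s * p * (lam * (a ^ (p - 1) - b ^ (p - 1)))) * T x) + |t| * s * θ' * m₁
        + C₂ / ε * E ((farSet (twoLevel a b) η).indicator 1) at h9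
    linarith
  have r7 : c * E (fun x => T x ^ k) ≤ K * (1 + m₁) := by
    have h15 : s * (c * E (fun x => T x ^ k)) ≤ s * (K * (1 + m₁)) := by
      have i1 : 0 ≤ |t| * θ' := by positivity
      have i2 : 0 ≤ lam * m₁ := by positivity
      have i3 : 0 ≤ C₀ * C₁ * m₁ := by positivity
      have i4 : 0 ≤ C₀ * q := by positivity
      have i5 : 0 ≤ C₀ * (q + 1) * m₁ := by positivity
      have i6 : 0 ≤ C₂ * C₃ * m₁ := by positivity
      have : c * E (fun x => T x ^ k) * s ≤ (lam + C₀ * ((C₁ + q * m₁) + (q + 1) + 3 * (1 + m₁))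
          + |t| * θ' * m₁ + C₂ * C₃) * s := by linarith
      refine (le_of_eq (mul_comm _ _)).trans (this.trans ?_)
      rw [mul_comm s]
      refine mul_le_mul_of_nonneg_right ?_ hs0.le
      rw [hK]
      linarith
    exact le_of_mul_le_mul_left h15 hs0
  have r8 : m₁ ≤ A + E (fun x => T x ^ k) / A := by
    have h16 : m₁ ≤ E (fun x => A + 1 / A * T x ^ k) := by
      refine expect_mono_of_mem hN fun x _ => ?_
      have hev : T x ^ k = |T x| ^ k := (H.even_k.pow_abs _).symm
      rcases le_total |T x| A with h17 | h17
      · have : 0 ≤ 1 / A * T x ^ k := mul_nonneg (by positivity) (H.even_k.pow_nonneg _)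
        linarith
      · have h18 : |T x| * A ≤ |T x| ^ k := by
          calc |T x| * A ≤ |T x| * |T x| := by gcongr
            _ = |T x| ^ 2 := (sq _).symm
            _ ≤ |T x| ^ k := pow_le_pow_right₀ (hA1.trans h17) (by omega)
        have h19 : |T x| ≤ 1 / A * T x ^ k := by
          rw [hev, one_div, inv_mul_eq_div, le_div_iff₀ (by linarith)]
          exact h18
        linarith
    rw [hE, expect_add, expect_const, expect_const_mul] at h16
    rw [div_eq_inv_mul, ← one_div]
    exact h16
  have hmk : 0 ≤ E (fun x => T x ^ k) := expect_nonneg hN fun x _ => H.even_k.pow_nonneg _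
  have r9 : K * (E (fun x => T x ^ k) / A) ≤ c / 2 * E (fun x => T x ^ k) := by
    have hA0 : 0 < A := by linarith
    have : K ≤ c / 2 * A := by
      rw [div_le_iff₀ hc] at hA2
      linarith
    rw [← mul_div_assoc, div_le_iff₀ hA0]
    have := mul_le_mul_of_nonneg_right this hmk
    linarith
  have r10 : c / 2 * E (fun x => T x ^ k) ≤ K * (1 + A) := by
    have := mul_le_mul_of_nonneg_left r8 hK0
    linarith
  calc E (fun x => T x ^ k) = 2 / c * (c / 2 * E (fun x => T x ^ k)) := by field_simp
    _ ≤ 2 / c * (K * (1 + A)) := by gcongr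

/-- Off the far set of radius `δ` the distance is at most `q δ`; on it the distance is bounded and
the probability is `O(ε ^ k)`. -/
theorem tendsto_expect_ell1 (t : ℝ) :
    Tendsto (fun N => expect p q N (β + t * scale k N ^ (k - 1)) h (ell1 (twoLevel a b)))
      atTop (𝓝 0) := by
  have hk := H.four_le_k
  refine squeeze_zero' (g := fun N => expect p q N (β + t * scale k N ^ (k - 1)) h
    (ell1 (twoLevel a b))) ?_ (Eventually.of_forall fun N => le_rfl) ?_
  · filter_upwards [eventually_ne_atTop 0] with N hN
    exact expect_nonneg hN fun x _ => ell1_nonneg _ x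
  have hsc : Tendsto (fun N => scale k N ^ k) atTop (𝓝 0) := by
    simpa [show k ≠ 0 by omega] using (tendsto_scale (show k ≠ 0 by omega)).pow k
  have hkey : ∀ δ : ℝ, 0 < δ → ∃ C : ℝ, 0 ≤ C ∧ ∀ N : ℕ, N ≠ 0 →
      expect p q N (β + t * scale k N ^ (k - 1)) h (ell1 (twoLevel a b))
        ≤ q * δ + C * scale k N ^ k := by
    intro δ hδ
    obtain ⟨C, hC, hfar⟩ := H.exists_expect_far_le hδ t
    refine ⟨q * C, by positivity, fun N hN => ?_⟩
    have h1 : expect p q N (β + t * scale k N ^ (k - 1)) h (ell1 (twoLevel a b))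
        ≤ expect p q N (β + t * scale k N ^ (k - 1)) h
          (fun x => q * δ + q * (farSet (twoLevel a b) δ).indicator 1 x) := by
      refine expect_mono_of_mem hN fun x hx => ?_
      by_cases hf : x ∈ farSet (twoLevel a b) δ
      · rw [Set.indicator_of_mem hf, Pi.one_apply, mul_one]
        have := ell1_le H.mem_simplex hx
        have : 0 ≤ (q : ℝ) * δ := by positivity
        linarith
      · rw [Set.indicator_of_notMem hf, mul_zero, add_zero]
        simp only [farSet, Set.mem_ofPred_eq, not_exists, not_le] at hf
        calc ell1 (twoLevel a b) x ≤ ∑ _r : Fin q, δ := Finset.sum_le_sum fun r _ => (hf r).le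
          _ = q * δ := by simp
    rw [expect_add, expect_const, expect_const_mul] at h1
    have h2 := hfar N hN _ (scale_pos hN) (scale_pow_mul (by omega) hN)
    calc _ ≤ _ := h1
      _ ≤ q * δ + q * (C * scale k N ^ k) := by gcongr
      _ = _ := by ring
  refine tendsto_zero_of_forall_le (K := q + 1) (B := fun _ => 0) tendsto_const_nhds fun δ hδ => ?_
  obtain ⟨C, hC, h1⟩ := hkey δ hδ
  have h2 : ∀ᶠ N in atTop, C * scale k N ^ k < δ := by
    have := hsc.const_mul C
    rw [mul_zero] at this
    exact this.eventually (gt_mem_nhds hδ)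
  filter_upwards [h2, eventually_ne_atTop 0] with N h3 hN
  rw [abs_of_nonneg (expect_nonneg hN fun x _ => ell1_nonneg _ x)]
  have := h1 N hN
  linarith

set_option maxHeartbeats 1000000 in
/-- The Stein equation holds asymptotically for test functions of compact support. -/
theorem tendsto_stein (t : ℝ) {g g' : ℝ → ℝ} (hg : ∀ x, HasDerivAt g (g' x) x)
    (hg' : Continuous g') {R : ℝ} (hgR : ∀ x, R ≤ |x| → g x = 0)
    (hgR' : ∀ x, R ≤ |x| → g' x = 0) :
    Tendsto (fun N => expect p q N (β + t * scale k N ^ (k - 1)) h (fun x =>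
      g' ((x 0 - a) / scale k N) + (t * p * (a ^ (p - 1) - b ^ (p - 1))
        - κ * ((x 0 - a) / scale k N) ^ (k - 1)) * g ((x 0 - a) / scale k N))) atTop (𝓝 0) := by
  have hk := H.four_le_k
  have hlam := H.psi_b_pos
  have hcg : Continuous g := continuous_iff_continuousAt.2 fun x => (hg x).continuousAt
  have hcs : ∀ f : ℝ → ℝ, (∀ x, R ≤ |x| → f x = 0) → HasCompactSupport f := by
    intro f hf
    refine HasCompactSupport.intro (isCompact_Icc (a := -R) (b := R)) fun x hx => hf x ?_
    by_contra hlt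
    exact hx (abs_le.1 (not_le.1 hlt).le)
  obtain ⟨M, hM⟩ := (hcs g hgR).exists_bound_of_continuous hcg
  obtain ⟨M', hM'⟩ := (hcs g' hgR').exists_bound_of_continuous hg'
  have hM0 : 0 ≤ M := (norm_nonneg _).trans (hM 0)
  have hM0' : 0 ≤ M' := (norm_nonneg _).trans (hM' 0)
  have huc : UniformContinuous g' := (hcs g' hgR').uniformContinuous_of_continuous hg'
  obtain ⟨C₀, hC₀, hstein⟩ := H.exists_stein_bound t
  obtain ⟨C₁, hC₁, hspread⟩ := H.exists_spread_bound t
  set lam := psi p β 0 b with hlamdef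
  set Ell : ℕ → ℝ := fun N =>
    expect p q N (β + t * scale k N ^ (k - 1)) h (ell1 (twoLevel a b)) with hEll
  have hEll0 : Tendsto Ell atTop (𝓝 0) := H.tendsto_expect_ell1 t
  have hsc := tendsto_scale (show k ≠ 0 by omega)
  have hsck : Tendsto (fun N => scale k N ^ (k - 1)) atTop (𝓝 0) := by
    simpa [show k - 1 ≠ 0 by omega] using hsc.pow (k - 1)
  have hMg : ∀ x y : ℝ, |g y - g x| ≤ M' * |y - x| := fun x y =>
    (convex_univ (𝕜 := ℝ) (E := ℝ)).norm_image_sub_le_of_norm_hasDerivWithin_le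
      (fun z _ => (hg z).hasDerivWithinAt) (fun z _ => hM' z) (Set.mem_univ x) (Set.mem_univ y)
  -- Here `δ` bounds the two local errors, the oscillation of `g'` over a step `s` and the relative
  -- error of the expansion of the drift. `B` collects the errors of the approximate Stein identity
  -- divided by `lam * s`.
  refine tendsto_zero_of_forall_le (K := 1 + |R| ^ (k - 1) * M / lam)
    (B := fun N => C₀ / lam * (M * (C₁ * scale k N + Ell N) + M' * (Ell N + scale k N ^ (k - 1))
      + scale k N * (M + M))) ?_ fun δ hδ => ?_
  · have := ((((hsc.const_mul C₁).add hEll0).const_mul M).add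
      ((hEll0.add hsck).const_mul M')).add (hsc.mul_const (M + M))
    simpa using this.const_mul (C₀ / lam)
  obtain ⟨η, hη, hdr⟩ := H.exists_drift_bound hδ
  obtain ⟨ρ, hρ, huc'⟩ := Metric.uniformContinuous_iff.1 huc δ hδ
  have hev1 : ∀ᶠ N in atTop, scale k N ^ (k - 1) < ρ := hsck.eventually (gt_mem_nhds hρ)
  have hev2 : ∀ᶠ N in atTop, scale k N * |R| < η := by
    have := hsc.mul_const |R|
    rw [zero_mul] at this
    exact this.eventually (gt_mem_nhds hη)
  filter_upwards [hev1, hev2, eventually_ne_atTop 0] with N hN1 hN2 hN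
  have hε := scale_pos (k := k) hN
  have he := scale_pow_mul (show k ≠ 0 by omega) hN
  have hst := hstein N hN _ hε he g
  have hsp := hspread N hN _ hε he
  have hEN : Ell N = expect p q N (β + t * scale k N ^ (k - 1)) h (ell1 (twoLevel a b)) := rfl
  set ε := scale k N with hεdef
  have hε1 := H.eps_le_one hN he
  have e2 : ε ^ k = ε ^ (k - 1) * ε := by rw [← pow_succ]; congr 1; omega
  set s := ε ^ (k - 1) with hs
  have hs0 : 0 < s := pow_pos hε _
  set E := expect p q N (β + t * s) h with hE
  set T : (Fin q → ℝ) → ℝ := fun x => (x 0 - a) / ε with hT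
  have hEllN : 0 ≤ Ell N := expect_nonneg hN fun x _ => ell1_nonneg _ x
  -- the bound on the Stein error
  have r1 : E (fun x => (spread x + s * ell1 (twoLevel a b) x) * |g (T x)|)
      ≤ s * (M * (C₁ * ε + Ell N)) := by
    have : E (fun x => (spread x + s * ell1 (twoLevel a b) x) * |g (T x)|)
        ≤ E (fun x => M * (spread x + s * ell1 (twoLevel a b) x)) := by
      refine expect_mono_of_mem hN fun x hx => ?_
      rw [mul_comm]
      exact mul_le_mul_of_nonneg_right (hM _)
        (add_nonneg (spread_nonneg x) (mul_nonneg hs0.le (ell1_nonneg _ x)))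
    rw [hE, expect_const_mul, expect_add, expect_const_mul, ← hE, ← hEN] at this
    refine this.trans ?_
    calc M * (E spread + s * Ell N) ≤ M * (C₁ * ε ^ k + s * Ell N) := by gcongr
      _ = s * (M * (C₁ * ε + Ell N)) := by rw [e2]; ring
  have r2 : E (fun x => (ell1 (twoLevel a b) x + s) * |g (T x + s) - g (T x)|)
      ≤ s * (M' * (Ell N + s)) := by
    have : E (fun x => (ell1 (twoLevel a b) x + s) * |g (T x + s) - g (T x)|)
        ≤ E (fun x => M' * s * (ell1 (twoLevel a b) x + s)) := by
      refine expect_mono_of_mem hN fun x hx => ?_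
      rw [mul_comm]
      refine mul_le_mul_of_nonneg_right ?_ (add_nonneg (ell1_nonneg _ x) hs0.le)
      have := hMg (T x) (T x + s)
      rwa [add_sub_cancel_left, abs_of_pos hs0] at this
    rw [hE, expect_const_mul, expect_add, expect_const, ← hE, ← hEN] at this
    refine this.trans (le_of_eq (by ring))
  have r3 : ε ^ k * (E (fun x => |g (T x)|) + E (fun x => |g (T x + s)|)) ≤ s * (ε * (M + M)) := by
    have h1 : E (fun x => |g (T x)|) ≤ M := by
      rw [← expect_const (p := p) (q := q) (N := N) (b := β + t * s) (h := h) M]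
      exact expect_mono_of_mem hN fun x _ => hM _
    have h2 : E (fun x => |g (T x + s)|) ≤ M := by
      rw [← expect_const (p := p) (q := q) (N := N) (b := β + t * s) (h := h) M]
      exact expect_mono_of_mem hN fun x _ => hM _
    rw [e2]
    calc s * ε * (E (fun x => |g (T x)|) + E (fun x => |g (T x + s)|))
        ≤ s * ε * (M + M) := by gcongr
      _ = _ := by ring
  set D : (Fin q → ℝ) → ℝ := fun x => (drift p q β h (x 0)
      - t * s * p * (lam * (a ^ (p - 1) - b ^ (p - 1)))) * g (T x) with hD
  set Δ : (Fin q → ℝ) → ℝ := fun x => lam * (g (T x + s) - g (T x)) with hΔ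
  have r4 : |E D - E Δ| ≤ s * (C₀ * (M * (C₁ * ε + Ell N) + M' * (Ell N + s) + ε * (M + M))) := by
    refine hst.trans ?_
    calc _ ≤ C₀ * (s * (M * (C₁ * ε + Ell N)) + s * (M' * (Ell N + s)) + s * (ε * (M + M))) := by
          refine mul_le_mul_of_nonneg_left ?_ hC₀
          exact add_le_add (add_le_add r1 r2) r3
      _ = _ := by ring
  set F : (Fin q → ℝ) → ℝ := fun x => g' (T x) + (t * p * (a ^ (p - 1) - b ^ (p - 1))
        - κ * T x ^ (k - 1)) * g (T x) with hF
  have r5 : ∀ x ∈ stdSimplex ℝ (Fin q), |lam * s * F x - (Δ x - D x)|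
      ≤ s * (lam * δ + |R| ^ (k - 1) * M * δ) := by
    intro x _
    have e3 : lam * s * F x - (Δ x - D x) = lam * (s * g' (T x) - (g (T x + s) - g (T x)))
        + (drift p q β h (x 0) - κ * lam * (s * T x ^ (k - 1))) * g (T x) := by
      simp only [hF, hD, hΔ]; ring
    have b1 : |s * g' (T x) - (g (T x + s) - g (T x))| ≤ s * δ := by
      have h1 := (convex_Icc (T x) (T x + s)).norm_image_sub_le_of_norm_hasDerivWithin_le
        (f := fun z => g z - g' (T x) * z) (f' := fun z => g' z - g' (T x) * 1) (C := δ)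
        (x := T x) (y := T x + s)
        (fun z _ => ((hg z).sub ((hasDerivAt_id z).const_mul _)).hasDerivWithinAt)
        (fun z hz => by
          rw [mul_one, Real.norm_eq_abs, ← Real.dist_eq]
          refine (huc' ?_).le
          rw [Real.dist_eq, abs_of_nonneg (by linarith [hz.1])]
          linarith [hz.2])
        (Set.left_mem_Icc.2 (by linarith)) (Set.right_mem_Icc.2 (by linarith))
      rw [add_sub_cancel_left, Real.norm_eq_abs, Real.norm_eq_abs, abs_of_pos hs0] at h1
      have e4 : s * g' (T x) - (g (T x + s) - g (T x))
          = -(g (T x + s) - g' (T x) * (T x + s) - (g (T x) - g' (T x) * T x)) := by ring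
      rw [e4, abs_neg, mul_comm s δ]
      exact h1
    have b2 : |(drift p q β h (x 0) - κ * lam * (s * T x ^ (k - 1))) * g (T x)|
        ≤ s * (|R| ^ (k - 1) * M * δ) := by
      -- Outside the support of `g` the term vanishes. Inside, `|x 0 - a| ≤ ε |R|` eventually lies
      -- in the window where the drift is close to its leading power.
      rcases le_or_gt R |T x| with hR | hR
      · rw [hgR _ hR, mul_zero, abs_zero]
        positivity
      · have hxT : x 0 - a = ε * T x := by simp only [hT]; field_simp
        have hTR : |T x| ≤ |R| := hR.le.trans (le_abs_self R)
        have h1 : |x 0 - a| < η := by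
          rw [hxT, abs_mul, abs_of_pos hε]
          refine lt_of_le_of_lt ?_ hN2
          gcongr
        have h2 := hdr (x 0) h1
        rw [hxT, mul_pow, abs_mul, abs_of_pos hε, mul_pow, ← hs] at h2
        rw [abs_mul]
        calc _ ≤ δ * (s * |T x| ^ (k - 1)) * M :=
              mul_le_mul h2 (hM _) (abs_nonneg _) (by positivity)
          _ ≤ δ * (s * |R| ^ (k - 1)) * M := by gcongr
          _ = _ := by ring
    rw [e3]
    refine (abs_add_le _ _).trans ?_
    rw [abs_mul, abs_of_pos hlam, mul_add]
    refine add_le_add ?_ b2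
    calc lam * |s * g' (T x) - (g (T x + s) - g (T x))| ≤ lam * (s * δ) := by gcongr
      _ = _ := by ring
  have r6 := abs_expect_le_of_mem (p := p) (b := β + t * s) (h := h) hN r5
  rw [expect_const, expect_sub, expect_sub, expect_const_mul] at r6
  change |lam * s * E F - (E Δ - E D)| ≤ _ at r6
  have r7 : |lam * s * E F| ≤ s * (lam * δ + |R| ^ (k - 1) * M * δ)
      + s * (C₀ * (M * (C₁ * ε + Ell N) + M' * (Ell N + s) + ε * (M + M))) := by
    have := abs_add_le (lam * s * E F - (E Δ - E D)) (E Δ - E D)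
    rw [sub_add_cancel] at this
    refine this.trans (add_le_add r6 ?_)
    rw [abs_sub_comm]
    exact r4
  rw [abs_mul, abs_of_pos (mul_pos hlam hs0)] at r7
  have r8 : |E F| ≤ (1 + |R| ^ (k - 1) * M / lam) * δ
      + C₀ / lam * (M * (C₁ * ε + Ell N) + M' * (Ell N + s) + ε * (M + M)) := by
    have e5 : s * (lam * δ + |R| ^ (k - 1) * M * δ)
      + s * (C₀ * (M * (C₁ * ε + Ell N) + M' * (Ell N + s) + ε * (M + M)))
      = (lam * s) * ((1 + |R| ^ (k - 1) * M / lam) * δ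
      + C₀ / lam * (M * (C₁ * ε + Ell N) + M' * (Ell N + s) + ε * (M + M))) := by
      field_simp
    rw [e5] at r7
    exact le_of_mul_le_mul_left r7 (mul_pos hlam hs0)
  exact r8

end CriticalPoint

end

/-! ### The limit law -/

/-- The logarithmic density `-(κ/k) x^k + θ x`. -/
def logDensity (κ : ℝ) (k : ℕ) (θ x : ℝ) : ℝ := -(κ / k) * x ^ k + θ * x

/-- The probability measure with Lebesgue density proportional to `exp (-(κ/k) x^k + θ x)`. -/
def limitLaw (κ : ℝ) (k : ℕ) (θ : ℝ) : Measure ℝ := (volume : Measure ℝ).tilted (logDensity κ k θ)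

section LimitLaw

variable {κ : ℝ} {k : ℕ}

theorem continuous_logDensity (θ : ℝ) : Continuous (logDensity κ k θ) := by
  unfold logDensity
  fun_prop

/-- For `|x| ≥ A` the power `k ≥ 4` beats `(|θ| + 1) x ^ 2`, so the density is dominated by a
Gaussian. -/
theorem exists_logDensity_le (hκ : 0 < κ) (hk : Even k) (hk4 : 4 ≤ k) (θ : ℝ) :
    ∃ B : ℝ, ∀ x, logDensity κ k θ x ≤ B - x ^ 2 := by
  have hk0 : (0 : ℝ) < k := by exact_mod_cast (by omega : 0 < k)
  set c := κ / k with hc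
  have hc0 : 0 < c := by positivity
  set A := max 1 ((|θ| + 1) / c) with hA
  have hA1 : 1 ≤ A := le_max_left _ _
  have hA2 : (|θ| + 1) ≤ A * c := by
    rw [← div_le_iff₀ hc0]
    exact le_max_right _ _
  refine ⟨|θ| * A + A ^ 2, fun x => ?_⟩
  have h1 : θ * x ≤ |θ| * |x| := (le_abs_self _).trans (abs_mul _ _).le
  have h2 : x ^ k = |x| ^ k := (hk.pow_abs x).symm
  unfold logDensity
  rw [← hc]
  rcases le_total |x| A with h | h
  · have h3 : 0 ≤ c * x ^ k := mul_nonneg hc0.le (hk.pow_nonneg _)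
    have h4 : |θ| * |x| ≤ |θ| * A := by gcongr
    have h5 : x ^ 2 ≤ A ^ 2 := by rw [← sq_abs]; gcongr
    linarith
  · have h3 : A * |x| ^ 2 ≤ |x| ^ k := by
      calc A * |x| ^ 2 ≤ |x| * |x| ^ 2 := by gcongr
        _ = |x| ^ 3 := by ring
        _ ≤ |x| ^ k := pow_le_pow_right₀ (hA1.trans h) (by omega)
    have h4 : (|θ| + 1) * |x| ^ 2 ≤ c * x ^ k := by
      rw [h2]
      calc (|θ| + 1) * |x| ^ 2 ≤ A * c * |x| ^ 2 := by gcongr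
        _ = c * (A * |x| ^ 2) := by ring
        _ ≤ c * |x| ^ k := by gcongr
    have h5 : |θ| * |x| ≤ |θ| * |x| ^ 2 := by
      gcongr
      nlinarith [hA1.trans h]
    have h6 : 0 ≤ |θ| * A + A ^ 2 := by positivity
    rw [sq_abs] at h4 h5
    linarith

theorem integrable_exp_logDensity (hκ : 0 < κ) (hk : Even k) (hk4 : 4 ≤ k) (θ : ℝ) :
    Integrable (fun x => Real.exp (logDensity κ k θ x)) := by
  obtain ⟨B, hB⟩ := exists_logDensity_le hκ hk hk4 θ
  have h1 : Integrable fun x : ℝ => Real.exp B * Real.exp (-1 * x ^ 2) :=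
    (integrable_exp_neg_mul_sq one_pos).const_mul _
  refine h1.mono' (Real.continuous_exp.comp (continuous_logDensity θ)).aestronglyMeasurable
    (Eventually.of_forall fun x => ?_)
  rw [Real.norm_eq_abs, Real.abs_exp, ← Real.exp_add]
  exact Real.exp_le_exp.2 ((hB x).trans (by linarith))

theorem isProbabilityMeasure_limitLaw (hκ : 0 < κ) (hk : Even k) (hk4 : 4 ≤ k) (θ : ℝ) :
    IsProbabilityMeasure (limitLaw κ k θ) :=
  isProbabilityMeasure_tilted (integrable_exp_logDensity hκ hk hk4 θ)

/-- From `|x| ^ j ≤ j! (exp x + exp (-x))`, a power is dominated by the densities with tilts `θ ±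
1`. -/
theorem integrable_pow_limitLaw (hκ : 0 < κ) (hk : Even k) (hk4 : 4 ≤ k) (θ : ℝ) (j : ℕ) :
    Integrable (fun x => x ^ j) (limitLaw κ k θ) := by
  have hi := integrable_exp_logDensity hκ hk hk4
  rw [limitLaw, integrable_tilted_iff (hi θ)]
  have h1 : Integrable fun x => (j.factorial : ℝ) * (Real.exp (logDensity κ k (θ + 1) x)
      + Real.exp (logDensity κ k (θ - 1) x)) := ((hi _).add (hi _)).const_mul _
  refine h1.mono' ?_ (Eventually.of_forall fun x => ?_)
  · exact ((Real.continuous_exp.comp (continuous_logDensity θ)).smul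
      (continuous_pow j)).aestronglyMeasurable
  · rw [smul_eq_mul, norm_mul, Real.norm_eq_abs, Real.abs_exp, Real.norm_eq_abs, abs_pow]
    have h2 := Real.pow_div_factorial_le_exp |x| (abs_nonneg x) j
    rw [div_le_iff₀ (by positivity)] at h2
    have h3 : Real.exp |x| ≤ Real.exp x + Real.exp (-x) := by
      rcases abs_cases x with h | h <;> rw [h.1] <;>
        linarith [Real.exp_pos x, Real.exp_pos (-x)]
    have e1 : Real.exp (logDensity κ k (θ + 1) x)
        = Real.exp (logDensity κ k θ x) * Real.exp x := by
      rw [← Real.exp_add]; congr 1; unfold logDensity; ring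
    have e2 : Real.exp (logDensity κ k (θ - 1) x)
        = Real.exp (logDensity κ k θ x) * Real.exp (-x) := by
      rw [← Real.exp_add]; congr 1; unfold logDensity; ring
    rw [e1, e2, ← mul_add]
    calc Real.exp (logDensity κ k θ x) * |x| ^ j
        ≤ Real.exp (logDensity κ k θ x) * ((Real.exp x + Real.exp (-x)) * j.factorial) := by
          gcongr
          exact h2.trans (by gcongr)
      _ = _ := by ring

theorem hasDerivAt_logDensity (hk : k ≠ 0) (θ x : ℝ) :
    HasDerivAt (logDensity κ k θ) (θ - κ * x ^ (k - 1)) x := by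
  have h := ((hasDerivAt_pow k x).const_mul (-(κ / k))).add ((hasDerivAt_id x).const_mul θ)
  have hk0 : (k : ℝ) ≠ 0 := by exact_mod_cast hk
  refine h.congr_deriv ?_
  field_simp
  ring

/-- The solution of the Stein equation `g' + V' g = f` for `f` of compact support and mean zero. -/
theorem exists_stein_solution (hκ : 0 < κ) (hk : Even k) (hk4 : 4 ≤ k) (θ : ℝ) {f : ℝ → ℝ}
    (hf : Continuous f) {R : ℝ} (hfR : ∀ x, R ≤ |x| → f x = 0)
    (hf0 : ∫ x, f x ∂(limitLaw κ k θ) = 0) :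
    ∃ g g' : ℝ → ℝ, (∀ x, HasDerivAt g (g' x) x) ∧ Continuous g' ∧ (∀ x, R ≤ |x| → g x = 0) ∧
      (∀ x, R ≤ |x| → g' x = 0) ∧ ∀ x, g' x + (θ - κ * x ^ (k - 1)) * g x = f x := by
  set V := logDensity κ k θ with hV
  have hVc : Continuous V := continuous_logDensity θ
  have hint := integrable_exp_logDensity hκ hk hk4 θ
  set u : ℝ → ℝ := fun x => f x * Real.exp (V x) with hu
  have huc : Continuous u := hf.mul (Real.continuous_exp.comp hVc)
  have hu0 : ∀ x, R ≤ |x| → u x = 0 := fun x hx => by simp [hu, hfR x hx]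
  have htot : ∫ x, u x = 0 := by
    rw [limitLaw, integral_tilted] at hf0
    have e : (fun x => (Real.exp (V x) / ∫ y, Real.exp (V y)) • f x)
        = fun x => (∫ y, Real.exp (V y))⁻¹ * u x := by
      funext x
      simp only [hu, smul_eq_mul]
      ring
    rw [e, integral_const_mul] at hf0
    have hpos : 0 < ∫ y, Real.exp (V y) := integral_exp_pos hint
    exact (mul_eq_zero.1 hf0).resolve_left (inv_ne_zero hpos.ne')
  set P : ℝ → ℝ := fun x => ∫ y in (-R)..x, u y with hP
  have hPd : ∀ x, HasDerivAt P (u x) x := fun x =>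
    intervalIntegral.integral_hasDerivAt_right (huc.intervalIntegrable _ _)
      (huc.stronglyMeasurableAtFilter _ _) huc.continuousAt
  -- To the left of the support the primitive vanishes trivially, to the right because `f` has mean
  -- zero. This gives the solution compact support.
  have hP0 : ∀ x, R ≤ |x| → P x = 0 := by
    intro x hx
    rcases le_total 0 x with h0 | h0
    · rw [abs_of_nonneg h0] at hx
      have : ∫ y in (-R)..x, u y = ∫ y, u y := by
        refine intervalIntegral.integral_eq_integral_of_support_subset fun y hy => ?_
        by_contra hny
        refine hy (hu0 y ?_)
        rw [Set.mem_Ioc, not_and_or, not_lt, not_le] at hny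
        rcases hny with h | h
        · exact (by linarith : R ≤ -y).trans (neg_le_abs y)
        · exact (hx.trans h.le).trans (le_abs_self y)
      rw [hP]
      exact this.trans htot
    · rw [abs_of_nonpos h0] at hx
      have : ∫ y in (-R)..x, u y = ∫ y in (-R)..x, (0 : ℝ) := by
        refine intervalIntegral.integral_congr fun y hy => hu0 y ?_
        rw [Set.uIcc_of_ge (by linarith)] at hy
        exact (by linarith [hy.2] : R ≤ -y).trans (neg_le_abs y)
      rw [hP]
      simp only [this, intervalIntegral.integral_zero]
  set g : ℝ → ℝ := fun x => Real.exp (-V x) * P x with hg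
  have hgd : ∀ x, HasDerivAt g (f x - (θ - κ * x ^ (k - 1)) * g x) x := by
    intro x
    have h1 := ((hasDerivAt_logDensity (κ := κ) (by omega : k ≠ 0) θ x).neg.exp).mul (hPd x)
    refine h1.congr_deriv ?_
    have e : Real.exp (-V x) * Real.exp (V x) = 1 := by rw [← Real.exp_add]; simp
    simp only [hu, hg, Pi.neg_apply]
    linear_combination f x * e
  have hgc : Continuous g := continuous_iff_continuousAt.2 fun x => (hgd x).continuousAt
  have hg0 : ∀ x, R ≤ |x| → g x = 0 := fun x hx => by simp [hg, hP0 x hx]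
  refine ⟨g, fun x => f x - (θ - κ * x ^ (k - 1)) * g x, hgd, by fun_prop, hg0,
    fun x hx => by simp [hfR x hx, hg0 x hx], fun x => by ring⟩

end LimitLaw

/-! ### Convergence of expectations at scale `N^(-1/k)`. -/

/-- A continuous cutoff function. -/
def cutoff (R x : ℝ) : ℝ := max 0 (min 1 (R + 1 - |x|))

theorem continuous_cutoff (R : ℝ) : Continuous (cutoff R) := by unfold cutoff; fun_prop

theorem cutoff_nonneg (R x : ℝ) : 0 ≤ cutoff R x := le_max_left _ _

theorem cutoff_le_one (R x : ℝ) : cutoff R x ≤ 1 := max_le zero_le_one (min_le_left _ _)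

theorem cutoff_eq_one {R x : ℝ} (h : |x| ≤ R) : cutoff R x = 1 := by
  unfold cutoff
  rw [min_eq_left (by linarith), max_eq_right zero_le_one]

theorem cutoff_eq_zero {R x : ℝ} (h : R + 1 ≤ |x|) : cutoff R x = 0 := by
  unfold cutoff
  exact max_eq_left ((min_le_right _ _).trans (by linarith))

namespace CriticalPoint

variable {p q : ℕ} [NeZero q] {β h a b κ : ℝ} {k : ℕ} (H : CriticalPoint p q β h a b κ k)

include H

/-- Convergence of the expectations of test functions of at most quadratic growth. -/
theorem tendsto_expect (t : ℝ) {φ : ℝ → ℝ} (hφ : Continuous φ) {A : ℝ}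
    (hφA : ∀ x, |φ x| ≤ A * (1 + x ^ 2)) :
    Tendsto (fun N => expect p q N (β + t * scale k N ^ (k - 1)) h
      (fun x => φ ((x 0 - a) / scale k N))) atTop
      (𝓝 (∫ x, φ x ∂(limitLaw κ k (t * p * (a ^ (p - 1) - b ^ (p - 1)))))) := by
  have hk := H.four_le_k
  set ν := limitLaw κ k (t * p * (a ^ (p - 1) - b ^ (p - 1))) with hν
  have hpr : IsProbabilityMeasure ν :=
    isProbabilityMeasure_limitLaw H.kappa_pos H.even_k H.four_le_k _
  have hpow : ∀ j : ℕ, Integrable (fun x => x ^ j) ν := fun j =>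
    integrable_pow_limitLaw H.kappa_pos H.even_k H.four_le_k _ j
  have hA0 : 0 ≤ A := by have := (abs_nonneg _).trans (hφA 0); simpa using this
  have hφi : Integrable φ ν := by
    have h1 : Integrable (fun x => A * (1 + x ^ 2)) ν :=
      ((integrable_const 1).add (hpow 2)).const_mul A
    exact h1.mono' hφ.aestronglyMeasurable (Eventually.of_forall hφA)
  obtain ⟨C, hC, hmom⟩ := H.exists_moment_bound t
  set K := max C (∫ x, x ^ k ∂ν) with hK
  have hKC : C ≤ K := le_max_left _ _
  have hKν : ∫ x, x ^ k ∂ν ≤ K := le_max_right _ _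
  have hK0 : 0 ≤ K := hC.trans hKC
  -- reduction to small errors
  suffices hs : Tendsto (fun N => expect p q N (β + t * scale k N ^ (k - 1)) h
      (fun x => φ ((x 0 - a) / scale k N)) - ∫ x, φ x ∂ν) atTop (𝓝 0) by
    simpa using hs.add_const (∫ x, φ x ∂ν)
  set I := A * (1 + ∫ x, x ^ 2 ∂ν) with hI
  refine tendsto_zero_of_forall_le (K := 1 + 4 * A * K + 4 * I * K) (B := fun _ => 0)
    tendsto_const_nhds fun δ hδ => ?_
  -- The first bound makes the tails beyond `R` of order `δ`; the second ensures that the cutoff has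
  -- mean at least `1 / 2` under the limit law, so dividing by this mean is harmless.
  obtain ⟨R, hR1, hRδ, hRK⟩ : ∃ R : ℝ, 1 ≤ R ∧ 1 / R ^ 2 ≤ δ ∧ K / R ^ 2 ≤ 1 / 2 := by
    refine ⟨max 1 (max (1 / δ) (2 * K)), le_max_left _ _, ?_, ?_⟩
    all_goals
      set R := max 1 (max (1 / δ) (2 * K))
      have hR1 : 1 ≤ R := le_max_left _ _
      have hR2 : 1 / δ ≤ R := (le_max_left _ _).trans (le_max_right _ _)
      have hR3 : 2 * K ≤ R := (le_max_right _ _).trans (le_max_right _ _)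
      have hR4 : R ≤ R ^ 2 := by nlinarith
    · rw [div_le_iff₀ (by positivity)]
      rw [div_le_iff₀ hδ] at hR2
      nlinarith
    · rw [div_le_iff₀ (by positivity)]
      linarith
  have htail : ∀ x : ℝ, 1 - cutoff R x ≤ x ^ k / R ^ 2 ∧
      |φ x * (1 - cutoff R x)| ≤ 2 * A * (x ^ k / R ^ 2) := by
    intro x
    have hxk : 0 ≤ x ^ k := H.even_k.pow_nonneg _
    rcases le_total |x| R with h1 | h1
    · rw [cutoff_eq_one h1]
      simp only [sub_self, mul_zero, abs_zero]
      exact ⟨by positivity, by positivity⟩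
    · have hx1 : 1 ≤ |x| := hR1.trans h1
      have h2 : x ^ 2 ≤ x ^ k / R ^ 2 := by
        rw [le_div_iff₀ (by positivity), ← sq_abs, ← H.even_k.pow_abs]
        calc |x| ^ 2 * R ^ 2 ≤ |x| ^ 2 * |x| ^ 2 := by gcongr
          _ = |x| ^ 4 := by ring
          _ ≤ |x| ^ k := pow_le_pow_right₀ hx1 hk
      have h3 : 1 ≤ x ^ 2 := by rw [← sq_abs]; exact one_le_pow₀ hx1
      have h4 := cutoff_nonneg R x
      have h5 := cutoff_le_one R x
      refine ⟨by linarith, ?_⟩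
      rw [abs_mul, abs_of_nonneg (by linarith : 0 ≤ 1 - cutoff R x)]
      calc |φ x| * (1 - cutoff R x) ≤ A * (1 + x ^ 2) * 1 := by
            gcongr
            · exact hφA x
            · linarith
        _ ≤ A * (2 * x ^ 2) := by rw [mul_one]; gcongr; linarith
        _ ≤ A * (2 * (x ^ k / R ^ 2)) := by gcongr
        _ = _ := by ring
  have hci : Integrable (cutoff R) ν := (integrable_const (1 : ℝ)).mono'
    (continuous_cutoff R).aestronglyMeasurable (Eventually.of_forall fun x => by
      rw [Real.norm_eq_abs, abs_of_nonneg (cutoff_nonneg R x)]; exact cutoff_le_one R x)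
  have hφci : Integrable (fun x => φ x * cutoff R x) ν := hφi.norm.mono'
    (hφ.mul (continuous_cutoff R)).aestronglyMeasurable (Eventually.of_forall fun x => by
      rw [norm_mul, Real.norm_eq_abs (cutoff R x), abs_of_nonneg (cutoff_nonneg R x)]
      exact mul_le_of_le_one_right (norm_nonneg _) (cutoff_le_one R x))
  set c := ∫ x, cutoff R x ∂ν with hc
  set J := ∫ x, φ x * cutoff R x ∂ν with hJ
  have hki : Integrable (fun x => x ^ k / R ^ 2) ν := (hpow k).div_const _
  have hkν : ∫ x, x ^ k / R ^ 2 ∂ν ≤ K / R ^ 2 := by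
    rw [integral_div]
    gcongr
  have hc1 : 1 - c ≤ K / R ^ 2 := by
    have e : 1 - c = ∫ x, (1 - cutoff R x) ∂ν := by
      rw [integral_sub (integrable_const _) hci]; simp [hc]
    rw [e]
    exact (integral_mono ((integrable_const _).sub hci) hki fun x => (htail x).1).trans hkν
  have hc2 : c ≤ 1 := by
    have := integral_mono hci (integrable_const (1 : ℝ)) fun x => cutoff_le_one R x
    simpa using this
  have hc0 : 1 / 2 ≤ c := by linarith
  have hJI : |J| ≤ I := by
    have h1 : |J| ≤ ∫ x, A * (1 + x ^ 2) ∂ν := by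
      refine norm_integral_le_of_norm_le (f := fun x => φ x * cutoff R x)
        (g := fun x => A * (1 + x ^ 2)) (((integrable_const 1).add (hpow 2)).const_mul A)
        (Eventually.of_forall fun x => ?_)
      rw [norm_mul, Real.norm_eq_abs (cutoff R x), abs_of_nonneg (cutoff_nonneg R x)]
      exact (mul_le_of_le_one_right (norm_nonneg _) (cutoff_le_one R x)).trans (hφA x)
    rwa [integral_const_mul, integral_add (integrable_const _) (hpow 2), integral_const,
      probReal_univ, one_smul] at h1
  have hI0 : 0 ≤ I := (abs_nonneg _).trans hJI
  have hJφ : |∫ x, φ x ∂ν - J| ≤ 2 * A * (K / R ^ 2) := by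
    have e : ∫ x, φ x ∂ν - J = ∫ x, φ x * (1 - cutoff R x) ∂ν := by
      rw [hJ, ← integral_sub hφi hφci]
      congr 1; funext x; ring
    rw [e]
    have h1 := norm_integral_le_of_norm_le (f := fun x => φ x * (1 - cutoff R x))
      (g := fun x => 2 * A * (x ^ k / R ^ 2)) (hki.const_mul (2 * A))
      (Eventually.of_forall fun x => (htail x).2)
    rw [integral_const_mul] at h1
    exact h1.trans (by gcongr)
  -- the centred test function of compact support
  set f : ℝ → ℝ := fun x => φ x * cutoff R x - J / c * cutoff R x with hf
  have hfc : Continuous f := by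
    have := continuous_cutoff R
    fun_prop
  have hf0 : ∫ x, f x ∂ν = 0 := by
    rw [hf, integral_sub hφci (hci.const_mul _), integral_const_mul, ← hJ, ← hc,
      div_mul_cancel₀ _ (by linarith : c ≠ 0), sub_self]
  obtain ⟨g, g', hg1, hg2, hg3, hg4, hg5⟩ := exists_stein_solution H.kappa_pos H.even_k
    H.four_le_k (t * p * (a ^ (p - 1) - b ^ (p - 1))) hfc
    (R := R + 1) (fun x hx => by simp [hf, cutoff_eq_zero hx]) hf0
  have hst := H.tendsto_stein t hg1 hg2 hg3 hg4
  simp only [hg5] at hst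
  have hev : ∀ᶠ N in atTop, |expect p q N (β + t * scale k N ^ (k - 1)) h
      (fun x => f ((x 0 - a) / scale k N))| < δ := by
    have := hst.eventually (Metric.ball_mem_nhds 0 hδ)
    simpa [Real.dist_eq] using this
  filter_upwards [hev, eventually_ne_atTop 0] with N hN1 hN
  have hm := hmom N hN _ (scale_pos hN) (scale_pow_mul (by omega) hN)
  set E := expect p q N (β + t * scale k N ^ (k - 1)) h with hE
  set T : (Fin q → ℝ) → ℝ := fun x => (x 0 - a) / scale k N with hT
  have hmR : E (fun x => T x ^ k / R ^ 2) ≤ K / R ^ 2 := by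
    have : E (fun x => T x ^ k / R ^ 2) = 1 / R ^ 2 * E (fun x => T x ^ k) := by
      rw [hE, ← expect_const_mul]
      congr 1; funext x; ring
    rw [this, one_div, inv_mul_eq_div]
    gcongr
    exact hm.trans hKC
  have q1 : |E (fun x => φ (T x) * (1 - cutoff R (T x)))| ≤ 2 * A * (K / R ^ 2) := by
    have h1 := abs_expect_le_of_mem (p := p) (b := β + t * scale k N ^ (k - 1)) (h := h) hN
      (F := fun x => φ (T x) * (1 - cutoff R (T x))) (G := fun x => 2 * A * (T x ^ k / R ^ 2))
      fun x _ => (htail (T x)).2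
    rw [expect_const_mul] at h1
    exact h1.trans (by gcongr)
  have q2 : |E (fun x => cutoff R (T x)) - c| ≤ K / R ^ 2 := by
    have h1 : E (fun x => 1 - cutoff R (T x)) ≤ K / R ^ 2 :=
      (expect_mono_of_mem hN fun x _ => (htail (T x)).1).trans hmR
    have h2 : 0 ≤ E (fun x => 1 - cutoff R (T x)) :=
      expect_nonneg hN fun x _ => by linarith [cutoff_le_one R (T x)]
    rw [hE, expect_sub, expect_const, ← hE] at h1 h2
    rw [abs_le]
    constructor <;> linarith
  -- Four errors: the tail under the model, the centred compactly supported part (small by the Stein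
  -- equation), the mass lost by the cutoff, and the tail under the limit law.
  have e : E (fun x => φ (T x)) - ∫ x, φ x ∂ν = E (fun x => φ (T x) * (1 - cutoff R (T x)))
      + E (fun x => f (T x)) + J / c * (E (fun x => cutoff R (T x)) - c) - (∫ x, φ x ∂ν - J) := by
    have e1 : E (fun x => φ (T x)) = E (fun x => φ (T x) * (1 - cutoff R (T x)))
        + E (fun x => f (T x)) + J / c * E (fun x => cutoff R (T x)) := by
      rw [hE, ← expect_const_mul, ← expect_add, ← expect_add]
      congr 1
      funext x
      simp only [hf]
      ring
    rw [e1]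
    have : J / c * c = J := div_mul_cancel₀ _ (by linarith)
    linear_combination this
  have q3 : |J / c * (E (fun x => cutoff R (T x)) - c)| ≤ 2 * I * (K / R ^ 2) := by
    rw [abs_mul, abs_div, abs_of_pos (by linarith : 0 < c)]
    have : |J| / c ≤ 2 * I := by
      rw [div_le_iff₀ (by linarith)]
      nlinarith
    gcongr
  rw [e]
  have q4 : |E (fun x => φ (T x) * (1 - cutoff R (T x)))
      + E (fun x => f (T x)) + J / c * (E (fun x => cutoff R (T x)) - c) - (∫ x, φ x ∂ν - J)|
      ≤ 2 * A * (K / R ^ 2) + δ + 2 * I * (K / R ^ 2) + 2 * A * (K / R ^ 2) := by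
    refine (abs_sub _ _).trans (add_le_add ((abs_add_le _ _).trans
      (add_le_add ((abs_add_le _ _).trans (add_le_add q1 hN1.le)) q3)) hJφ)
  refine q4.trans ?_
  have q5 : K / R ^ 2 ≤ K * δ := by
    rw [div_eq_mul_one_div]
    gcongr
  have q6 : 0 ≤ I * K * δ := by positivity
  have q7 : A * (K / R ^ 2) ≤ A * (K * δ) := by gcongr
  have q8 : I * (K / R ^ 2) ≤ I * (K * δ) := by gcongr
  linarith

end CriticalPoint

/-! ### From smooth test functions to distribution functions -/

/-- The piecewise linear function that is `1` below `u` and `0` above `u + δ`. -/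
def ramp (u δ y : ℝ) : ℝ := max 0 (min 1 ((u + δ - y) / δ))

theorem continuous_ramp (u δ : ℝ) : Continuous (ramp u δ) := by unfold ramp; fun_prop

theorem ramp_nonneg (u δ y : ℝ) : 0 ≤ ramp u δ y := le_max_left _ _

theorem ramp_le_one (u δ y : ℝ) : ramp u δ y ≤ 1 := max_le zero_le_one (min_le_left _ _)

theorem ramp_eq_one {u δ y : ℝ} (hδ : 0 < δ) (h : y ≤ u) : ramp u δ y = 1 := by
  unfold ramp
  rw [min_eq_left, max_eq_right zero_le_one]
  rw [le_div_iff₀ hδ]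
  linarith

theorem ramp_eq_zero {u δ y : ℝ} (hδ : 0 < δ) (h : u + δ ≤ y) : ramp u δ y = 0 := by
  unfold ramp
  refine max_eq_left ((min_le_right _ _).trans ?_)
  exact div_nonpos_of_nonpos_of_nonneg (by linarith) hδ.le

theorem ramp_sub_le {u u' δ y y' : ℝ} (hδ : 0 < δ) :
    ramp u δ y ≤ ramp u' δ y' + (|u - u'| + |y - y'|) / δ := by
  unfold ramp
  have h0 : 0 ≤ (|u - u'| + |y - y'|) / δ := by positivity
  have h1 : (u + δ - y) / δ ≤ (u' + δ - y') / δ + (|u - u'| + |y - y'|) / δ := by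
    rw [← add_div]
    gcongr
    linarith [le_abs_self (u - u'), neg_abs_le (y - y')]
  refine max_le (by linarith [le_max_left 0 (min 1 ((u' + δ - y') / δ))]) ?_
  have h2 : min 1 ((u' + δ - y') / δ) ≤ max 0 (min 1 ((u' + δ - y') / δ)) := le_max_right _ _
  rcases le_total 1 ((u' + δ - y') / δ) with h3 | h3
  · rw [min_eq_left h3] at h2 ⊢
    exact (min_le_left _ _).trans (by linarith)
  · rw [min_eq_right h3] at h2 ⊢
    exact (min_le_right _ _).trans (by linarith)

theorem indicator_le_ramp {ι : Type*} (f : ι → ℝ) (u : ℝ) {δ : ℝ} (hδ : 0 < δ) (i : ι) :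
    {i | f i ≤ u}.indicator (1 : ι → ℝ) i ≤ ramp u δ (f i) := by
  by_cases h : f i ≤ u
  · rw [Set.indicator_of_mem (show i ∈ {i | f i ≤ u} from h), ramp_eq_one hδ h]
    simp
  · rw [Set.indicator_of_notMem (show i ∉ {i | f i ≤ u} from h)]
    exact ramp_nonneg _ _ _

theorem ramp_le_indicator {ι : Type*} (f : ι → ℝ) (u : ℝ) {δ : ℝ} (hδ : 0 < δ) (i : ι) :
    ramp u δ (f i) ≤ {i | f i ≤ u + δ}.indicator (1 : ι → ℝ) i := by
  by_cases h : f i ≤ u + δ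
  · rw [Set.indicator_of_mem (show i ∈ {i | f i ≤ u + δ} from h)]
    exact ramp_le_one _ _ _
  · rw [Set.indicator_of_notMem (show i ∉ {i | f i ≤ u + δ} from h),
      ramp_eq_zero hδ (not_le.1 h).le]

theorem tendsto_measureReal_sublevel_right (ν : Measure ℝ) [IsProbabilityMeasure ν] {φ : ℝ → ℝ}
    (hφ : Continuous φ) (w : ℝ) :
    Tendsto (fun δ => ν.real {y | φ y ≤ w + δ}) (𝓝[>] 0) (𝓝 (ν.real {y | φ y ≤ w})) := by
  have hm : Measurable φ := hφ.measurable
  have hcdf : ∀ u, ν.real {y | φ y ≤ u} = ProbabilityTheory.cdf (ν.map φ) u := by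
    intro u
    have := Measure.isProbabilityMeasure_map (μ := ν) hm.aemeasurable
    rw [ProbabilityTheory.cdf_eq_real, map_measureReal_apply hm measurableSet_Iic]
    rfl
  simp only [hcdf]
  have hrc := (ProbabilityTheory.cdf (ν.map φ)).right_continuous w
  have h1 : Tendsto (fun δ : ℝ => w + δ) (𝓝[>] 0) (𝓝[≥] w) := by
    refine tendsto_nhdsWithin_iff.2 ⟨?_, ?_⟩
    · have : Tendsto (fun δ : ℝ => w + δ) (𝓝 0) (𝓝 (w + 0)) :=
        (continuous_const.add continuous_id).tendsto 0
      rw [add_zero] at this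
      exact this.mono_left nhdsWithin_le_nhds
    · filter_upwards [self_mem_nhdsWithin] with δ hδ
      have : (0 : ℝ) < δ := hδ
      simp only [Set.mem_Ici]
      linarith
  exact hrc.tendsto.comp h1

/-- Right continuity for `-φ` at `-w` gives left continuity of the strict sublevels; absence of an
atom at `w` identifies these with the weak ones. -/
theorem tendsto_measureReal_sublevel_left (ν : Measure ℝ) [IsProbabilityMeasure ν] {φ : ℝ → ℝ}
    (hφ : Continuous φ) {w : ℝ} (hw : ν {y | φ y = w} = 0) :
    Tendsto (fun δ => ν.real {y | φ y ≤ w - δ}) (𝓝[>] 0) (𝓝 (ν.real {y | φ y ≤ w})) := by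
  have hcont : Continuous fun y => -φ y := hφ.neg
  have h := tendsto_measureReal_sublevel_right ν hcont (-w)
  -- compare with the complements
  have hm : Measurable φ := hφ.measurable
  have h1 : ∀ u : ℝ, ν.real {y | u < φ y} = 1 - ν.real {y | φ y ≤ u} := by
    intro u
    have : {y | u < φ y} = {y | φ y ≤ u}ᶜ := by ext; simp
    rw [this, probReal_compl_eq_one_sub (measurableSet_le hm measurable_const)]
  have h2 : ν.real {y | -φ y ≤ -w} = 1 - ν.real {y | φ y ≤ w} := by
    rw [← h1]
    refine measureReal_congr ?_
    have : ∀ᵐ y ∂ν, φ y ≠ w := by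
      rw [ae_iff]
      simpa using hw
    filter_upwards [this] with y hy
    apply propext
    change -φ y ≤ -w ↔ w < φ y
    rw [neg_le_neg_iff]
    exact ⟨fun h => lt_of_le_of_ne h (Ne.symm hy), le_of_lt⟩
  rw [h2] at h
  have h3 : Tendsto (fun δ => 1 - ν.real {y | -φ y ≤ -w + δ}) (𝓝[>] 0)
      (𝓝 (ν.real {y | φ y ≤ w})) := by simpa using h.const_sub 1
  -- Evaluating the reflected statement at `2 * δ` turns its strict sublevel into a lower bound for
  -- the weak sublevel at `w - δ`.
  refine tendsto_of_tendsto_of_tendsto_of_le_of_le' (h3.comp (?_ : Tendsto (fun δ : ℝ => 2 * δ)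
    (𝓝[>] 0) (𝓝[>] 0))) tendsto_const_nhds ?_ ?_
  · refine tendsto_nhdsWithin_iff.2 ⟨?_, ?_⟩
    · have : Tendsto (fun δ : ℝ => 2 * δ) (𝓝 0) (𝓝 (2 * 0)) :=
        (continuous_const.mul continuous_id).tendsto 0
      rw [mul_zero] at this
      exact this.mono_left nhdsWithin_le_nhds
    · filter_upwards [self_mem_nhdsWithin] with δ hδ
      have : (0 : ℝ) < δ := hδ
      simp only [Set.mem_Ioi]
      linarith
  · filter_upwards [self_mem_nhdsWithin] with δ hδ
    have hδ' : (0 : ℝ) < δ := hδ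
    have h4 : {y | -φ y ≤ -w + 2 * δ} = {y | φ y < w - 2 * δ}ᶜ := by
      ext y
      simp only [Set.mem_ofPred_eq, Set.mem_compl_iff, not_lt]
      constructor <;> intro h <;> linarith
    simp only [Function.comp]
    rw [h4, probReal_compl_eq_one_sub (measurableSet_lt hm measurable_const), sub_sub_cancel]
    refine measureReal_mono fun y hy => ?_
    simp only [Set.mem_ofPred_eq] at hy ⊢
    linarith
  · filter_upwards [self_mem_nhdsWithin] with δ hδ
    have hδ' : (0 : ℝ) < δ := hδ
    refine measureReal_mono fun y hy => ?_
    simp only [Set.mem_ofPred_eq] at hy ⊢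
    linarith

namespace CriticalPoint

variable {p q : ℕ} [NeZero q] {β h a b κ : ℝ} {k : ℕ} (H : CriticalPoint p q β h a b κ k)

include H

theorem tendsto_expect_zero {φ : ℝ → ℝ} (hφ : Continuous φ) {A : ℝ}
    (hφA : ∀ x, |φ x| ≤ A * (1 + x ^ 2)) :
    Tendsto (fun N => expect p q N β h (fun x => φ ((x 0 - a) / scale k N))) atTop
      (𝓝 (∫ x, φ x ∂(limitLaw κ k 0))) := by
  simpa using H.tendsto_expect 0 hφ hφA

/-- Indicators are squeezed between ramps of width `δ`. Ramps are `1/δ`-Lipschitz in threshold and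
argument, so convergence of `u` and `L¹`-closeness of `W` to `φ` of the rescaled entry suffice. -/
theorem tendsto_expect_indicator_le {φ : ℝ → ℝ} (hφ : Continuous φ)
    {W : ℕ → (Fin q → ℝ) → ℝ}
    (hW : Tendsto (fun N => expect p q N β h (fun x => |W N x - φ ((x 0 - a) / scale k N)|))
      atTop (𝓝 0))
    {u : ℕ → ℝ} {w : ℝ} (hu : Tendsto u atTop (𝓝 w)) (hw : limitLaw κ k 0 {y | φ y = w} = 0) :
    Tendsto (fun N => expect p q N β h ({x | W N x ≤ u N}.indicator 1)) atTop
      (𝓝 ((limitLaw κ k 0).real {y | φ y ≤ w})) := by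
  set ν := limitLaw κ k 0 with hν
  have hpr : IsProbabilityMeasure ν :=
    isProbabilityMeasure_limitLaw H.kappa_pos H.even_k H.four_le_k _
  have hm : Measurable φ := hφ.measurable
  have hramp : ∀ v δ : ℝ, 0 < δ →
      Tendsto (fun N => expect p q N β h (fun x => ramp v δ (φ ((x 0 - a) / scale k N)))) atTop
        (𝓝 (∫ x, ramp v δ (φ x) ∂ν)) := by
    intro v δ hδ
    refine H.tendsto_expect_zero (φ := fun y => ramp v δ (φ y)) (A := 1)
      ((continuous_ramp v δ).comp hφ) fun x => ?_
    rw [abs_of_nonneg (ramp_nonneg _ _ _)]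
    nlinarith [ramp_le_one v δ (φ x), sq_nonneg x]
  have hri : ∀ v δ : ℝ, Integrable (fun x => ramp v δ (φ x)) ν := fun v δ =>
    (integrable_const (1 : ℝ)).mono' ((continuous_ramp v δ).comp hφ).aestronglyMeasurable
      (Eventually.of_forall fun x => by
        rw [Real.norm_eq_abs, abs_of_nonneg (ramp_nonneg _ _ _)]; exact ramp_le_one _ _ _)
  have hind : ∀ v : ℝ, ∫ x, {y | φ y ≤ v}.indicator (1 : ℝ → ℝ) x ∂ν = ν.real {y | φ y ≤ v} :=
    fun v => integral_indicator_one (measurableSet_le hm measurable_const)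
  have hindi : ∀ v : ℝ, Integrable ({y | φ y ≤ v}.indicator (1 : ℝ → ℝ)) ν := fun v =>
    (integrable_const (1 : ℝ)).indicator (measurableSet_le hm measurable_const)
  have herr : ∀ δ : ℝ, Tendsto (fun N => (|u N - w|
      + expect p q N β h (fun x => |W N x - φ ((x 0 - a) / scale k N)|)) / δ) atTop (𝓝 0) := by
    intro δ
    have h1 : Tendsto (fun N => |u N - w|) atTop (𝓝 0) := by
      have := (hu.sub_const w).abs
      simpa using this
    simpa using (h1.add hW).div_const δ
  rw [Metric.tendsto_nhds]
  intro e he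
  have hr := (tendsto_measureReal_sublevel_right ν hφ w).eventually
    (Metric.ball_mem_nhds _ (half_pos he))
  have hl := (tendsto_measureReal_sublevel_left ν hφ hw).eventually
    (Metric.ball_mem_nhds _ (half_pos he))
  obtain ⟨δ, ⟨hδr, hδl⟩, hδ⟩ := ((hr.and hl).and self_mem_nhdsWithin).exists
  have hδ0 : (0 : ℝ) < δ := hδ
  rw [Real.dist_eq, abs_lt] at hδr hδl
  -- upper bound
  have hup : ∀ᶠ N in atTop, expect p q N β h (fun x => ramp w δ (φ ((x 0 - a) / scale k N)))
      + (|u N - w| + expect p q N β h (fun x => |W N x - φ ((x 0 - a) / scale k N)|)) / δ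
      < ν.real {y | φ y ≤ w} + e := by
    have h1 := (hramp w δ hδ0).add (herr δ)
    refine h1.eventually (gt_mem_nhds ?_)
    rw [add_zero]
    have h2 : ∫ x, ramp w δ (φ x) ∂ν ≤ ν.real {y | φ y ≤ w + δ} := by
      rw [← hind]
      exact integral_mono (hri w δ) (hindi _) fun x => ramp_le_indicator φ w hδ0 x
    linarith
  have hlo : ∀ᶠ N in atTop, ν.real {y | φ y ≤ w} - e
      < expect p q N β h (fun x => ramp (w - δ) δ (φ ((x 0 - a) / scale k N)))
      - (|u N - w| + expect p q N β h (fun x => |W N x - φ ((x 0 - a) / scale k N)|)) / δ := by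
    have h1 := (hramp (w - δ) δ hδ0).sub (herr δ)
    refine h1.eventually (lt_mem_nhds ?_)
    rw [sub_zero]
    have h2 : ν.real {y | φ y ≤ w - δ} ≤ ∫ x, ramp (w - δ) δ (φ x) ∂ν := by
      rw [← hind]
      exact integral_mono (hindi _) (hri _ δ) fun x => indicator_le_ramp φ (w - δ) hδ0 x
    linarith
  filter_upwards [hup, hlo, eventually_ne_atTop 0] with N hN1 hN2 hN
  have key : ∀ v v' : ℝ, |v - v'| = |u N - w| →
      expect p q N β h (fun x => (|v - v'| + |W N x - φ ((x 0 - a) / scale k N)|) / δ)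
      = (|u N - w| + expect p q N β h (fun x => |W N x - φ ((x 0 - a) / scale k N)|)) / δ := by
    intro v v' hv
    rw [hv]
    have : (fun x : Fin q → ℝ => (|u N - w| + |W N x - φ ((x 0 - a) / scale k N)|) / δ)
        = fun x => 1 / δ * (|u N - w| + |W N x - φ ((x 0 - a) / scale k N)|) := by
      funext x; ring
    rw [this, expect_const_mul, expect_add, expect_const]
    ring
  have hA : expect p q N β h ({x | W N x ≤ u N}.indicator 1)
      ≤ expect p q N β h (fun x => ramp w δ (φ ((x 0 - a) / scale k N)))
      + (|u N - w| + expect p q N β h (fun x => |W N x - φ ((x 0 - a) / scale k N)|)) / δ := by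
    rw [← key (u N) w rfl, ← expect_add]
    exact expect_mono_of_mem hN fun x _ =>
      (indicator_le_ramp (W N) (u N) hδ0 x).trans (ramp_sub_le hδ0)
  have hB : expect p q N β h (fun x => ramp (w - δ) δ (φ ((x 0 - a) / scale k N)))
      - (|u N - w| + expect p q N β h (fun x => |W N x - φ ((x 0 - a) / scale k N)|)) / δ
      ≤ expect p q N β h ({x | W N x ≤ u N}.indicator 1) := by
    have hv : |u N - δ - (w - δ)| = |u N - w| := by congr 1; ring
    rw [← key (u N - δ) (w - δ) hv, ← expect_sub]
    refine expect_mono_of_mem hN fun x _ => ?_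
    have h1 := ramp_le_indicator (W N) (u N - δ) hδ0 x
    rw [sub_add_cancel] at h1
    have h2 := ramp_sub_le (u := w - δ) (u' := u N - δ)
      (y := φ ((x 0 - a) / scale k N)) (y' := W N x) hδ0
    rw [abs_sub_comm (w - δ), abs_sub_comm (φ _)] at h2
    linarith
  rw [Real.dist_eq, abs_lt]
  constructor <;> linarith

end CriticalPoint

/-! ### The maximum likelihood estimator -/

/-- The sufficient statistic. -/
def powSum (p : ℕ) {q : ℕ} (t : Fin q → ℝ) : ℝ := ∑ r, t r ^ p

section MLE

variable {p q N : ℕ} [NeZero q] {b h : ℝ}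

theorem pottsMeasure_real (s : Set (Fin N → Fin q)) :
    (pottsMeasure p q N b h).real s = ∑ x, prob p q N b h x * s.indicator 1 x := by
  have h1 : pottsMeasure p q N b h s
      = ∑ x : Fin N → Fin q, ENNReal.ofReal (prob p q N b h x * s.indicator 1 x) := by
    rw [pottsMeasure, Measure.finsetSum_apply]
    refine Finset.sum_congr rfl fun x _ => ?_
    rw [Measure.smul_apply, Measure.dirac_apply' _ (Set.Finite.measurableSet (Set.toFinite s)),
      smul_eq_mul]
    by_cases hx : x ∈ s <;> simp [hx]
  have h0 : ∀ x : Fin N → Fin q, 0 ≤ prob p q N b h x * s.indicator 1 x := fun x =>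
    mul_nonneg (prob_pos x).le (Set.indicator_nonneg (fun _ _ => zero_le_one) _)
  rw [Measure.real, h1, ← ENNReal.ofReal_sum_of_nonneg fun x _ => h0 x,
    ENNReal.toReal_ofReal (Finset.sum_nonneg fun x _ => h0 x)]

theorem pottsMeasure_real_preimage (s : Set (Fin q → ℝ)) :
    (pottsMeasure p q N b h).real (magnetization ⁻¹' s) = expect p q N b h (s.indicator 1) := by
  rw [pottsMeasure_real]
  rfl

/-- The inverse likelihood, up to the factor `1`, is a positive combination of exponentials. -/
theorem inv_prob_eq (x : Fin N → Fin q) (b : ℝ) :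
    (prob p q N b h x)⁻¹ = ∑ y : Fin N → Fin q,
      Real.exp (N * h * (magnetization y 0 - magnetization x 0)) *
        Real.exp (b * (N * (powSum p (magnetization y) - powSum p (magnetization x)))) := by
  rw [prob, inv_div, Finset.sum_div]
  refine Finset.sum_congr rfl fun y _ => ?_
  rw [weight, weight, ← Real.exp_sub, ← Real.exp_add]
  congr 1
  unfold powSum
  ring

theorem isMaximumLikelihood_iff (x : Fin N → Fin q) (b : ℝ) :
    IsMaximumLikelihood p q N h x b ↔
      ∀ b', (prob p q N b h x)⁻¹ ≤ (prob p q N b' h x)⁻¹ :=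
  forall_congr' fun b' => by rw [inv_le_inv₀ (prob_pos x) (prob_pos x)]

theorem hasDerivAt_inv_prob (x : Fin N → Fin q) (b : ℝ) :
    HasDerivAt (fun b => (prob p q N b h x)⁻¹) (∑ y : Fin N → Fin q,
      Real.exp (N * h * (magnetization y 0 - magnetization x 0)) *
        (Real.exp (b * (N * (powSum p (magnetization y) - powSum p (magnetization x))))
          * (N * (powSum p (magnetization y) - powSum p (magnetization x))))) b := by
  simp only [inv_prob_eq]
  refine HasDerivAt.fun_sum fun y _ => ?_
  refine HasDerivAt.const_mul _ ?_
  simpa using ((hasDerivAt_id b).mul_const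
    ((N : ℝ) * (powSum p (magnetization y) - powSum p (magnetization x)))).exp

/-- Each exponential is the inverse likelihood of `x` times the probability of `y`, so the
derivative of the inverse likelihood is that inverse likelihood times `N (E_b S - S(x))`. -/
theorem deriv_inv_prob (x : Fin N → Fin q) (b : ℝ) :
    ∑ y : Fin N → Fin q,
      Real.exp (N * h * (magnetization y 0 - magnetization x 0)) *
        (Real.exp (b * (N * (powSum p (magnetization y) - powSum p (magnetization x))))
          * (N * (powSum p (magnetization y) - powSum p (magnetization x))))
      = (prob p q N b h x)⁻¹ * (N * (expect p q N b h (powSum p) - powSum p (magnetization x))) := by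
  have h1 : ∀ y : Fin N → Fin q,
      Real.exp (N * h * (magnetization y 0 - magnetization x 0)) *
        Real.exp (b * (N * (powSum p (magnetization y) - powSum p (magnetization x))))
        = (prob p q N b h x)⁻¹ * prob p q N b h y := by
    intro y
    have hZ := (partition_pos p q N b h).ne'
    have hw := (weight_pos (p := p) (b := b) (h := h) x).ne'
    rw [prob, prob, inv_div, div_mul_div_comm, mul_comm (∑ y, _), mul_div_mul_right _ _ hZ, weight, weight,
      ← Real.exp_sub, ← Real.exp_add]
    congr 1
    unfold powSum
    ring
  have h2 : expect p q N b h (powSum p) - powSum p (magnetization x)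
      = expect p q N b h (fun t => powSum p t - powSum p (magnetization x)) := by
    rw [expect_sub, expect_const]
  rw [h2]
  simp only [expect, Finset.mul_sum]
  refine Finset.sum_congr rfl fun y _ => ?_
  rw [← mul_assoc, h1 y]
  ring

/-- The derivative `D` of the inverse likelihood is a sum of terms proportional to `exp (b d) d`,
each nondecreasing in `b` and strictly increasing when `d ≠ 0`. The estimate is its zero, so it is
at most `b` exactly when `D b ≥ 0`. -/
theorem maximumLikelihood_le_iff (hN : N ≠ 0) {x : Fin N → Fin q} {bh : ℝ}
    (hb : IsMaximumLikelihood p q N h x bh)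
    (hx : ∃ y : Fin N → Fin q, powSum p (magnetization y) ≠ powSum p (magnetization x)) :
    bh ≤ b ↔ powSum p (magnetization x) ≤ expect p q N b h (powSum p) := by
  have hN0 : (0 : ℝ) < N := by exact_mod_cast Nat.pos_of_ne_zero hN
  set D : ℝ → ℝ := fun b => ∑ y : Fin N → Fin q,
      Real.exp (N * h * (magnetization y 0 - magnetization x 0)) *
        (Real.exp (b * (N * (powSum p (magnetization y) - powSum p (magnetization x))))
          * (N * (powSum p (magnetization y) - powSum p (magnetization x)))) with hD
  have hmono : StrictMono D := by
    intro b₁ b₂ hlt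
    have hle : ∀ d : ℝ, Real.exp (b₁ * d) * d ≤ Real.exp (b₂ * d) * d := by
      intro d
      rcases le_total 0 d with hd | hd
      · have : Real.exp (b₁ * d) ≤ Real.exp (b₂ * d) := Real.exp_le_exp.2 (by nlinarith)
        nlinarith
      · have : Real.exp (b₂ * d) ≤ Real.exp (b₁ * d) := Real.exp_le_exp.2 (by nlinarith)
        nlinarith
    obtain ⟨y, hy⟩ := hx
    refine Finset.sum_lt_sum (fun y _ => ?_) ⟨y, Finset.mem_univ y, ?_⟩
    · exact mul_le_mul_of_nonneg_left (hle _) (Real.exp_pos _).le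
    · refine mul_lt_mul_of_pos_left ?_ (Real.exp_pos _)
      rcases lt_or_gt_of_ne hy with h1 | h1
      · have hd : (N : ℝ) * (powSum p (magnetization y) - powSum p (magnetization x)) < 0 := by
          nlinarith
        exact mul_lt_mul_of_neg_right (Real.exp_lt_exp.2 (by nlinarith)) hd
      · have hd : 0 < (N : ℝ) * (powSum p (magnetization y) - powSum p (magnetization x)) := by
          apply mul_pos hN0; linarith
        exact mul_lt_mul_of_pos_right (Real.exp_lt_exp.2 (by nlinarith)) hd
  have h0 : D bh = 0 := by
    have hmin : IsLocalMin (fun b => (prob p q N b h x)⁻¹) bh :=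
      Eventually.of_forall ((isMaximumLikelihood_iff x bh).1 hb)
    exact hmin.hasDerivAt_eq_zero (hasDerivAt_inv_prob x bh)
  rw [← hmono.le_iff_le, h0]
  change 0 ≤ D b ↔ _
  rw [hD]
  beta_reduce
  rw [deriv_inv_prob]
  have hp0 : 0 < (prob p q N b h x)⁻¹ := inv_pos.2 (prob_pos x)
  rw [mul_nonneg_iff_of_pos_left hp0, mul_nonneg_iff_of_pos_left hN0, sub_nonneg]

/-- The term of `y` in the inverse likelihood blows up as `b → -∞` and that of `z` as `b → ∞`, so
the continuous inverse likelihood attains its minimum. -/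
theorem exists_maximumLikelihood (hN : N ≠ 0) {x y z : Fin N → Fin q}
    (hy : powSum p (magnetization y) < powSum p (magnetization x))
    (hz : powSum p (magnetization x) < powSum p (magnetization z)) :
    ∃ b, IsMaximumLikelihood p q N h x b := by
  have hN0 : (0 : ℝ) < N := by exact_mod_cast Nat.pos_of_ne_zero hN
  simp only [isMaximumLikelihood_iff]
  have hcont : Continuous fun b => (prob p q N b h x)⁻¹ :=
    continuous_iff_continuousAt.2 fun b => (hasDerivAt_inv_prob x b).continuousAt
  refine hcont.exists_forall_le ?_
  have hterm : ∀ (w : Fin N → Fin q) (b : ℝ),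
      Real.exp (N * h * (magnetization w 0 - magnetization x 0)) *
        Real.exp (b * (N * (powSum p (magnetization w) - powSum p (magnetization x))))
        ≤ (prob p q N b h x)⁻¹ := by
    intro w b
    rw [inv_prob_eq]
    exact Finset.single_le_sum (f := fun w : Fin N → Fin q =>
      Real.exp (N * h * (magnetization w 0 - magnetization x 0)) *
        Real.exp (b * (N * (powSum p (magnetization w) - powSum p (magnetization x)))))
      (fun w _ => (mul_pos (Real.exp_pos _) (Real.exp_pos _)).le) (Finset.mem_univ w)
  rw [cocompact_eq_atBot_atTop, tendsto_sup]
  constructor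
  · refine tendsto_atTop_mono (hterm y) (Tendsto.const_mul_atTop (Real.exp_pos _) ?_)
    refine Real.tendsto_exp_atTop.comp (Tendsto.atBot_mul_const_of_neg ?_ tendsto_id)
    nlinarith
  · refine tendsto_atTop_mono (hterm z) (Tendsto.const_mul_atTop (Real.exp_pos _) ?_)
    refine Real.tendsto_exp_atTop.comp (Tendsto.atTop_mul_const ?_ tendsto_id)
    apply mul_pos hN0
    linarith

end MLE

section Limit

variable {p q : ℕ} [NeZero q] {β h : ℝ}

/-- If the sufficient statistic, affinely rescaled, has a limit law `G` without atoms and the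
rescaled means under the perturbed parameters converge to `e`, then the distribution functions of
the maximum likelihood estimator at these parameters converge to `G e`. -/
theorem tendsto_distribution_mle {βhat : (N : ℕ) → (Fin N → Fin q) → EReal}
    (hβhat : IsMLE p q h βhat) {α : ℕ → ℝ} {σ : ℝ} (hα : ∀ᶠ N in atTop, 0 < α N)
    {τ : ℕ → ℝ} {e : ℝ} {G : ℝ → ℝ}
    (he : Tendsto (fun N => expect p q N (β + τ N) h (fun x => α N * (powSum p x - σ)))
      atTop (𝓝 e))
    (hG : ∀ (u : ℕ → ℝ) (w : ℝ), Tendsto u atTop (𝓝 w) →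
      Tendsto (fun N => expect p q N β h ({x | α N * (powSum p x - σ) ≤ u N}.indicator 1)) atTop
        (𝓝 (G w)))
    (hG0 : ∀ δ : ℝ, 0 < δ → ∃ w, 0 < G w ∧ G w < δ)
    (hG1 : ∀ δ : ℝ, 0 < δ → ∃ w, 1 - δ < G w ∧ G w < 1) :
    Tendsto (fun N => (pottsMeasure p q N β h).real
      {x | βhat N x ≤ ((β + τ N : ℝ) : EReal)}) atTop (𝓝 (G e)) := by
  classical
  set W : ℕ → (Fin q → ℝ) → ℝ := fun N x => α N * (powSum p x - σ) with hW
  -- Samples with extremal statistic are the only ones at which the value of the estimator may be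
  -- arbitrary.
  set lo : (N : ℕ) → Set (Fin N → Fin q) := fun N =>
    {x | ∀ y : Fin N → Fin q, powSum p (magnetization x) ≤ powSum p (magnetization y)} with hlo
  set hi : (N : ℕ) → Set (Fin N → Fin q) := fun N =>
    {x | ∀ y : Fin N → Fin q, powSum p (magnetization y) ≤ powSum p (magnetization x)} with hhi
  have hexc : ∀ (N : ℕ) (w : ℝ), 0 < expect p q N β h ({x | W N x ≤ w}.indicator 1) →
      ∃ y : Fin N → Fin q, W N (magnetization y) ≤ w := by
    intro N w hpos
    by_contra hcon
    push Not at hcon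
    refine hpos.ne' (Finset.sum_eq_zero fun y _ => ?_)
    rw [Set.indicator_of_notMem (show magnetization y ∉ {x | W N x ≤ w} from not_le.2 (hcon y)),
      mul_zero]
  have hexc' : ∀ (N : ℕ) (w : ℝ), expect p q N β h ({x | W N x ≤ w}.indicator 1) < 1 →
      ∃ y : Fin N → Fin q, w < W N (magnetization y) := by
    intro N w hlt
    by_contra hcon
    push Not at hcon
    refine hlt.ne ?_
    rw [← sum_prob p q N β h]
    refine Finset.sum_congr rfl fun y _ => ?_
    rw [Set.indicator_of_mem (show magnetization y ∈ {x | W N x ≤ w} from hcon y), Pi.one_apply,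
      mul_one]
  have hWle : ∀ N, 0 < α N → ∀ x y : Fin q → ℝ, powSum p x ≤ powSum p y ↔ W N x ≤ W N y := by
    intro N hN x y
    simp only [hW]
    rw [mul_le_mul_iff_right₀ hN, sub_le_sub_iff_right]
  have hlo0 : Tendsto (fun N => (pottsMeasure p q N β h).real (lo N)) atTop (𝓝 0) := by
    rw [Metric.tendsto_nhds]
    intro δ hδ
    -- Since `G w > 0`, eventually some sample has rescaled statistic at most `w`; hence so do all
    -- minimizing samples, and `{W ≤ w}` has probability below `δ`.
    obtain ⟨w, hw0, hwδ⟩ := hG0 δ hδ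
    have h1 := hG (fun _ => w) w tendsto_const_nhds
    filter_upwards [h1.eventually (lt_mem_nhds hw0), h1.eventually (gt_mem_nhds hwδ), hα]
      with N h2 h3 hN
    obtain ⟨y, hy⟩ := hexc N w h2
    rw [Real.dist_eq, sub_zero, abs_of_nonneg measureReal_nonneg]
    refine lt_of_le_of_lt ?_ h3
    rw [← pottsMeasure_real_preimage]
    refine measureReal_mono fun x hx => ?_
    exact ((hWle N hN _ _).1 (hx y)).trans hy
  have hhi0 : Tendsto (fun N => (pottsMeasure p q N β h).real (hi N)) atTop (𝓝 0) := by
    rw [Metric.tendsto_nhds]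
    intro δ hδ
    obtain ⟨w, hw0, hwδ⟩ := hG1 δ hδ
    have h1 := hG (fun _ => w) w tendsto_const_nhds
    filter_upwards [h1.eventually (lt_mem_nhds hw0), h1.eventually (gt_mem_nhds hwδ), hα]
      with N h2 h3 hN
    obtain ⟨y, hy⟩ := hexc' N w h3
    rw [Real.dist_eq, sub_zero, abs_of_nonneg measureReal_nonneg]
    have h4 : (pottsMeasure p q N β h).real (hi N)
        ≤ (pottsMeasure p q N β h).real (magnetization ⁻¹' {x | W N x ≤ w})ᶜ := by
      refine measureReal_mono fun x hx => ?_
      simp only [Set.mem_compl_iff, Set.mem_preimage, Set.mem_ofPred_eq, not_le]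
      exact hy.trans_le ((hWle N hN _ _).1 (hx y))
    rw [probReal_compl_eq_one_sub (Set.Finite.measurableSet (Set.toFinite _)),
      pottsMeasure_real_preimage] at h4
    linarith
  have hmain := hG _ e he
  have hdiff : Tendsto (fun N => (pottsMeasure p q N β h).real
      {x | βhat N x ≤ ((β + τ N : ℝ) : EReal)} - expect p q N β h
        ({x | W N x ≤ expect p q N (β + τ N) h (W N)}.indicator 1)) atTop (𝓝 0) := by
    have hB := hlo0.add hhi0
    rw [add_zero] at hB
    refine squeeze_zero_norm' ?_ hB
    filter_upwards [hα, eventually_ne_atTop 0] with N hN hN0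
    rw [Real.norm_eq_abs, ← pottsMeasure_real_preimage]
    have hEW : expect p q N (β + τ N) h (W N)
        = α N * (expect p q N (β + τ N) h (powSum p) - σ) := by
      simp only [hW]
      rw [expect_const_mul, expect_sub, expect_const]
    -- Off the extremal samples the likelihood has a maximum, and comparing the estimator with `β +
    -- τ` is comparing the statistic with its mean there.
    have hgood : ∀ x, x ∉ lo N ∪ hi N → (x ∈ {x | βhat N x ≤ ((β + τ N : ℝ) : EReal)} ↔
        x ∈ magnetization ⁻¹' {x | W N x ≤ expect p q N (β + τ N) h (W N)}) := by
      intro x hx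
      simp only [hlo, hhi, Set.mem_union, Set.mem_ofPred_eq, not_or, not_forall, not_le] at hx
      obtain ⟨⟨y, hy⟩, ⟨z, hz⟩⟩ := hx
      obtain ⟨bh, hbh, hml⟩ := hβhat N x (exists_maximumLikelihood hN0 hy hz)
      simp only [Set.mem_ofPred_eq, Set.mem_preimage]
      rw [hbh, EReal.coe_le_coe_iff, maximumLikelihood_le_iff hN0 hml ⟨y, hy.ne⟩, hEW]
      simp only [hW]
      rw [mul_le_mul_iff_right₀ hN, sub_le_sub_iff_right]
    have hle : ∀ s s' : Set (Fin N → Fin q), (∀ x, x ∉ lo N ∪ hi N → x ∈ s → x ∈ s') →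
        (pottsMeasure p q N β h).real s ≤ (pottsMeasure p q N β h).real s'
          + ((pottsMeasure p q N β h).real (lo N) + (pottsMeasure p q N β h).real (hi N)) := by
      intro s s' hss
      have h1 : s ⊆ s' ∪ (lo N ∪ hi N) := fun x hx => by
        by_cases hb : x ∈ lo N ∪ hi N
        · exact Or.inr hb
        · exact Or.inl (hss x hb hx)
      refine (measureReal_mono h1).trans ((measureReal_union_le _ _).trans ?_)
      gcongr
      exact measureReal_union_le _ _
    have h1 := hle _ _ fun x hx => (hgood x hx).1
    have h2 := hle _ _ fun x hx => (hgood x hx).2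
    rw [abs_le]
    constructor <;> linarith
  have := hdiff.add hmain
  rw [zero_add] at this
  exact this.congr fun N => sub_add_cancel _ _

end Limit

/-! ### Weak convergence on the extended reals from distribution functions -/

/-- The closed lower sets with real end points, together with the trivial lower sets. -/
def lowerSets : Set (Set EReal) :=
  {s | s = ∅ ∨ s = Set.univ ∨ ∃ t : ℝ, s = Set.Iic (t : EReal)}

theorem total_of_mem_lowerSets {s s' : Set EReal} (hs : s ∈ lowerSets) (hs' : s' ∈ lowerSets) :
    s ⊆ s' ∨ s' ⊆ s := by
  rcases hs with rfl | rfl | ⟨t, rfl⟩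
  · simp
  · simp
  rcases hs' with rfl | rfl | ⟨t', rfl⟩
  · simp
  · simp
  rcases le_total t t' with h | h
  · exact Or.inl (Set.Iic_subset_Iic.2 (EReal.coe_le_coe_iff.2 h))
  · exact Or.inr (Set.Iic_subset_Iic.2 (EReal.coe_le_coe_iff.2 h))

theorem inter_mem_lowerSets {s s' : Set EReal} (hs : s ∈ lowerSets) (hs' : s' ∈ lowerSets) :
    s ∩ s' ∈ lowerSets := by
  rcases total_of_mem_lowerSets hs hs' with h | h
  · rwa [Set.inter_eq_left.2 h]
  · rwa [Set.inter_eq_right.2 h]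

theorem union_mem_lowerSets {s s' : Set EReal} (hs : s ∈ lowerSets) (hs' : s' ∈ lowerSets) :
    s ∪ s' ∈ lowerSets := by
  rcases total_of_mem_lowerSets hs hs' with h | h
  · rwa [Set.union_eq_right.2 h]
  · rwa [Set.union_eq_left.2 h]

theorem measurableSet_of_mem_lowerSets {s : Set EReal} (hs : s ∈ lowerSets) :
    MeasurableSet s := by
  rcases hs with rfl | rfl | ⟨t, rfl⟩
  exacts [MeasurableSet.empty, MeasurableSet.univ, measurableSet_Iic]

theorem exists_sdiff_lowerSets_subset {u : Set EReal} (hu : IsOpen u) {x : EReal} (hx : x ∈ u) :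
    ∃ s ∈ lowerSets, ∃ s' ∈ lowerSets, s \ s' ∈ 𝓝 x ∧ s \ s' ⊆ u := by
  have hux : u ∈ 𝓝 x := hu.mem_nhds hx
  induction x with
  | bot =>
    obtain ⟨y, hy⟩ := EReal.mem_nhds_bot_iff.1 hux
    refine ⟨Set.Iic ((y - 1 : ℝ) : EReal), Or.inr (Or.inr ⟨_, rfl⟩), ∅, Or.inl rfl, ?_, ?_⟩
    · rw [Set.sdiff_empty]
      exact Iic_mem_nhds (EReal.bot_lt_coe _)
    · rw [Set.sdiff_empty]
      refine (Set.Iic_subset_Iio.2 ?_).trans hy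
      exact EReal.coe_lt_coe_iff.2 (by linarith)
  | top =>
    obtain ⟨y, hy⟩ := EReal.mem_nhds_top_iff.1 hux
    refine ⟨Set.univ, Or.inr (Or.inl rfl), Set.Iic (y : EReal), Or.inr (Or.inr ⟨_, rfl⟩), ?_, ?_⟩
    · rw [← Set.compl_eq_univ_sdiff, Set.compl_Iic]
      exact Ioi_mem_nhds (EReal.coe_lt_top _)
    · rwa [← Set.compl_eq_univ_sdiff, Set.compl_Iic]
  | coe r =>
    rw [EReal.nhds_coe, mem_map] at hux
    obtain ⟨e, he, hball⟩ := Metric.mem_nhds_iff.1 hux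
    refine ⟨Set.Iic ((r + e / 2 : ℝ) : EReal), Or.inr (Or.inr ⟨_, rfl⟩),
      Set.Iic ((r - e / 2 : ℝ) : EReal), Or.inr (Or.inr ⟨_, rfl⟩), ?_, ?_⟩
    · have hlow : (Set.Iic ((r - e / 2 : ℝ) : EReal))ᶜ ∈ 𝓝 (r : EReal) := by
        rw [Set.compl_Iic]
        exact Ioi_mem_nhds (EReal.coe_lt_coe_iff.2 (by linarith))
      exact inter_mem (Iic_mem_nhds (EReal.coe_lt_coe_iff.2 (by linarith))) hlow
    · rintro y ⟨h1, h2⟩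
      simp only [Set.mem_Iic, not_le] at h1 h2
      induction y with
      | bot => simp at h2
      | top => exact absurd (top_le_iff.1 h1) (EReal.coe_ne_top _)
      | coe y =>
        rw [EReal.coe_le_coe_iff] at h1
        rw [EReal.coe_lt_coe_iff] at h2
        refine hball ?_
        rw [Metric.mem_ball, Real.dist_eq, abs_lt]
        constructor <;> linarith

/-- Differences of the sets in `lowerSets` form a π-system containing a neighbourhood of every point
inside each open set, and their masses converge. Atoms of the limit need no exception because
convergence is assumed at every real `t`. -/
theorem tendsto_probabilityMeasure_ereal {μ : ℕ → ProbabilityMeasure EReal}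
    {ν : ProbabilityMeasure EReal}
    (h : ∀ t : ℝ, Tendsto (fun N => (μ N : Measure EReal).real (Set.Iic (t : EReal))) atTop
      (𝓝 ((ν : Measure EReal).real (Set.Iic (t : EReal))))) :
    Tendsto μ atTop (𝓝 ν) := by
  have h0 : ∀ s ∈ lowerSets, Tendsto (fun N => (μ N : Measure EReal).real s) atTop
      (𝓝 ((ν : Measure EReal).real s)) := by
    rintro s (rfl | rfl | ⟨t, rfl⟩)
    · simp
    · simp
    · exact h t
  have hpi : IsPiSystem {u | ∃ s ∈ lowerSets, ∃ s' ∈ lowerSets, u = s \ s'} := by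
    rintro _ ⟨s, hs, s', hs', rfl⟩ _ ⟨v, hv, v', hv', rfl⟩ _
    refine ⟨s ∩ v, inter_mem_lowerSets hs hv, s' ∪ v', union_mem_lowerSets hs' hv', ?_⟩
    ext x
    simp only [Set.mem_inter_iff, Set.mem_sdiff, Set.mem_union]
    tauto
  refine hpi.tendsto_probabilityMeasure_of_tendsto_of_mem ?_ ?_ ?_
  · rintro _ ⟨s, hs, s', hs', rfl⟩
    exact (measurableSet_of_mem_lowerSets hs).diff (measurableSet_of_mem_lowerSets hs')
  · intro u hu x hx
    obtain ⟨s, hs, s', hs', h1, h2⟩ := exists_sdiff_lowerSets_subset hu hx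
    exact ⟨s \ s', ⟨s, hs, s', hs', rfl⟩, h1, h2⟩
  · rintro _ ⟨s, hs, s', hs', rfl⟩
    have hreal : ∀ P : ProbabilityMeasure EReal, (P : Measure EReal).real (s \ s')
        = (P : Measure EReal).real s - (P : Measure EReal).real (s' ∩ s) := by
      intro P
      rw [← measureReal_sdiff (Set.inter_subset_right) ((measurableSet_of_mem_lowerSets hs').inter
        (measurableSet_of_mem_lowerSets hs)), Set.inter_comm, Set.sdiff_self_inter]
    have h3 : Tendsto (fun N => (μ N : Measure EReal).real (s \ s')) atTop
        (𝓝 ((ν : Measure EReal).real (s \ s'))) := by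
      simp only [hreal]
      exact (h0 s hs).sub (h0 _ (inter_mem_lowerSets hs' hs))
    simpa using h3

theorem mul_sub_le_coe_iff {c β t : ℝ} (hc : 0 < c) (x : EReal) :
    (c : EReal) * (x - (β : EReal)) ≤ (t : EReal) ↔ x ≤ ((β + t / c : ℝ) : EReal) := by
  induction x with
  | bot => simp [EReal.coe_mul_bot_of_pos hc]
  | top =>
    rw [EReal.top_sub_coe, EReal.coe_mul_top_of_pos hc]
    simp only [top_le_iff, EReal.coe_ne_top]
  | coe x =>
    rw [← EReal.coe_sub, ← EReal.coe_mul, EReal.coe_le_coe_iff, EReal.coe_le_coe_iff,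
      ← sub_le_iff_le_add', le_div_iff₀ hc, mul_comm]

theorem rescaledErrorTendsto_of_tendsto {p q : ℕ} [NeZero q] {β h a : ℝ}
    {βhat : (N : ℕ) → (Fin N → Fin q) → EReal} {L : ProbabilityMeasure EReal}
    (hL : ∀ t : ℝ, Tendsto (fun N => (pottsMeasure p q N β h).real
      {x | βhat N x ≤ ((β + t / (N : ℝ) ^ a : ℝ) : EReal)}) atTop
      (𝓝 ((L : Measure EReal).real (Set.Iic (t : EReal))))) :
    RescaledErrorTendsto p q β h a βhat L := by
  have hmeas : ∀ N, AEMeasurable (fun x : Fin N → Fin q =>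
      (((N : ℝ) ^ a : ℝ) : EReal) * (βhat N x - (β : EReal))) (pottsMeasure p q N β h) :=
    fun N => (measurable_of_finite _).aemeasurable
  refine ⟨hmeas, measurable_id.aemeasurable, ?_⟩
  refine tendsto_probabilityMeasure_ereal fun t => ?_
  have h1 : (Measure.map (id : EReal → EReal) (L : Measure EReal)).real (Set.Iic (t : EReal))
      = (L : Measure EReal).real (Set.Iic (t : EReal)) := by rw [Measure.map_id]
  simp only [ProbabilityMeasure.coe_mk]
  rw [h1]
  refine (hL t).congr' ?_
  filter_upwards [eventually_ne_atTop 0] with N hN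
  have hN0 : (0 : ℝ) < (N : ℝ) ^ a :=
    Real.rpow_pos_of_pos (by exact_mod_cast Nat.pos_of_ne_zero hN) _
  rw [Measure.real, Measure.real, Measure.map_apply_of_aemeasurable (hmeas N) measurableSet_Iic]
  congr 2
  ext x
  simp only [Set.mem_ofPred_eq, Set.mem_preimage, Set.mem_Iic]
  exact (mul_sub_le_coe_iff hN0 _).symm

/-! ### Distribution functions of the limit law -/

section LimitLaw

variable {κ : ℝ} {k : ℕ} (hκ : 0 < κ) (hk : Even k) (hk4 : 4 ≤ k)

include hκ hk hk4

theorem limitLaw_pos_of_isOpen {s : Set ℝ} (hs : IsOpen s) (hne : s.Nonempty) (θ : ℝ) :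
    0 < (limitLaw κ k θ).real s := by
  have := isProbabilityMeasure_limitLaw hκ hk hk4 θ
  refine ENNReal.toReal_pos (fun h0 => ?_) (measure_ne_top _ _)
  exact (hs.measure_pos volume hne).ne'
    (absolutelyContinuous_tilted (integrable_exp_logDensity hκ hk hk4 θ) h0)

theorem limitLaw_sublevel_pos {φ : ℝ → ℝ} (hφ : Continuous φ) {y w : ℝ} (h : φ y < w) (θ : ℝ) :
    0 < (limitLaw κ k θ).real {y | φ y ≤ w} := by
  have := isProbabilityMeasure_limitLaw hκ hk hk4 θ
  exact (limitLaw_pos_of_isOpen hκ hk hk4 (isOpen_lt hφ continuous_const) ⟨y, h⟩ θ).trans_le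
    (measureReal_mono fun z (hz : φ z < w) => hz.le)

theorem limitLaw_sublevel_lt_one {φ : ℝ → ℝ} (hφ : Continuous φ) {y w : ℝ} (h : w < φ y)
    (θ : ℝ) : (limitLaw κ k θ).real {y | φ y ≤ w} < 1 := by
  have := isProbabilityMeasure_limitLaw hκ hk hk4 θ
  have h1 := limitLaw_pos_of_isOpen hκ hk hk4 (isOpen_lt continuous_const hφ) ⟨y, h⟩ θ
  have h2 : {y | w < φ y} = {y | φ y ≤ w}ᶜ := by ext; simp
  rw [h2, probReal_compl_eq_one_sub (measurableSet_le hφ.measurable measurable_const)] at h1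
  linarith

theorem exists_limitLaw_sublevel_near_one {φ : ℝ → ℝ} (hφ : Continuous φ)
    (hun : ∀ w, ∃ y, w < φ y) {δ : ℝ} (hδ : 0 < δ) :
    ∃ w, 1 - δ < (limitLaw κ k 0).real {y | φ y ≤ w} ∧
      (limitLaw κ k 0).real {y | φ y ≤ w} < 1 := by
  have := isProbabilityMeasure_limitLaw hκ hk hk4 0
  have := Measure.isProbabilityMeasure_map (μ := limitLaw κ k 0) hφ.measurable.aemeasurable
  have h1 := ProbabilityTheory.tendsto_cdf_atTop ((limitLaw κ k 0).map φ)
  obtain ⟨w, hw⟩ := (h1.eventually (lt_mem_nhds (show 1 - δ < 1 by linarith))).exists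
  rw [ProbabilityTheory.cdf_eq_real, map_measureReal_apply hφ.measurable measurableSet_Iic] at hw
  obtain ⟨y, hy⟩ := hun w
  exact ⟨w, hw, limitLaw_sublevel_lt_one hκ hk hk4 hφ hy 0⟩

theorem exists_limitLaw_Iic_near_zero {δ : ℝ} (hδ : 0 < δ) :
    ∃ w, 0 < (limitLaw κ k 0).real {y | y ≤ w} ∧ (limitLaw κ k 0).real {y | y ≤ w} < δ := by
  have := isProbabilityMeasure_limitLaw hκ hk hk4 0
  have h1 := ProbabilityTheory.tendsto_cdf_atBot (limitLaw κ k 0)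
  obtain ⟨w, hw⟩ := (h1.eventually (gt_mem_nhds hδ)).exists
  rw [ProbabilityTheory.cdf_eq_real] at hw
  exact ⟨w, limitLaw_sublevel_pos hκ hk hk4 continuous_id (sub_one_lt w) 0, hw⟩

/-- The sublevels decrease to the null set `{0}` as `w ↓ 0`, while for `w > 0` they contain an open
interval. -/
theorem exists_limitLaw_sq_near_zero {δ : ℝ} (hδ : 0 < δ) :
    ∃ w, 0 < (limitLaw κ k 0).real {y | y ^ 2 ≤ w} ∧
      (limitLaw κ k 0).real {y | y ^ 2 ≤ w} < δ := by
  have := isProbabilityMeasure_limitLaw hκ hk hk4 0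
  have h1 := tendsto_measureReal_sublevel_right (limitLaw κ k 0) (continuous_pow 2) 0
  have h2 : (limitLaw κ k 0).real {y : ℝ | y ^ 2 ≤ 0} = 0 := by
    have : {y : ℝ | y ^ 2 ≤ 0} = {0} := by
      ext y
      simp only [Set.mem_ofPred_eq, Set.mem_singleton_iff]
      constructor
      · intro h
        exact pow_eq_zero_iff (two_ne_zero) |>.1 (le_antisymm h (sq_nonneg y))
      · rintro rfl; norm_num
    rw [this, Measure.real, limitLaw,
      tilted_absolutelyContinuous _ _ (measure_singleton (0 : ℝ)), ENNReal.toReal_zero]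
  rw [h2] at h1
  obtain ⟨w, hw, hw0⟩ := ((h1.eventually (gt_mem_nhds hδ)).and self_mem_nhdsWithin).exists
  have hw0 : 0 < w := hw0
  rw [zero_add] at hw
  exact ⟨w, limitLaw_sublevel_pos hκ hk hk4 (continuous_pow 2) (y := 0) (by simpa using hw0) 0, hw⟩

end LimitLaw

theorem limitLaw_countable {κ : ℝ} {k : ℕ} (θ : ℝ) {s : Set ℝ} (hs : s.Countable) :
    limitLaw κ k θ s = 0 :=
  tilted_absolutelyContinuous _ _ (hs.measure_zero volume)

theorem countable_sq_eq (w : ℝ) : {y : ℝ | y ^ 2 = w}.Countable := by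
  refine (Set.Finite.subset (Set.toFinite {√w, -√w}) fun y hy => ?_).countable
  have hy : y ^ 2 = w := hy
  have : y ^ 2 = √w ^ 2 := by rw [Real.sq_sqrt (hy ▸ sq_nonneg y), hy]
  simpa using sq_eq_sq_iff_eq_or_eq_neg.1 this

theorem scale_pow_pred {k N : ℕ} (hk : k ≠ 0) (hN : N ≠ 0) :
    scale k N ^ (k - 1) = 1 / (N : ℝ) ^ (((k : ℝ) - 1) / k) := by
  have hN0 : (0 : ℝ) < N := by exact_mod_cast Nat.pos_of_ne_zero hN
  have hk0 : (k : ℝ) ≠ 0 := by exact_mod_cast hk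
  rw [scale, ← Real.rpow_natCast, ← Real.rpow_mul hN0.le, one_div ((N : ℝ) ^ _),
    ← Real.rpow_neg hN0.le, Nat.cast_sub (Nat.one_le_iff_ne_zero.2 hk), Nat.cast_one]
  congr 1
  ring

theorem sq_le_one_add_pow {k : ℕ} (hk : Even k) (hk2 : 2 ≤ k) (y : ℝ) : y ^ 2 ≤ 1 + y ^ k := by
  rw [← hk.pow_abs, ← sq_abs]
  rcases le_total |y| 1 with h | h
  · have : |y| ^ 2 ≤ 1 := pow_le_one₀ (abs_nonneg _) h
    have : 0 ≤ |y| ^ k := by positivity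
    linarith
  · have : |y| ^ 2 ≤ |y| ^ k := pow_le_pow_right₀ h hk2
    linarith

theorem pow_four_le_one_add_pow {k : ℕ} (hk : Even k) (hk2 : 4 ≤ k) (y : ℝ) :
    y ^ 4 ≤ 1 + y ^ k := by
  rw [← hk.pow_abs, ← (show Even 4 by decide).pow_abs]
  rcases le_total |y| 1 with h | h
  · have : |y| ^ 4 ≤ 1 := pow_le_one₀ (abs_nonneg _) h
    have : 0 ≤ |y| ^ k := by positivity
    linarith
  · have : |y| ^ 4 ≤ |y| ^ k := pow_le_pow_right₀ h hk2
    linarith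

/-! ### Expansion of the sufficient statistic at the maximizer. -/

/-- The sum of the squares of the entries other than the first is controlled by the spread and
the first entry. -/
theorem sum_erase_sub_sq_le {q : ℕ} [NeZero q] (hq : 2 ≤ q) {a b : ℝ} (hab : a + (q - 1) * b = 1)
    {x : Fin q → ℝ} (hx : x ∈ stdSimplex ℝ (Fin q)) :
    ∑ r ∈ Finset.univ.erase (0 : Fin q), (x r - b) ^ 2 ≤ spread x + (x 0 - a) ^ 2 := by
  set S := Finset.univ.erase (0 : Fin q)
  have hcard : (S.card : ℝ) = q - 1 := card_erase_zero q
  have hsum : ∑ r ∈ S, (x r - b) = -(x 0 - a) := by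
    rw [Finset.sum_sub_distrib, sum_erase_zero hx, Finset.sum_const, nsmul_eq_mul, hcard]
    linarith
  -- Expanding the squares gives an identity, since the deviations from `b` sum to `-(x 0 - a)`; the
  -- factor `2 (q - 1) ≥ 2` then gives the claim.
  have hid : spread x = 2 * (q - 1) * ∑ r ∈ S, (x r - b) ^ 2 - 2 * (x 0 - a) ^ 2 := by
    have h1 : ∀ r r' : Fin q, (x r - x r') ^ 2
        = (x r - b) ^ 2 + (x r' - b) ^ 2 - 2 * ((x r - b) * (x r' - b)) := fun r r' => by ring
    have h2 : ∑ r ∈ S, ∑ r' ∈ S, (x r - b) * (x r' - b) = (x 0 - a) ^ 2 := by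
      rw [← Finset.sum_mul_sum, hsum]; ring
    have h3 : spread x = ∑ r ∈ S, ∑ r' ∈ S, (x r - x r') ^ 2 := rfl
    have h4 : ∀ r, ∑ r' ∈ S, (x r - x r') ^ 2 = (q - 1) * (x r - b) ^ 2
        + ∑ r' ∈ S, (x r' - b) ^ 2 - 2 * ∑ r' ∈ S, (x r - b) * (x r' - b) := by
      intro r
      rw [Finset.sum_congr rfl fun r' _ => h1 r r', Finset.sum_sub_distrib,
        Finset.sum_add_distrib, Finset.sum_const, nsmul_eq_mul, hcard, Finset.mul_sum]
    rw [h3, Finset.sum_congr rfl fun r _ => h4 r, Finset.sum_sub_distrib, Finset.sum_add_distrib,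
      Finset.sum_const, nsmul_eq_mul, hcard, ← Finset.mul_sum, ← Finset.mul_sum, h2]
    ring
  have hq' : (2 : ℝ) ≤ q := by exact_mod_cast hq
  have h0 : 0 ≤ ∑ r ∈ S, (x r - b) ^ 2 := Finset.sum_nonneg fun _ _ => sq_nonneg _
  have h1 : 0 ≤ spread x := spread_nonneg x
  nlinarith

/-- First order expansion of the sufficient statistic at a two-level vector. -/
theorem exists_powSum_sub_bound {p q : ℕ} [NeZero q] (hq : 2 ≤ q) {a b : ℝ}
    (hm : (twoLevel a b : Fin q → ℝ) ∈ stdSimplex ℝ (Fin q)) (hab : a + (q - 1) * b = 1) :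
    ∃ C : ℝ, 0 ≤ C ∧ ∀ x ∈ stdSimplex ℝ (Fin q),
      |powSum p x - powSum p (twoLevel a b : Fin q → ℝ)
        - p * (a ^ (p - 1) - b ^ (p - 1)) * (x 0 - a)| ≤ C * (spread x + (x 0 - a) ^ 2) := by
  obtain ⟨C, hC, hT⟩ := exists_taylor_bound (f := fun y : ℝ => y ^ p) (contDiff_id.pow p) 1
  refine ⟨2 * C, by positivity, fun x hx => ?_⟩
  set m : Fin q → ℝ := twoLevel a b with hmdef
  have hm0 : m 0 = a := if_pos rfl
  have hmr : ∀ r ∈ Finset.univ.erase (0 : Fin q), m r = b := fun r hr =>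
    if_neg (Finset.ne_of_mem_erase hr)
  have hmem : ∀ {t : Fin q → ℝ}, t ∈ stdSimplex ℝ (Fin q) → ∀ r, t r ∈ Set.Icc (-1 : ℝ) 1 :=
    fun ht r => ⟨by linarith [ht.1 r], stdSimplex_le_one ht r⟩
  have hterm : ∀ r, |x r ^ p - m r ^ p - p * m r ^ (p - 1) * (x r - m r)|
      ≤ C * (x r - m r) ^ 2 := by
    intro r
    have := hT (m r) (hmem hm r) (x r) (hmem hx r)
    simpa using this
  -- On the simplex the deviations of the other entries add up to `-(x 0 - a)`, so the differential
  -- sees only the first entry.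
  have hlin : ∑ r, p * m r ^ (p - 1) * (x r - m r)
      = p * (a ^ (p - 1) - b ^ (p - 1)) * (x 0 - a) := by
    rw [← Finset.add_sum_erase _ _ (Finset.mem_univ (0 : Fin q)), hm0,
      Finset.sum_congr rfl fun r hr => by rw [hmr r hr], ← Finset.mul_sum,
      Finset.sum_sub_distrib, sum_erase_zero hx, Finset.sum_const, nsmul_eq_mul, card_erase_zero]
    linear_combination (-(p : ℝ) * b ^ (p - 1)) * hab
  have hsq : ∑ r, (x r - m r) ^ 2 ≤ 2 * (spread x + (x 0 - a) ^ 2) := by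
    rw [← Finset.add_sum_erase _ _ (Finset.mem_univ (0 : Fin q)), hm0,
      Finset.sum_congr rfl fun r hr => by rw [hmr r hr]]
    have := sum_erase_sub_sq_le hq hab hx
    have := spread_nonneg x
    linarith
  have e : powSum p x - powSum p m - p * (a ^ (p - 1) - b ^ (p - 1)) * (x 0 - a)
      = ∑ r, (x r ^ p - m r ^ p - p * m r ^ (p - 1) * (x r - m r)) := by
    rw [Finset.sum_sub_distrib, Finset.sum_sub_distrib, hlin]
    rfl
  rw [e]
  calc |∑ r, (x r ^ p - m r ^ p - p * m r ^ (p - 1) * (x r - m r))|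
      ≤ ∑ r, C * (x r - m r) ^ 2 :=
        (Finset.abs_sum_le_sum_abs _ _).trans (Finset.sum_le_sum fun r _ => hterm r)
    _ = C * ∑ r, (x r - m r) ^ 2 := by rw [Finset.mul_sum]
    _ ≤ C * (2 * (spread x + (x 0 - a) ^ 2)) := by gcongr
    _ = _ := by ring

/-! ### The limit of the distribution functions at a critical point -/

section

variable {p q : ℕ} [NeZero q] {β h a b κ : ℝ} {k : ℕ}

namespace CriticalPoint

variable (H : CriticalPoint p q β h a b κ k)

include H

/-- If the rescaled statistic is `L¹`-close to `φ(T)` at every `β + t ε^(k-1)`, its mean there tends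
to that of `φ` under the tilted limit law, and its distribution function at `β` tends to that of `φ`
under the untilted one. The remaining hypotheses exclude atoms and make the extremal samples
negligible. -/
theorem tendsto_distribution_of_statistic {βhat : (N : ℕ) → (Fin N → Fin q) → EReal}
    (hβhat : IsMLE p q h βhat) {φ : ℝ → ℝ} (hφ : Continuous φ) {A : ℝ}
    (hφA : ∀ x, |φ x| ≤ A * (1 + x ^ 2)) {α : ℕ → ℝ} {σ : ℝ} (hα : ∀ᶠ N in atTop, 0 < α N)
    (herr : ∀ t, Tendsto (fun N => expect p q N (β + t * scale k N ^ (k - 1)) h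
      (fun x => |α N * (powSum p x - σ) - φ ((x 0 - a) / scale k N)|)) atTop (𝓝 0))
    (hatom : ∀ w, {y | φ y = w}.Countable) (hun : ∀ w, ∃ y, w < φ y)
    (hG0 : ∀ δ : ℝ, 0 < δ → ∃ w, 0 < (limitLaw κ k 0).real {y | φ y ≤ w} ∧
      (limitLaw κ k 0).real {y | φ y ≤ w} < δ) (t : ℝ) :
    Tendsto (fun N => (pottsMeasure p q N β h).real
      {x | βhat N x ≤ ((β + t / (N : ℝ) ^ (((k : ℝ) - 1) / k) : ℝ) : EReal)}) atTop
      (𝓝 ((limitLaw κ k 0).real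
        {y | φ y ≤ ∫ x, φ x ∂(limitLaw κ k (t * p * (a ^ (p - 1) - b ^ (p - 1))))})) := by
  have hk0 : k ≠ 0 := by have := H.four_le_k; omega
  have he : Tendsto (fun N => expect p q N (β + t * scale k N ^ (k - 1)) h
      (fun x => α N * (powSum p x - σ))) atTop
      (𝓝 (∫ x, φ x ∂(limitLaw κ k (t * p * (a ^ (p - 1) - b ^ (p - 1)))))) := by
    have h1 := H.tendsto_expect t hφ hφA
    have h2 : Tendsto (fun N => expect p q N (β + t * scale k N ^ (k - 1)) h
        (fun x => α N * (powSum p x - σ))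
        - expect p q N (β + t * scale k N ^ (k - 1)) h
          (fun x => φ ((x 0 - a) / scale k N))) atTop (𝓝 0) := by
      refine squeeze_zero_norm (fun N => ?_) (herr t)
      rw [← expect_sub]
      exact abs_expect_le _
    simpa using h2.add h1
  refine (tendsto_distribution_mle (G := fun w => (limitLaw κ k 0).real {y | φ y ≤ w}) hβhat hα he
    (fun u w hu => ?_) hG0
    (fun δ hδ => exists_limitLaw_sublevel_near_one H.kappa_pos H.even_k H.four_le_k hφ hun
      hδ)).congr' ?_
  · refine H.tendsto_expect_indicator_le hφ ?_ hu (limitLaw_countable 0 (hatom w))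
    simpa using herr 0
  · filter_upwards [eventually_ne_atTop 0] with N hN
    rw [scale_pow_pred hk0 hN, mul_one_div]

/-- The limit when the largest entry of the maximizer is strictly larger than the others. -/
theorem tendsto_distribution_of_lt {βhat : (N : ℕ) → (Fin N → Fin q) → EReal}
    (hβhat : IsMLE p q h βhat) (hab : b < a) (t : ℝ) :
    Tendsto (fun N => (pottsMeasure p q N β h).real
      {x | βhat N x ≤ ((β + t / (N : ℝ) ^ (((k : ℝ) - 1) / k) : ℝ) : EReal)}) atTop
      (𝓝 ((limitLaw κ k 0).real
        {y | y ≤ ∫ x, x ∂(limitLaw κ k (t * p * (a ^ (p - 1) - b ^ (p - 1))))})) := by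
  have hk4 := H.four_le_k
  have hk0 : k ≠ 0 := by omega
  set c : ℝ := p * (a ^ (p - 1) - b ^ (p - 1)) with hc
  have hc0 : 0 < c := by
    have h1 := H.two_le_p
    have h2 : b ^ (p - 1) < a ^ (p - 1) := pow_lt_pow_left₀ hab H.b_pos.le (by omega)
    have h3 : (0 : ℝ) < p := by exact_mod_cast (by omega : 0 < p)
    exact mul_pos h3 (by linarith)
  obtain ⟨C, hC, hpow⟩ := exists_powSum_sub_bound (p := p) H.two_le_q H.mem_simplex H.sum_eq
  -- Dividing by `c * ε` makes the linear term exactly `T`; the remainder, the spread plus `(x 0 -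
  -- a) ^ 2`, has mean `O(ε ^ 2)` and so contributes `O(ε)`.
  refine H.tendsto_distribution_of_statistic hβhat (φ := fun y => y) (A := 1) continuous_id
    (fun x => ?_) (α := fun N => 1 / (c * scale k N)) (σ := powSum p (twoLevel a b : Fin q → ℝ))
    ?_ (fun t => ?_) (fun w => ?_) (fun w => ⟨w + 1, by simp⟩)
    (fun δ hδ => exists_limitLaw_Iic_near_zero H.kappa_pos H.even_k hk4 hδ) t
  · rw [one_mul, abs_le]
    constructor <;> nlinarith [sq_nonneg (x - 1), sq_nonneg (x + 1)]
  · filter_upwards [eventually_ne_atTop 0] with N hN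
    have := scale_pos (k := k) hN
    positivity
  · obtain ⟨C₁, hC₁, hspread⟩ := H.exists_spread_bound t
    obtain ⟨C₂, hC₂, hmom⟩ := H.exists_moment_bound t
    have h0 : Tendsto (fun N => C / c * (C₁ + (1 + C₂)) * scale k N) atTop (𝓝 0) := by
      simpa using (tendsto_scale hk0).const_mul (C / c * (C₁ + (1 + C₂)))
    refine tendsto_of_tendsto_of_tendsto_of_le_of_le' tendsto_const_nhds h0 ?_ ?_
    · filter_upwards [eventually_ne_atTop 0] with N hN
      exact expect_nonneg hN fun x _ => abs_nonneg _
    filter_upwards [eventually_ne_atTop 0] with N hN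
    set ε := scale k N with hε
    have hε0 : 0 < ε := scale_pos hN
    have he := scale_pow_mul hk0 hN
    rw [← hε] at he
    have hε1 : ε ≤ 1 := H.eps_le_one hN he
    have hb : ∀ x ∈ stdSimplex ℝ (Fin q),
        |1 / (c * ε) * (powSum p x - powSum p (twoLevel a b : Fin q → ℝ)) - (x 0 - a) / ε|
        ≤ C / (c * ε) * spread x + C / (c * ε) * ε ^ 2 * (1 + ((x 0 - a) / ε) ^ k) := by
      intro x hx
      have e1 : 1 / (c * ε) * (powSum p x - powSum p (twoLevel a b : Fin q → ℝ)) - (x 0 - a) / ε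
          = 1 / (c * ε) * (powSum p x - powSum p (twoLevel a b : Fin q → ℝ)
            - c * (x 0 - a)) := by
        field_simp
      rw [e1, abs_mul, abs_of_pos (by positivity : 0 < 1 / (c * ε))]
      have h1 := hpow x hx
      have h2 := sq_le_one_add_pow H.even_k (by omega) ((x 0 - a) / ε)
      have e2 : (x 0 - a) ^ 2 = ε ^ 2 * ((x 0 - a) / ε) ^ 2 := by field_simp
      calc 1 / (c * ε) * |powSum p x - powSum p (twoLevel a b : Fin q → ℝ) - c * (x 0 - a)|
          ≤ 1 / (c * ε) * (C * (spread x + (x 0 - a) ^ 2)) := by gcongr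
        _ = C / (c * ε) * spread x + C / (c * ε) * ε ^ 2 * ((x 0 - a) / ε) ^ 2 := by
          rw [e2]; ring
        _ ≤ _ := by gcongr
    refine (expect_mono_of_mem hN hb).trans ?_
    rw [expect_add (F := fun x => C / (c * ε) * spread x)
      (G := fun x => C / (c * ε) * ε ^ 2 * (1 + ((x 0 - a) / ε) ^ k)), expect_const_mul,
      expect_const_mul, expect_add (F := fun _ => (1 : ℝ)), expect_const]
    have hs := hspread N hN ε hε0 he
    have hm := hmom N hN ε hε0 he
    have hεk : ε ^ k ≤ ε ^ 2 := pow_le_pow_of_le_one hε0.le hε1 (by omega)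
    calc C / (c * ε) * expect p q N (β + t * ε ^ (k - 1)) h spread + C / (c * ε) * ε ^ 2
          * (1 + expect p q N (β + t * ε ^ (k - 1)) h fun x => ((x 0 - a) / ε) ^ k)
        ≤ C / (c * ε) * (C₁ * ε ^ 2) + C / (c * ε) * ε ^ 2 * (1 + C₂) := by
          gcongr
          exact hs.trans (by gcongr)
      _ = C / c * (C₁ + (1 + C₂)) * ε := by field_simp
  · simp

/-- The limit in the symmetric situation with two colours. -/
theorem tendsto_distribution_of_symmetric {βhat : (N : ℕ) → (Fin N → Fin q) → EReal}
    (hβhat : IsMLE p q h βhat) (hab : a = b) {σ c C : ℝ} (hc0 : 0 < c) (hC : 0 ≤ C)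
    (hpow : ∀ x ∈ stdSimplex ℝ (Fin q),
      |powSum p x - σ - c * (x 0 - a) ^ 2| ≤ C * (x 0 - a) ^ 4) (t : ℝ) :
    Tendsto (fun N => (pottsMeasure p q N β h).real
      {x | βhat N x ≤ ((β + t / (N : ℝ) ^ (((k : ℝ) - 1) / k) : ℝ) : EReal)}) atTop
      (𝓝 ((limitLaw κ k 0).real {y | y ^ 2 ≤ ∫ x, x ^ 2 ∂(limitLaw κ k 0)})) := by
  have hk4 := H.four_le_k
  have hk0 : k ≠ 0 := by omega
  have hθ : t * p * (a ^ (p - 1) - b ^ (p - 1)) = 0 := by rw [hab, sub_self, mul_zero]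
  -- The general statement has the tilted law only in the inner mean. With `a = b` this tilt is zero
  -- for every `t`, so the limit is constant in `t`.
  rw [← hθ]
  nth_rewrite 1 [hθ]
  refine H.tendsto_distribution_of_statistic hβhat (φ := fun y => y ^ 2) (A := 1)
    (continuous_pow 2) (fun x => ?_) (α := fun N => 1 / (c * scale k N ^ 2)) (σ := σ)
    ?_ (fun t => ?_) (fun w => countable_sq_eq w) (fun w => ⟨|w| + 1, ?_⟩)
    (fun δ hδ => exists_limitLaw_sq_near_zero H.kappa_pos H.even_k hk4 hδ) t
  · rw [one_mul, abs_of_nonneg (sq_nonneg x)]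
    linarith
  · filter_upwards [eventually_ne_atTop 0] with N hN
    have := scale_pos (k := k) hN
    positivity
  · obtain ⟨C₂, hC₂, hmom⟩ := H.exists_moment_bound t
    have h0 : Tendsto (fun N => C / c * (1 + C₂) * scale k N ^ 2) atTop (𝓝 0) := by
      simpa using ((tendsto_scale hk0).pow 2).const_mul (C / c * (1 + C₂))
    refine tendsto_of_tendsto_of_tendsto_of_le_of_le' tendsto_const_nhds h0 ?_ ?_
    · filter_upwards [eventually_ne_atTop 0] with N hN
      exact expect_nonneg hN fun x _ => abs_nonneg _
    filter_upwards [eventually_ne_atTop 0] with N hN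
    set ε := scale k N with hε
    have hε0 : 0 < ε := scale_pos hN
    have he := scale_pow_mul hk0 hN
    rw [← hε] at he
    have hb : ∀ x ∈ stdSimplex ℝ (Fin q),
        |1 / (c * ε ^ 2) * (powSum p x - σ) - ((x 0 - a) / ε) ^ 2|
        ≤ C / c * ε ^ 2 * (1 + ((x 0 - a) / ε) ^ k) := by
      intro x hx
      have e1 : 1 / (c * ε ^ 2) * (powSum p x - σ) - ((x 0 - a) / ε) ^ 2
          = 1 / (c * ε ^ 2) * (powSum p x - σ - c * (x 0 - a) ^ 2) := by
        field_simp
      rw [e1, abs_mul, abs_of_pos (by positivity : 0 < 1 / (c * ε ^ 2))]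
      have h1 := hpow x hx
      have h2 := pow_four_le_one_add_pow H.even_k hk4 ((x 0 - a) / ε)
      calc 1 / (c * ε ^ 2) * |powSum p x - σ - c * (x 0 - a) ^ 2|
          ≤ 1 / (c * ε ^ 2) * (C * (x 0 - a) ^ 4) := by gcongr
        _ = C / c * ε ^ 2 * ((x 0 - a) / ε) ^ 4 := by field_simp
        _ ≤ _ := by gcongr
    refine (expect_mono_of_mem hN hb).trans ?_
    rw [expect_const_mul, expect_add (F := fun _ => (1 : ℝ)), expect_const]
    have hm := hmom N hN ε hε0 he
    calc C / c * ε ^ 2 * (1 + expect p q N (β + t * ε ^ (k - 1)) h fun x => ((x 0 - a) / ε) ^ k)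
        ≤ C / c * ε ^ 2 * (1 + C₂) := by gcongr
      _ = C / c * (1 + C₂) * ε ^ 2 := by ring
  · have := abs_nonneg w
    have := le_abs_self w
    nlinarith

end CriticalPoint

end

/-! ### The free energy along two-level vectors -/

/-- L'Hôpital's rule. Iterated, it gives the leading term of a function from its first non-vanishing
derivative. -/
theorem tendsto_div_pow_succ {f f' : ℝ → ℝ} {a l : ℝ} (n : ℕ)
    (hf : ∀ᶠ x in 𝓝 a, HasDerivAt f (f' x) x) (h0 : f a = 0)
    (hl : Tendsto (fun x => f' x / (x - a) ^ n) (𝓝[≠] a) (𝓝 l)) :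
    Tendsto (fun x => f x / (x - a) ^ (n + 1)) (𝓝[≠] a) (𝓝 (l / (n + 1))) := by
  have hn : (n : ℝ) + 1 ≠ 0 := by positivity
  have hfa : HasDerivAt f (f' a) a := hf.self_of_nhds
  have hg : ∀ x, HasDerivAt (fun x : ℝ => (x - a) ^ (n + 1)) ((n + 1) * (x - a) ^ n) x := by
    intro x
    have := ((hasDerivAt_id x).sub_const a).fun_pow (n + 1)
    simpa using this
  refine HasDerivAt.lhopital_zero_nhdsNE (hf.filter_mono nhdsWithin_le_nhds)
    (Eventually.of_forall hg) ?_ ?_ ?_ ?_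
  · filter_upwards [self_mem_nhdsWithin] with x hx
    exact mul_ne_zero hn (pow_ne_zero _ (sub_ne_zero.2 hx))
  · have := hfa.continuousAt.tendsto.mono_left (nhdsWithin_le_nhds (s := {a}ᶜ))
    rwa [h0] at this
  · have := ((hg a).continuousAt.tendsto).mono_left (nhdsWithin_le_nhds (s := {a}ᶜ))
    simpa using this
  · refine (hl.div_const ((n : ℝ) + 1)).congr fun x => ?_
    rw [div_div, mul_comm]

theorem tendsto_div_sub_of_hasDerivAt {f : ℝ → ℝ} {a l : ℝ} (hf : HasDerivAt f l a)
    (h0 : f a = 0) : Tendsto (fun x => f x / (x - a) ^ 1) (𝓝[≠] a) (𝓝 l) := by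
  refine (hasDerivAt_iff_tendsto_slope.1 hf).congr fun x => ?_
  rw [slope_def_field, h0, sub_zero, pow_one]

/-- The functions `(c t^(p-1) + d) / t^j`, which include all derivatives of `β t^p - t log t` from
the second one on. -/
def powRatio (p : ℕ) (c d : ℝ) (j : ℕ) (t : ℝ) : ℝ := (c * t ^ (p - 1) + d) / t ^ j

theorem hasDerivAt_powRatio {p : ℕ} (hp : 2 ≤ p) (c d : ℝ) (j : ℕ) {t : ℝ} (ht : 0 < t) :
    HasDerivAt (powRatio p c d j) (powRatio p (c * (p - 1 - j)) (-(j * d)) (j + 1) t) t := by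
  obtain ⟨n, rfl⟩ : ∃ n, p = n + 2 := ⟨p - 2, by omega⟩
  have h1 := (((hasDerivAt_pow (n + 1) t).const_mul c).add_const d).div (hasDerivAt_pow j t)
    (pow_pos ht j).ne'
  refine h1.congr_deriv ?_
  unfold powRatio
  rw [show n + 2 - 1 = n + 1 by omega, show n + 1 - 1 = n by omega]
  push_cast
  rcases j with _ | j
  · simp only [Nat.cast_zero, pow_zero]
    field_simp
    ring
  · rw [Nat.add_sub_cancel]
    push_cast
    field_simp
    ring

/-- The derivative of `β t^p - t log t`. -/
def entropyDeriv (p : ℕ) (β t : ℝ) : ℝ := β * p * t ^ (p - 1) - Real.log t - 1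

theorem hasDerivAt_entropyDeriv {p : ℕ} (hp : 2 ≤ p) (β : ℝ) {t : ℝ} (ht : 0 < t) :
    HasDerivAt (entropyDeriv p β) (powRatio p (β * p * (p - 1)) (-1) 1 t) t := by
  obtain ⟨n, rfl⟩ : ∃ n, p = n + 2 := ⟨p - 2, by omega⟩
  have h1 := (((hasDerivAt_pow (n + 1) t).const_mul (β * (n + 2 : ℕ))).sub
    (Real.hasDerivAt_log ht.ne')).sub_const 1
  refine h1.congr_deriv ?_
  unfold powRatio
  rw [show n + 2 - 1 = n + 1 by omega, show n + 1 - 1 = n by omega]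
  push_cast
  field_simp
  ring

theorem hasDerivAt_pow_sub_mul_log {p : ℕ} (β : ℝ) {t : ℝ} (ht : 0 < t) :
    HasDerivAt (fun t => β * t ^ p - t * Real.log t) (entropyDeriv p β t) t := by
  refine (((hasDerivAt_pow p t).const_mul β).sub (Real.hasDerivAt_mul_log ht.ne')).congr_deriv ?_
  unfold entropyDeriv
  ring

/-- The free energy of the probability vector with first entry `x` and all others equal. -/
def profile (p q : ℕ) [NeZero q] (β h x : ℝ) : ℝ :=
  negFreeEnergy p q β h (twoLevel x ((1 - x) / (q - 1)))

/-- The first derivative of `profile`. -/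
def profileDeriv (p q : ℕ) (β h x : ℝ) : ℝ :=
  entropyDeriv p β x + h - entropyDeriv p β ((1 - x) / (q - 1))

/-- The second derivative of `profile`. -/
def profileDerivTwo (p q : ℕ) (β x : ℝ) : ℝ :=
  powRatio p (β * p * (p - 1)) (-1) 1 x
    + powRatio p (β * p * (p - 1)) (-1) 1 ((1 - x) / (q - 1)) / (q - 1)

/-- The third derivative of `profile`. -/
def profileDerivThree (p q : ℕ) (β x : ℝ) : ℝ :=
  powRatio p (β * p * (p - 1) * (p - 2)) 1 2 x
    - powRatio p (β * p * (p - 1) * (p - 2)) 1 2 ((1 - x) / (q - 1)) / (q - 1) ^ 2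

/-- The fourth derivative of `profile`. -/
def profileDerivFour (p q : ℕ) (β x : ℝ) : ℝ :=
  powRatio p (β * p * (p - 1) * (p - 2) * (p - 3)) (-2) 3 x
    + powRatio p (β * p * (p - 1) * (p - 2) * (p - 3)) (-2) 3 ((1 - x) / (q - 1)) / (q - 1) ^ 3

theorem sum_two_level {q : ℕ} [NeZero q] (g : ℝ → ℝ) (a b : ℝ) :
    ∑ r : Fin q, g (twoLevel a b r) = g a + (q - 1) * g b := by
  rw [← Finset.add_sum_erase _ _ (Finset.mem_univ (0 : Fin q)), twoLevel, if_pos rfl,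
    Finset.sum_congr rfl fun r hr => by rw [twoLevel, if_neg (Finset.ne_of_mem_erase hr)],
    Finset.sum_const, nsmul_eq_mul, card_erase_zero]

theorem negFreeEnergy_twoLevel (p q : ℕ) [NeZero q] (β h a b : ℝ) :
    negFreeEnergy p q β h (twoLevel a b)
      = (β * a ^ p - a * Real.log a) + h * a + (q - 1) * (β * b ^ p - b * Real.log b) := by
  rw [negFreeEnergy, sum_two_level (fun t => t ^ p), sum_two_level (fun t => t * Real.log t),
    twoLevel, if_pos rfl]
  ring

section

variable {p q : ℕ} [NeZero q] (hp : 2 ≤ p) (hq : 2 ≤ q) {β h x : ℝ} (hx : x ∈ Set.Ioo (0 : ℝ) 1)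

include hq hx

theorem other_entry_pos : 0 < (1 - x) / ((q : ℝ) - 1) := by
  have : (2 : ℝ) ≤ q := by exact_mod_cast hq
  exact div_pos (by linarith [hx.2]) (by linarith)

omit hx in
theorem hasDerivAt_other_entry (x : ℝ) :
    HasDerivAt (fun x : ℝ => (1 - x) / ((q : ℝ) - 1)) (-(1 / ((q : ℝ) - 1))) x := by
  have := ((hasDerivAt_id x).const_sub 1).div_const ((q : ℝ) - 1)
  refine this.congr_deriv (by ring)

theorem hasDerivAt_profile : HasDerivAt (profile p q β h) (profileDeriv p q β h x) x := by
  have hq' : (q : ℝ) - 1 ≠ 0 := by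
    have : (2 : ℝ) ≤ q := by exact_mod_cast hq
    linarith
  have h1 := hasDerivAt_pow_sub_mul_log (p := p) β hx.1
  have h2 := (hasDerivAt_pow_sub_mul_log (p := p) β (other_entry_pos hq hx)).comp x
    (hasDerivAt_other_entry hq x)
  have h3 := (h1.add ((hasDerivAt_id x).const_mul h)).add (h2.const_mul ((q : ℝ) - 1))
  have e : profile p q β h = fun x => (β * x ^ p - x * Real.log x) + h * id x
      + (q - 1) * ((fun t => β * t ^ p - t * Real.log t) ∘ fun x : ℝ => (1 - x) / ((q : ℝ) - 1)) x := by
    funext x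
    rw [profile, negFreeEnergy_twoLevel]
    rfl
  rw [e]
  refine h3.congr_deriv ?_
  unfold profileDeriv
  field_simp
  ring

include hp

theorem hasDerivAt_profileDeriv :
    HasDerivAt (profileDeriv p q β h) (profileDerivTwo p q β x) x := by
  have h2 := (hasDerivAt_entropyDeriv hp β (other_entry_pos hq hx)).comp x
    (hasDerivAt_other_entry hq x)
  refine (((hasDerivAt_entropyDeriv hp β hx.1).add_const h).sub h2).congr_deriv ?_
  unfold profileDerivTwo
  ring

theorem hasDerivAt_profileDerivTwo :
    HasDerivAt (profileDerivTwo p q β) (profileDerivThree p q β x) x := by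
  have h2 := ((hasDerivAt_powRatio hp (β * p * (p - 1)) (-1) 1 (other_entry_pos hq hx)).comp x
    (hasDerivAt_other_entry hq x)).div_const ((q : ℝ) - 1)
  refine ((hasDerivAt_powRatio hp (β * p * (p - 1)) (-1) 1 hx.1).add h2).congr_deriv ?_
  unfold profileDerivThree
  rw [show (β * p * (p - 1) * ((p : ℝ) - 1 - (1 : ℕ))) = β * p * (p - 1) * (p - 2) by
    push_cast; ring, show (-(((1 : ℕ) : ℝ) * (-1))) = 1 by push_cast; ring]
  field_simp
  ring

theorem hasDerivAt_profileDerivThree :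
    HasDerivAt (profileDerivThree p q β) (profileDerivFour p q β x) x := by
  have h2 := ((hasDerivAt_powRatio hp (β * p * (p - 1) * (p - 2)) 1 2
    (other_entry_pos hq hx)).comp x (hasDerivAt_other_entry hq x)).div_const (((q : ℝ) - 1) ^ 2)
  refine ((hasDerivAt_powRatio hp (β * p * (p - 1) * (p - 2)) 1 2 hx.1).sub h2).congr_deriv ?_
  unfold profileDerivFour
  rw [show (β * p * (p - 1) * (p - 2) * ((p : ℝ) - 1 - (2 : ℕ)))
      = β * p * (p - 1) * (p - 2) * (p - 3) by push_cast; ring,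
    show (-(((2 : ℕ) : ℝ) * 1)) = -2 by push_cast; ring]
  have hq' : (q : ℝ) - 1 ≠ 0 := by
    have : (2 : ℝ) ≤ q := by exact_mod_cast hq
    linarith
  field_simp
  ring

end

theorem iteratedDeriv_four_eq {U : Set ℝ} (hU : IsOpen U) {f f₁ f₂ f₃ f₄ : ℝ → ℝ}
    (h1 : ∀ x ∈ U, HasDerivAt f (f₁ x) x) (h2 : ∀ x ∈ U, HasDerivAt f₁ (f₂ x) x)
    (h3 : ∀ x ∈ U, HasDerivAt f₂ (f₃ x) x) (h4 : ∀ x ∈ U, HasDerivAt f₃ (f₄ x) x)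
    {x : ℝ} (hx : x ∈ U) : iteratedDeriv 4 f x = f₄ x := by
  have step : ∀ {g g' : ℝ → ℝ}, (∀ x ∈ U, HasDerivAt g (g' x) x) → Set.EqOn (deriv g) g' U :=
    fun hg x hx => (hg x hx).deriv
  have up : ∀ {g g' : ℝ → ℝ}, Set.EqOn g g' U → Set.EqOn (deriv g) (deriv g') U :=
    fun hg x hx => (Filter.eventuallyEq_of_mem (hU.mem_nhds hx) hg).deriv_eq
  have e1 := step h1
  have e2 := (up e1).trans (step h2)
  have e3 := (up e2).trans (step h3)
  have e4 := (up e3).trans (step h4)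
  simp only [iteratedDeriv_succ, iteratedDeriv_zero]
  exact e4 hx

/-- The first entry of `x_s`. -/
def entry (q : ℕ) (s : ℝ) : ℝ := (1 + (q - 1) * s) / q

theorem xvec_eq_twoLevel (q : ℕ) [NeZero q] (s : ℝ) :
    xvec q s = twoLevel (entry q s) ((1 - s) / q) := rfl

section

variable {p q : ℕ} [NeZero q] (hp : 2 ≤ p) (hq : 2 ≤ q) {β h : ℝ}

include hq

theorem one_sub_entry_div (s : ℝ) : (1 - entry q s) / ((q : ℝ) - 1) = (1 - s) / q := by
  have : (2 : ℝ) ≤ q := by exact_mod_cast hq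
  have h1 : (q : ℝ) - 1 ≠ 0 := by linarith
  have h2 : (q : ℝ) ≠ 0 := by linarith
  unfold entry
  field_simp
  ring

theorem fred_eq_profile (s : ℝ) : fred p q β h s = profile p q β h (entry q s) := by
  rw [fred, profile, xvec_eq_twoLevel, one_sub_entry_div hq]

theorem hasDerivAt_entry (s : ℝ) : HasDerivAt (entry q) (((q : ℝ) - 1) / q) s := by
  have := (((hasDerivAt_id s).const_mul ((q : ℝ) - 1)).const_add 1).div_const (q : ℝ)
  exact this.congr_deriv (by ring)

theorem entry_mem {s : ℝ} (hs : s ∈ Set.Ico (0 : ℝ) 1) : entry q s ∈ Set.Ioo (0 : ℝ) 1 := by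
  have h2 : (2 : ℝ) ≤ q := by exact_mod_cast hq
  constructor
  · have : 0 ≤ ((q : ℝ) - 1) * s := mul_nonneg (by linarith) hs.1
    exact div_pos (by linarith) (by linarith)
  · rw [entry, div_lt_one (by linarith)]
    nlinarith [hs.2]

include hp

theorem iteratedDeriv_four_fred {s : ℝ} (hs : s ∈ Set.Ico (0 : ℝ) 1) :
    iteratedDeriv 4 (fred p q β h) s
      = (((q : ℝ) - 1) / q) ^ 4 * profileDerivFour p q β (entry q s) := by
  have hcont : Continuous (entry q) := by unfold entry; fun_prop
  have e : fred p q β h = fun s => profile p q β h (entry q s) := funext (fred_eq_profile hq)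
  set c := ((q : ℝ) - 1) / q with hc
  rw [e]
  refine iteratedDeriv_four_eq (U := entry q ⁻¹' Set.Ioo 0 1) (isOpen_Ioo.preimage hcont)
    (f₁ := fun s => c * profileDeriv p q β h (entry q s))
    (f₂ := fun s => c ^ 2 * profileDerivTwo p q β (entry q s))
    (f₃ := fun s => c ^ 3 * profileDerivThree p q β (entry q s))
    (f₄ := fun s => c ^ 4 * profileDerivFour p q β (entry q s))
    (fun s hs => ?_) (fun s hs => ?_) (fun s hs => ?_) (fun s hs => ?_) (entry_mem hq hs)
  · refine ((hasDerivAt_profile hq hs).comp s (hasDerivAt_entry hq s)).congr_deriv ?_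
    ring
  · refine (((hasDerivAt_profileDeriv hp hq hs).comp s
      (hasDerivAt_entry hq s)).const_mul c).congr_deriv ?_
    ring
  · refine (((hasDerivAt_profileDerivTwo hp hq hs).comp s
      (hasDerivAt_entry hq s)).const_mul (c ^ 2)).congr_deriv ?_
    ring
  · refine (((hasDerivAt_profileDerivThree hp hq hs).comp s
      (hasDerivAt_entry hq s)).const_mul (c ^ 3)).congr_deriv ?_
    ring

end

/-! ### Derivative conditions at a maximum -/

theorem eventually_mem_Ioo {x : ℝ} (hx : x ∈ Set.Ioo (0 : ℝ) 1) :
    ∀ᶠ y in 𝓝 x, y ∈ Set.Ioo (0 : ℝ) 1 := isOpen_Ioo.mem_nhds hx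

section

variable {p q : ℕ} [NeZero q] (hp : 2 ≤ p) (hq : 2 ≤ q) {β h a : ℝ}
  (ha : a ∈ Set.Ioo (0 : ℝ) 1)

include hq ha

theorem isLocalMax_profile (hmax : IsUniqueMaximizer p q β h (twoLevel a ((1 - a) / (q - 1)))) :
    IsLocalMax (profile p q β h) a := by
  filter_upwards [eventually_mem_Ioo ha] with x hx
  by_cases hxa : (twoLevel x ((1 - x) / ((q : ℝ) - 1)) : Fin q → ℝ)
      = twoLevel a ((1 - a) / (q - 1))
  · rw [profile, profile, hxa]
  refine (hmax.2 _ ⟨fun r => ?_, ?_⟩ hxa).le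
  · unfold twoLevel
    split_ifs
    exacts [hx.1.le, (other_entry_pos hq hx).le]
  · have hq' : (q : ℝ) - 1 ≠ 0 := by
      have : (2 : ℝ) ≤ q := by exact_mod_cast hq
      linarith
    rw [sum_two_level (fun t => t)]
    field_simp
    ring

theorem profileDeriv_eq_zero (hmax : IsLocalMax (profile p q β h) a) :
    profileDeriv p q β h a = 0 :=
  hmax.hasDerivAt_eq_zero (hasDerivAt_profile hq ha)

theorem tendsto_profile_sub (n : ℕ) {l : ℝ}
    (hl : Tendsto (fun x => profileDeriv p q β h x / (x - a) ^ n) (𝓝[≠] a) (𝓝 l)) :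
    Tendsto (fun x => (profile p q β h x - profile p q β h a) / (x - a) ^ (n + 1)) (𝓝[≠] a)
      (𝓝 (l / (n + 1))) := by
  refine tendsto_div_pow_succ (f' := profileDeriv p q β h) n ?_ (sub_self _) hl
  filter_upwards [eventually_mem_Ioo ha] with x hx
  exact (hasDerivAt_profile hq hx).sub_const _

include hp

theorem profileDerivTwo_nonpos (hmax : IsLocalMax (profile p q β h) a) :
    profileDerivTwo p q β a ≤ 0 := by
  have h1 := tendsto_div_sub_of_hasDerivAt (hasDerivAt_profileDeriv hp hq ha)
    (profileDeriv_eq_zero hq ha hmax)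
  have h2 := tendsto_profile_sub hq ha 1 h1
  have h3 : profileDerivTwo p q β a / ((1 : ℕ) + 1) ≤ 0 := by
    refine le_of_tendsto h2 ?_
    filter_upwards [hmax.filter_mono nhdsWithin_le_nhds] with x hx
    exact div_nonpos_of_nonpos_of_nonneg (sub_nonpos.2 hx) (by norm_num; positivity)
  norm_num at h3
  linarith

theorem tendsto_profileDeriv_two (hmax : IsLocalMax (profile p q β h) a)
    (h2 : profileDerivTwo p q β a = 0) :
    Tendsto (fun x => profileDeriv p q β h x / (x - a) ^ 2) (𝓝[≠] a)
      (𝓝 (profileDerivThree p q β a / 2)) := by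
  have h1 := tendsto_div_sub_of_hasDerivAt (hasDerivAt_profileDerivTwo hp hq ha) h2
  have := tendsto_div_pow_succ (f := profileDeriv p q β h) 1
    ((eventually_mem_Ioo ha).mono fun x hx => hasDerivAt_profileDeriv hp hq hx)
    (profileDeriv_eq_zero hq ha hmax) h1
  norm_num at this
  exact this

/-- With a cubic leading term, the nonpositive increment of the profile forces opposite signs of the
coefficient from the two sides. -/
theorem profileDerivThree_eq_zero (hmax : IsLocalMax (profile p q β h) a)
    (h2 : profileDerivTwo p q β a = 0) : profileDerivThree p q β a = 0 := by
  have h3 := tendsto_profile_sub hq ha 2 (tendsto_profileDeriv_two hp hq ha hmax h2)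
  have hr : profileDerivThree p q β a / 2 / ((2 : ℕ) + 1) ≤ 0 := by
    refine le_of_tendsto (h3.mono_left (nhdsGT_le_nhdsNE a)) ?_
    filter_upwards [hmax.filter_mono nhdsWithin_le_nhds, self_mem_nhdsWithin] with x hx hxa
    exact div_nonpos_of_nonpos_of_nonneg (sub_nonpos.2 hx)
      (pow_nonneg (sub_nonneg.2 (le_of_lt hxa)) _)
  have hl : 0 ≤ profileDerivThree p q β a / 2 / ((2 : ℕ) + 1) := by
    refine ge_of_tendsto (h3.mono_left (nhdsLT_le_nhdsNE a)) ?_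
    filter_upwards [hmax.filter_mono nhdsWithin_le_nhds, self_mem_nhdsWithin] with x hx hxa
    exact div_nonneg_of_nonpos (sub_nonpos.2 hx)
      ((show Odd (2 + 1) by decide).pow_nonpos (sub_nonpos.2 (le_of_lt hxa)))
  norm_num at hr hl
  linarith

theorem tendsto_profileDeriv_three (hmax : IsLocalMax (profile p q β h) a)
    (h2 : profileDerivTwo p q β a = 0) :
    Tendsto (fun x => profileDeriv p q β h x / (x - a) ^ 3) (𝓝[≠] a)
      (𝓝 (profileDerivFour p q β a / 6)) := by
  have h1 := tendsto_div_sub_of_hasDerivAt (hasDerivAt_profileDerivThree hp hq ha)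
    (profileDerivThree_eq_zero hp hq ha hmax h2)
  have h3 := tendsto_div_pow_succ (f := profileDerivTwo p q β) 1
    ((eventually_mem_Ioo ha).mono fun x hx => hasDerivAt_profileDerivTwo hp hq hx) h2 h1
  have h4 := tendsto_div_pow_succ (f := profileDeriv p q β h) 2
    ((eventually_mem_Ioo ha).mono fun x hx => hasDerivAt_profileDeriv hp hq hx)
    (profileDeriv_eq_zero hq ha hmax) h3
  convert h4 using 2
  push_cast
  ring

end

/-! ### The drift -/

section

variable {p q : ℕ} [NeZero q] (hq : 2 ≤ q) {β h a : ℝ} (ha : a ∈ Set.Ioo (0 : ℝ) 1)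

theorem psi_eq_exp (p : ℕ) (β c : ℝ) {t : ℝ} (ht : 0 < t) :
    psi p β c t = Real.exp (-(entropyDeriv p β t + c + 1)) := by
  rw [psi, entropyDeriv]
  nth_rewrite 1 [← Real.exp_log ht]
  rw [← Real.exp_add]
  congr 1
  ring

include hq ha

/-- Up to a positive factor the drift is `exp (-F') - 1`, with `F'` the derivative of the profile.
So it vanishes at `a` to the same order, and the Stein identity inherits the degeneracy of the free
energy. -/
theorem drift_eq : drift p q β h a
    = psi p β 0 ((1 - a) / (q - 1)) * (Real.exp (-profileDeriv p q β h a) - 1) := by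
  rw [drift, psi_eq_exp p β h ha.1, psi_eq_exp p β 0 (other_entry_pos hq ha), mul_sub, mul_one,
    ← Real.exp_add]
  congr 2
  unfold profileDeriv
  ring

theorem tendsto_drift_div_pow {k : ℕ} (hk : 2 ≤ k) {κ : ℝ}
    (hκ : Tendsto (fun x => profileDeriv p q β h x / (x - a) ^ (k - 1)) (𝓝[≠] a) (𝓝 (-κ))) :
    Tendsto (fun x => drift p q β h x / (x - a) ^ (k - 1)) (𝓝[≠] a)
      (𝓝 (κ * psi p β 0 ((1 - a) / (q - 1)))) := by
  have hid : Tendsto (fun x : ℝ => (x - a) ^ (k - 1)) (𝓝[≠] a) (𝓝 0) := by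
    have hc : Continuous fun x : ℝ => (x - a) ^ (k - 1) := by fun_prop
    have := (hc.tendsto a).mono_left (nhdsWithin_le_nhds (s := {a}ᶜ))
    rwa [sub_self, zero_pow (by omega)] at this
  have hD : Tendsto (fun x => -profileDeriv p q β h x) (𝓝[≠] a) (𝓝 0) := by
    have h1 := (hκ.mul hid).neg
    rw [mul_zero, neg_zero] at h1
    refine h1.congr' ?_
    filter_upwards [self_mem_nhdsWithin] with x hx
    rw [div_mul_cancel₀ _ (pow_ne_zero _ (sub_ne_zero.2 hx))]
  -- The divided difference `(exp y - 1) / y`, extended by `1` at `y = 0`, avoids assuming that the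
  -- derivative of the profile is nonzero near `a`.
  have hds : Tendsto (fun x => dslope Real.exp 0 (-profileDeriv p q β h x)) (𝓝[≠] a) (𝓝 1) := by
    have hc : ContinuousAt (dslope Real.exp 0) 0 :=
      continuousAt_dslope_same.2 Real.differentiableAt_exp
    have h1 := hc.tendsto.comp hD
    rwa [dslope_same, Real.deriv_exp, Real.exp_zero] at h1
  have hpsi : Tendsto (fun x => psi p β 0 ((1 - x) / ((q : ℝ) - 1))) (𝓝[≠] a)
      (𝓝 (psi p β 0 ((1 - a) / (q - 1)))) := by
    have hc : Continuous fun x : ℝ => psi p β 0 ((1 - x) / ((q : ℝ) - 1)) :=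
      (contDiff_psi p β 0 (n := 0)).continuous.comp (by fun_prop)
    exact (hc.tendsto a).mono_left nhdsWithin_le_nhds
  have h1 := (hpsi.mul hds).mul hκ.neg
  rw [mul_one, neg_neg, mul_comm] at h1
  refine h1.congr' ?_
  filter_upwards [(eventually_mem_Ioo ha).filter_mono nhdsWithin_le_nhds] with x hx
  have h2 : dslope Real.exp 0 (-profileDeriv p q β h x) * (-profileDeriv p q β h x)
      = Real.exp (-profileDeriv p q β h x) - 1 := by
    have := sub_smul_dslope Real.exp 0 (-profileDeriv p q β h x)
    rw [sub_zero, smul_eq_mul, Real.exp_zero] at this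
    rw [← this, mul_comm]
  rw [drift_eq hq hx, ← h2]
  ring

end

/-! ### Classification of the special points -/

theorem IsUniqueMaximizer.eq {p q : ℕ} [NeZero q] {β h : ℝ} {m m' : Fin q → ℝ}
    (hm : IsUniqueMaximizer p q β h m) (hm' : IsUniqueMaximizer p q β h m') : m = m' := by
  by_contra hne
  exact lt_asymm (hm.2 m' hm'.1 (Ne.symm hne)) (hm'.2 m hm.1 hne)

theorem xvec_injective {q : ℕ} [NeZero q] (hq : 2 ≤ q) : Function.Injective (xvec q) := by
  intro s s' h
  have h1 : (2 : ℝ) ≤ q := by exact_mod_cast hq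
  have h2 := congrFun h 0
  simp only [xvec, if_true] at h2
  rw [div_left_inj' (by linarith), add_right_inj] at h2
  exact mul_left_cancel₀ (by linarith) h2

theorem powRatio_eq {p : ℕ} (hp : 2 ≤ p) (K : ℝ) {t : ℝ} (ht : 0 < t) :
    K * t ^ (p - 2) - 1 / t = powRatio p K (-1) 1 t := by
  obtain ⟨n, rfl⟩ : ∃ n, p = n + 2 := ⟨p - 2, by omega⟩
  unfold powRatio
  rw [show n + 2 - 2 = n by omega, show n + 2 - 1 = n + 1 by omega]
  field_simp
  ring

/-- On a singular point, the weighted coordinates of a null vector are all equal. -/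
theorem IsSingularQ.exists_const {p q : ℕ} {β : ℝ} {m : Fin q → ℝ} (hm : IsSingularQ p q β m) :
    ∃ t : Fin q → ℝ, t ≠ 0 ∧ ∑ r, t r = 0 ∧ ∀ r r' : Fin q,
      (β * p * (p - 1) * m r ^ (p - 2) - 1 / m r) * t r
        = (β * p * (p - 1) * m r' ^ (p - 2) - 1 / m r') * t r' := by
  obtain ⟨t, ht0, hts, ht⟩ := hm
  refine ⟨t, ht0, hts, fun r r' => ?_⟩
  have h := ht (fun i => (Pi.single r (1 : ℝ) : Fin q → ℝ) i
    - (Pi.single r' (1 : ℝ) : Fin q → ℝ) i) (by simp [Finset.sum_sub_distrib])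
  simp only [bilinQ, mul_sub, Finset.sum_sub_distrib, Pi.single_apply, mul_ite, mul_one,
    mul_zero, Finset.sum_ite_eq', Finset.mem_univ, if_true] at h
  linarith

section

variable {p q : ℕ} [NeZero q] (hp : 2 ≤ p) (hq : 2 ≤ q) {β h s : ℝ}

include hp hq

theorem entry_ge (hs : 0 ≤ s) : (1 - s) / q ≤ entry q s := by
  have h1 : (2 : ℝ) ≤ q := by exact_mod_cast hq
  unfold entry
  have : 0 ≤ (q - 1) * s := mul_nonneg (by linarith) hs
  gcongr
  linarith

theorem isLocalMax_entry (hs : s ∈ Set.Ico (0 : ℝ) 1)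
    (hmax : IsUniqueMaximizer p q β h (xvec q s)) : IsLocalMax (profile p q β h) (entry q s) := by
  refine isLocalMax_profile hq (entry_mem hq hs) ?_
  rw [one_sub_entry_div hq]
  exact hmax

/-- The null vector has equal weighted coordinates. Unless the weight at `b` vanishes, summing them
over the simplex tangent space shows that the degenerate direction is that of the first colour,
where the form is the second derivative of the profile. -/
theorem profileDerivTwo_eq_zero (hβ : 0 < β) (hs : s ∈ Set.Ico (0 : ℝ) 1)
    (hmax : IsUniqueMaximizer p q β h (xvec q s)) (hsing : IsSingularQ p q β (xvec q s)) :
    profileDerivTwo p q β (entry q s) = 0 := by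
  have hq' : (2 : ℝ) ≤ q := by exact_mod_cast hq
  have hp' : (2 : ℝ) ≤ p := by exact_mod_cast hp
  have hent := entry_mem hq hs
  have hb0 : 0 < (1 - s) / (q : ℝ) := div_pos (by linarith [hs.2]) (by linarith)
  have hle := entry_ge hp hq hs.1
  set a := entry q s with ha
  set b := (1 - s) / (q : ℝ) with hb
  set K := β * p * (p - 1) with hK
  have hK0 : 0 < K := mul_pos (mul_pos hβ (by linarith)) (by linarith)
  have hnon := profileDerivTwo_nonpos hp hq hent (isLocalMax_entry hp hq hs hmax)
  have hD : profileDerivTwo p q β a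
      = powRatio p K (-1) 1 a + powRatio p K (-1) 1 b / (q - 1) := by
    rw [profileDerivTwo, one_sub_entry_div hq]
  rw [hD] at hnon ⊢
  obtain ⟨t, ht0, hts, ht⟩ := hsing.exists_const
  have hv0 : xvec q s 0 = a := if_pos rfl
  have hvr : ∀ r : Fin q, r ≠ 0 → xvec q s r = b := fun r hr => if_neg hr
  have ht' : ∀ r : Fin q, r ≠ 0 → powRatio p K (-1) 1 b * t r = powRatio p K (-1) 1 a * t 0 := by
    intro r hr
    have := ht r 0
    rwa [hvr r hr, hv0, ← hK, powRatio_eq hp K hb0, powRatio_eq hp K hent.1] at this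
  -- If the weight at `b` is zero, then `K b^(p-1) = 1` and `a ≥ b` makes the weight at `a`
  -- nonnegative; maximality makes it nonpositive.
  by_cases hG : powRatio p K (-1) 1 b = 0
  · rw [hG, zero_div, add_zero] at hnon ⊢
    refine le_antisymm hnon ?_
    have h1 : K * b ^ (p - 1) + -1 = 0 := by
      have := hG
      rw [powRatio, div_eq_zero_iff] at this
      exact this.resolve_right (pow_pos hb0 1).ne'
    have h2 : b ^ (p - 1) ≤ a ^ (p - 1) := pow_le_pow_left₀ hb0.le hle _
    refine div_nonneg ?_ (pow_pos hent.1 1).le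
    nlinarith
  · have hsum : powRatio p K (-1) 1 b * t 0 + (q - 1) * (powRatio p K (-1) 1 a * t 0) = 0 := by
      rw [← Finset.add_sum_erase _ _ (Finset.mem_univ (0 : Fin q))] at hts
      have h1 : powRatio p K (-1) 1 b * ∑ r ∈ Finset.univ.erase (0 : Fin q), t r
          = (q - 1) * (powRatio p K (-1) 1 a * t 0) := by
        rw [Finset.mul_sum, Finset.sum_congr rfl fun r hr => ht' r (Finset.ne_of_mem_erase hr),
          Finset.sum_const, nsmul_eq_mul, card_erase_zero]
      rw [← h1, ← mul_add, hts, mul_zero]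
    have ht00 : t 0 ≠ 0 := by
      intro h0
      refine ht0 (funext fun r => ?_)
      by_cases hr : r = 0
      · rw [hr]; exact h0
      · have := ht' r hr
        rw [h0, mul_zero] at this
        exact (mul_eq_zero.1 this).resolve_left hG
    have h2 : (q - 1) * powRatio p K (-1) 1 a + powRatio p K (-1) 1 b = 0 :=
      mul_right_cancel₀ ht00 (by linear_combination hsum)
    have h3 : (q : ℝ) - 1 ≠ 0 := by linarith
    field_simp
    linarith

end

/-! ### Algebra of the vanishing derivatives. -/

/-- The relations between the second, third and fourth derivatives of the profile at `a`, written
in terms of `A = K a^(p-1)`, `B = K b^(p-1)` and `ρ = (q-1) b / a`. -/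
theorem profile_relations {p q : ℕ} [NeZero q] (hq : 2 ≤ q) {β a b : ℝ} (ha : 0 < a) (hb : 0 < b)
    (hab : (1 - a) / ((q : ℝ) - 1) = b) {A B ρ k : ℝ} (hA : A = β * p * (p - 1) * a ^ (p - 1))
    (hB : B = β * p * (p - 1) * b ^ (p - 1)) (hρ : ρ = (q - 1) * b / a) (hk : k = p - 2) :
    (profileDerivTwo p q β a = 0 → ρ * (A - 1) = 1 - B) ∧
    (profileDerivThree p q β a = 0 → ρ ^ 2 * (k * A + 1) = k * B + 1) ∧
    (profileDerivFour p q β a = 0 →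
      ρ ^ 3 * (k * (k - 1) * A - 2) + (k * (k - 1) * B - 2) = 0) := by
  have hq' : (2 : ℝ) ≤ q := by exact_mod_cast hq
  have hn : (0 : ℝ) < q - 1 := by linarith
  refine ⟨fun h => ?_, fun h => ?_, fun h => ?_⟩
  · rw [profileDerivTwo, hab, powRatio, powRatio, ← hA, ← hB] at h
    rw [hρ]
    field_simp at h ⊢
    linarith
  · rw [profileDerivThree, hab, powRatio, powRatio, mul_right_comm _ ((p : ℝ) - 2) (a ^ (p - 1)),
      mul_right_comm _ ((p : ℝ) - 2) (b ^ (p - 1)), ← hA, ← hB, ← hk] at h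
    rw [hρ]
    field_simp at h ⊢
    linarith
  · have e : ∀ t : ℝ, β * p * (p - 1) * (p - 2) * (p - 3) * t ^ (p - 1)
        = k * (k - 1) * (β * p * (p - 1) * t ^ (p - 1)) := by
      intro t; rw [hk]; ring
    rw [profileDerivFour, hab, powRatio, powRatio, e, e, ← hA, ← hB] at h
    rw [hρ]
    field_simp at h ⊢
    linarith

/-- Eliminating `A` and `B` from the three relations leaves `m ρ = 1 + ρ²` and `A ρ³ = B`, that is,
`(b/a)^(m+1) = ρ³`, with `ρ < 1`. Since `b/a ≤ ρ`, this fails for `m ≥ 3`; for `m = 2` the first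
equation forces `ρ = 1`; for `m ≤ 1` the fourth-order relation has only negative terms. -/
theorem no_flat_asymmetric_point {m : ℕ} {a b n A B ρ : ℝ} (ha : 0 < a) (hb : 0 < b) (hn : 1 ≤ n)
    (hρ : ρ = n * b / a) (hAB : A * b ^ (m + 1) = B * a ^ (m + 1)) (hA0 : 0 < A) (hB1 : B < 1)
    (h2 : ρ * (A - 1) = 1 - B) (h3 : ρ ^ 2 * (m * A + 1) = m * B + 1)
    (h4 : ρ ^ 3 * (m * (m - 1) * A - 2) + (m * (m - 1) * B - 2) = 0) : False := by
  have hρ0 : 0 < ρ := by rw [hρ]; positivity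
  have hρ3 : 0 < ρ ^ 3 := by positivity
  rcases Nat.lt_or_ge m 2 with hm | hm
  · have : (m : ℝ) * (m - 1) = 0 := by interval_cases m <;> norm_num
    rw [this] at h4
    nlinarith
  have hm' : (2 : ℝ) ≤ m := by exact_mod_cast hm
  have hb1 : m * B = m * ρ + ρ - 1 := by
    refine mul_left_cancel₀ (show 1 + ρ ≠ 0 by positivity) ?_
    linear_combination (-1 : ℝ) * h3 + m * ρ * h2
  have hm1 : m * ρ = 1 + ρ ^ 2 := by
    refine mul_left_cancel₀ (show ((m : ℝ) + 1) * (1 + ρ) ≠ 0 by positivity) ?_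
    linear_combination h4 - (m * (m - 1) * ρ ^ 2) * h2 - (m - 1) * (1 - ρ ^ 2) * hb1
  have hρ1 : ρ < 1 := by nlinarith
  have hAρ : A * ρ ^ 3 = B := by
    refine mul_left_cancel₀ (show (m : ℝ) ≠ 0 by linarith) ?_
    linear_combination m * ρ ^ 2 * h2 + (-ρ ^ 2 - 1) * hb1 + (ρ - 1) * hm1
  have hpow : b ^ (m + 1) = ρ ^ 3 * a ^ (m + 1) := by
    refine mul_left_cancel₀ hA0.ne' ?_
    rw [hAB, ← hAρ, mul_assoc]
  have hba : b ≤ ρ * a := by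
    rw [hρ, div_mul_cancel₀ _ ha.ne']
    nlinarith
  rcases hm.eq_or_lt with rfl | hm3
  · push_cast at hm1
    nlinarith [sq_nonneg (1 - ρ), mul_pos (sub_pos.2 hρ1) (sub_pos.2 hρ1)]
  · have h5 : b ^ (m + 1) ≤ ρ ^ (m + 1) * a ^ (m + 1) := by
      rw [← mul_pow]
      exact pow_le_pow_left₀ hb.le hba _
    have h6 : ρ ^ (m + 1) < ρ ^ 3 := pow_lt_pow_right_of_lt_one₀ hρ0 hρ1 (by omega)
    have h7 : ρ ^ (m + 1) * a ^ (m + 1) < ρ ^ 3 * a ^ (m + 1) :=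
      mul_lt_mul_of_pos_right h6 (pow_pos ha _)
    linarith


section

variable {p q : ℕ} [NeZero q] (hp : 2 ≤ p) (hq : 2 ≤ q) {β h s : ℝ}

include hp hq

/-- At equal entries `A = B` and `ρ = q - 1`: the second-order relation gives `A = 1`, and the
third-order one then gives `(q - 1)² = 1`. -/
theorem symmetric_flat_point (h2 : profileDerivTwo p q β (entry q 0) = 0)
    (h3 : profileDerivThree p q β (entry q 0) = 0) :
    q = 2 ∧ β * p * (p - 1) * (1 / 2) ^ (p - 1) = 1 ∧
      profileDerivFour p q β (entry q 0) = 16 * (p - 4) * (p - 1) := by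
  have hq' : (2 : ℝ) ≤ q := by exact_mod_cast hq
  have hp' : (2 : ℝ) ≤ p := by exact_mod_cast hp
  have he : entry q 0 = 1 / q := by unfold entry; ring
  rw [he] at h2 h3 ⊢
  have hpos : (0 : ℝ) < 1 / q := by positivity
  have hab : (1 - 1 / (q : ℝ)) / (q - 1) = 1 / q := by
    have : (q : ℝ) - 1 ≠ 0 := by linarith
    field_simp
  set A := β * p * (p - 1) * (1 / (q : ℝ)) ^ (p - 1) with hA
  obtain ⟨r2, r3, -⟩ := profile_relations (p := p) (β := β) hq hpos hpos hab hA hA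
    (ρ := (q : ℝ) - 1) (by field_simp) (k := p - 2) rfl
  have r2 := r2 h2
  have r3 := r3 h3
  have hA1 : A = 1 := by
    refine mul_left_cancel₀ (show (q : ℝ) ≠ 0 by linarith) ?_
    linarith
  rw [hA1] at r3
  have hq2 : (q : ℝ) = 2 := by
    have h5 : ((q : ℝ) - 1) ^ 2 = 1 := by
      refine mul_right_cancel₀ (show (p : ℝ) - 2 + 1 ≠ 0 by linarith) ?_
      linarith
    nlinarith
  have hq2' : q = 2 := by exact_mod_cast hq2
  have hK : β * p * (p - 1) * (1 / 2 : ℝ) ^ (p - 1) = 1 := by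
    have := hA1
    rwa [hA, hq2] at this
  refine ⟨hq2', hK, ?_⟩
  have e : β * p * (p - 1) * (p - 2) * (p - 3) * (1 / 2 : ℝ) ^ (p - 1) = (p - 2) * (p - 3) := by
    linear_combination ((p : ℝ) - 2) * (p - 3) * hK
  rw [profileDerivFour, hab, hq2, powRatio, e]
  norm_num
  ring

theorem entry_gt (hs : s ∈ Set.Ioo (0 : ℝ) 1) : (1 - s) / q < entry q s := by
  have h1 : (2 : ℝ) ≤ q := by exact_mod_cast hq
  unfold entry
  have : 0 < (q - 1) * s := mul_pos (by linarith) hs.1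
  gcongr
  linarith [hs.1]

/-- As `a > b`, the coefficient at `a` exceeds that at `b`. In `ρ (A - 1) = 1 - B` the two must lie
on opposite sides of `1`. -/
theorem other_coefficient_lt_one (hβ : 0 < β) (hs : s ∈ Set.Ioo (0 : ℝ) 1)
    (h2 : profileDerivTwo p q β (entry q s) = 0) :
    β * p * (p - 1) * ((1 - s) / q) ^ (p - 1) < 1 := by
  have hq' : (2 : ℝ) ≤ q := by exact_mod_cast hq
  have hp' : (2 : ℝ) ≤ p := by exact_mod_cast hp
  have hb0 : 0 < (1 - s) / (q : ℝ) := div_pos (by linarith [hs.2]) (by linarith)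
  have ha0 := (entry_mem hq ⟨hs.1.le, hs.2⟩).1
  have hlt := entry_gt hp hq hs
  have hK : 0 < β * p * (p - 1) := mul_pos (mul_pos hβ (by linarith)) (by linarith)
  have r2 := (profile_relations (p := p) (β := β) hq ha0 hb0 (one_sub_entry_div hq s) rfl rfl rfl
    rfl).1 h2
  have hρ : 0 < ((q : ℝ) - 1) * ((1 - s) / q) / entry q s :=
    div_pos (mul_pos (by linarith) hb0) ha0
  have hAB : β * p * (p - 1) * ((1 - s) / q) ^ (p - 1)
      < β * p * (p - 1) * entry q s ^ (p - 1) :=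
    mul_lt_mul_of_pos_left (pow_lt_pow_left₀ hlt hb0.le (by omega)) hK
  by_contra! hB
  nlinarith

/-- The derivative of the profile is `F⁗(a)/6 (x - a)³` to leading order, which gives `κ =
-F⁗(a)/6`. At `s = 0` transverse non-degeneracy is vacuous, since then `q = 2`. -/
theorem criticalPoint_four (hβ : 0 < β) (hs : s ∈ Set.Ico (0 : ℝ) 1)
    (hmax : IsUniqueMaximizer p q β h (xvec q s))
    (h2 : profileDerivTwo p q β (entry q s) = 0)
    (h4 : profileDerivFour p q β (entry q s) < 0) :
    CriticalPoint p q β h (entry q s) ((1 - s) / q) (-profileDerivFour p q β (entry q s) / 6)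
      4 := by
  have hq' : (2 : ℝ) ≤ q := by exact_mod_cast hq
  have hloc := isLocalMax_entry hp hq hs hmax
  have hent := entry_mem hq hs
  have hb0 : 0 < (1 - s) / (q : ℝ) := div_pos (by linarith [hs.2]) (by linarith)
  refine ⟨hp, hq, hβ, hent.1, hb0, ?_, hmax, ?_, fun hq3 => ?_, by decide, le_rfl, by linarith, ?_⟩
  · rw [← one_sub_entry_div hq]
    have : (q : ℝ) - 1 ≠ 0 := by linarith
    field_simp
    ring
  · have h1 := profileDeriv_eq_zero hq hent hloc
    rw [profileDeriv, one_sub_entry_div hq] at h1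
    rw [psi_eq_exp p β h hent.1, psi_eq_exp p β 0 hb0]
    congr 1
    linarith
  · rcases hs.1.eq_or_lt with h0 | h0
    · subst h0
      have := (symmetric_flat_point hp hq h2 (profileDerivThree_eq_zero hp hq hent hloc h2)).1
      omega
    · exact other_coefficient_lt_one hp hq hβ ⟨h0, hs.2⟩ h2
  · have h1 := tendsto_drift_div_pow (k := 4) (κ := -profileDerivFour p q β (entry q s) / 6)
      hq hent (by norm_num) (by
        rw [neg_div, neg_neg]
        exact tendsto_profileDeriv_three hp hq hent hloc h2)
    rwa [one_sub_entry_div hq] at h1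

/-- For `q = 2` one has `ρ = b/a < 1`. If `p = 2` the third-order relation reads `ρ² = 1`; if `p =
3` it combines with the second-order one and `A ρ² = B` to give `(1 - ρ)(1 + ρ) = 0`. -/
theorem asymmetric_excluded (hβ : 0 < β) (hs : s ∈ Set.Ioo (0 : ℝ) 1)
    (hmax : IsUniqueMaximizer p q β h (xvec q s))
    (h2 : profileDerivTwo p q β (entry q s) = 0) :
    profileDerivFour p q β (entry q s) ≠ 0 ∧ ¬(p = 2 ∧ q = 2) ∧ ¬(p = 3 ∧ q = 2) := by
  have hs' : s ∈ Set.Ico (0 : ℝ) 1 := ⟨hs.1.le, hs.2⟩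
  have hq' : (2 : ℝ) ≤ q := by exact_mod_cast hq
  have hp' : (2 : ℝ) ≤ p := by exact_mod_cast hp
  have hb0 : 0 < (1 - s) / (q : ℝ) := div_pos (by linarith [hs.2]) (by linarith)
  have hent := entry_mem hq hs'
  have hlt := entry_gt hp hq hs
  have hB1 := other_coefficient_lt_one hp hq hβ hs h2
  have hK : 0 < β * p * (p - 1) := mul_pos (mul_pos hβ (by linarith)) (by linarith)
  have h3 := profileDerivThree_eq_zero hp hq hent (isLocalMax_entry hp hq hs' hmax) h2
  obtain ⟨r2, r3, r4⟩ := profile_relations (p := p) (β := β) hq hent.1 hb0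
    (one_sub_entry_div hq s) rfl rfl rfl (k := p - 2) rfl
  have r2 := r2 h2
  have r3 := r3 h3
  set a := entry q s
  set b := (1 - s) / (q : ℝ)
  set A := β * p * (p - 1) * a ^ (p - 1) with hA
  set B := β * p * (p - 1) * b ^ (p - 1) with hB
  set ρ := ((q : ℝ) - 1) * b / a with hρ
  have hA0 : 0 < A := mul_pos hK (pow_pos hent.1 _)
  have hρ0 : 0 < ρ := div_pos (mul_pos (by linarith) hb0) hent.1
  refine ⟨fun h4 => ?_, ?_, ?_⟩
  · have hcast : ((p - 2 : ℕ) : ℝ) = p - 2 := by rw [Nat.cast_sub hp]; norm_num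
    have hexp : p - 2 + 1 = p - 1 := by omega
    refine no_flat_asymmetric_point (m := p - 2) (A := A) (B := B) hent.1 hb0
      (n := (q : ℝ) - 1) (by linarith) hρ ?_ hA0 hB1 r2 ?_ ?_
    · rw [hexp, hA, hB]; ring
    · rw [hcast]; exact r3
    · rw [hcast]; exact r4 h4
  · rintro ⟨hp2, hq2⟩
    have hρ1 : ρ < 1 := by
      rw [hρ, div_lt_one hent.1, hq2]
      norm_num
      exact hlt
    rw [hp2] at r3
    norm_num at r3
    rcases r3 with r3 | r3 <;> linarith
  · rintro ⟨hp3, hq2⟩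
    have hρb : ρ * a = b := by
      rw [hρ, div_mul_cancel₀ _ hent.1.ne', hq2]
      norm_num
    have hρ1 : ρ < 1 := by
      rw [hρ, div_lt_one hent.1, hq2]
      norm_num
      exact hlt
    have hAB : A * ρ ^ 2 = B := by
      rw [hA, hB, ← hρb, hp3]
      norm_num
      ring
    rw [hp3] at r3
    norm_num at r3
    have hB2 : B = 2 * ρ - 1 := by
      refine mul_left_cancel₀ (show 1 + ρ ≠ 0 by positivity) ?_
      linear_combination (-1 : ℝ) * r3 + ρ * r2
    have : (1 - ρ) * (1 + ρ) = 0 := by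
      linear_combination hAB - ρ * r2 + (1 + ρ) * hB2
    rcases mul_eq_zero.1 this with h | h <;> linarith

theorem pair_mem_iff_eq_zero (hβ : 0 < β) (hs : s ∈ Set.Ico (0 : ℝ) 1)
    (hmax : IsUniqueMaximizer p q β h (xvec q s))
    (h2 : profileDerivTwo p q β (entry q s) = 0)
    (h4 : profileDerivFour p q β (entry q s) < 0) :
    (p, q) ∈ ({(2, 2), (3, 2)} : Set (ℕ × ℕ)) ↔ s = 0 := by
  have hmem : (p, q) ∈ ({(2, 2), (3, 2)} : Set (ℕ × ℕ)) ↔ (p = 2 ∧ q = 2) ∨ (p = 3 ∧ q = 2) := by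
    simp
  rw [hmem]
  constructor
  · intro hpq
    by_contra h0
    have := (asymmetric_excluded hp hq hβ ⟨lt_of_le_of_ne hs.1 (Ne.symm h0), hs.2⟩ hmax h2).2
    tauto
  · rintro rfl
    obtain ⟨hq2, -, h4'⟩ := symmetric_flat_point hp hq h2 (profileDerivThree_eq_zero hp hq
      (entry_mem hq hs) (isLocalMax_entry hp hq hs hmax) h2)
    have hp' : (2 : ℝ) ≤ p := by exact_mod_cast hp
    have hp4 : (p : ℝ) < 4 := by
      by_contra! hcon
      rw [h4'] at h4
      nlinarith
    have hp4' : p < 4 := by exact_mod_cast hp4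
    omega

theorem flat_of_fourth_eq_zero (hβ : 0 < β) (hs : s ∈ Set.Ico (0 : ℝ) 1)
    (hmax : IsUniqueMaximizer p q β h (xvec q s))
    (h2 : profileDerivTwo p q β (entry q s) = 0)
    (h4 : profileDerivFour p q β (entry q s) = 0) : p = 4 ∧ q = 2 ∧ s = 0 ∧ β = 2 / 3 := by
  have h0 : s = 0 := by
    by_contra h0
    exact (asymmetric_excluded hp hq hβ ⟨lt_of_le_of_ne hs.1 (Ne.symm h0), hs.2⟩ hmax h2).1 h4
  subst h0
  obtain ⟨hq2, hK, h4'⟩ := symmetric_flat_point hp hq h2 (profileDerivThree_eq_zero hp hq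
    (entry_mem hq hs) (isLocalMax_entry hp hq hs hmax) h2)
  have hp' : (2 : ℝ) ≤ p := by exact_mod_cast hp
  have hp4 : (p : ℝ) = 4 := by
    have : ((p : ℝ) - 4) * (p - 1) = 0 := by linarith
    rcases mul_eq_zero.1 this with h | h <;> linarith
  have hp4' : p = 4 := by exact_mod_cast hp4
  refine ⟨hp4', hq2, rfl, ?_⟩
  rw [hp4'] at hK
  norm_num at hK
  linarith

end

theorem criticalPoint_six {h : ℝ} (hmax : IsUniqueMaximizer 4 2 (2 / 3) h (xvec 2 0)) :
    CriticalPoint 4 2 (2 / 3) h (1 / 2) (1 / 2) (64 / 5) 6 := by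
  have he : entry 2 0 = 1 / 2 := by unfold entry; norm_num
  have hb : (1 - 0) / ((2 : ℕ) : ℝ) = 1 / 2 := by norm_num
  have hmem : (1 / 2 : ℝ) ∈ Set.Ioo (0 : ℝ) 1 := by norm_num
  have hother : (1 - 1 / 2 : ℝ) / (((2 : ℕ) : ℝ) - 1) = 1 / 2 := by norm_num
  have hloc : IsLocalMax (profile 4 2 (2 / 3) h) (1 / 2) := by
    rw [← he]
    exact isLocalMax_entry (by norm_num) le_rfl (by norm_num) hmax
  have hD1 := profileDeriv_eq_zero le_rfl hmem hloc
  -- Explicitly, the second derivative equals `-16 (x - 1/2)^4 / (x (1 - x))`. One integration gives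
  -- the leading coefficient `-64/5` of the first derivative, so `κ / 6 = 32/15`, the constant of
  -- the type-II law.
  have hD2 : Tendsto (fun x => profileDerivTwo 4 2 (2 / 3) x / (x - 1 / 2) ^ 4) (𝓝[≠] (1 / 2))
      (𝓝 (-64)) := by
    have hc : ContinuousAt (fun x : ℝ => -16 / (x * (1 - x))) (1 / 2) := by
      refine ContinuousAt.div (by fun_prop) (by fun_prop) (by norm_num)
    have h1 := hc.tendsto.mono_left (nhdsWithin_le_nhds (s := {(1 / 2 : ℝ)}ᶜ))
    rw [show (-16 / (1 / 2 * (1 - 1 / 2)) : ℝ) = -64 by norm_num] at h1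
    refine h1.congr' ?_
    filter_upwards [(eventually_mem_Ioo hmem).filter_mono nhdsWithin_le_nhds,
      self_mem_nhdsWithin] with x hx hx2
    have hx3 : x - 1 / 2 ≠ 0 := sub_ne_zero.2 hx2
    have hx4 : x ≠ 0 := hx.1.ne'
    have hx5 : 1 - x ≠ 0 := by linarith [hx.2]
    rw [eq_div_iff (pow_ne_zero 4 hx3), profileDerivTwo, powRatio, powRatio]
    norm_num
    field_simp
    ring
  have hD : Tendsto (fun x => profileDeriv 4 2 (2 / 3) h x / (x - 1 / 2) ^ (6 - 1))
      (𝓝[≠] (1 / 2)) (𝓝 (-(64 / 5))) := by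
    have := tendsto_div_pow_succ (f := profileDeriv 4 2 (2 / 3) h) 4
      ((eventually_mem_Ioo hmem).mono fun x hx =>
        hasDerivAt_profileDeriv (by norm_num) le_rfl hx) hD1 hD2
    norm_num at this ⊢
    exact this
  refine ⟨by norm_num, le_rfl, by norm_num, by norm_num, by norm_num, by norm_num, ?_, ?_,
    by norm_num, by decide, by norm_num, by norm_num, ?_⟩
  · rw [xvec_eq_twoLevel, he, hb] at hmax
    exact hmax
  · rw [profileDeriv, hother] at hD1
    rw [psi_eq_exp 4 _ h hmem.1, psi_eq_exp 4 _ 0 hmem.1]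
    congr 1
    linarith
  · have h1 := tendsto_drift_div_pow (k := 6) le_rfl hmem (by norm_num) hD
    rwa [hother] at h1

/-! ### Dilations of tilted measures -/

theorem tilted_comp_mul_left {c : ℝ} (hc : c ≠ 0) (g : ℝ → ℝ) :
    (volume : Measure ℝ).tilted (fun x => g (c * x))
      = ((volume : Measure ℝ).tilted g).map (fun y => c⁻¹ * y) := by
  have hm : Measurable fun y : ℝ => c⁻¹ * y := measurable_const_mul c⁻¹
  have hpre : ∀ s : Set ℝ, (fun y : ℝ => c * y) ⁻¹' ((fun y : ℝ => c⁻¹ * y) ⁻¹' s) = s := by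
    intro s
    ext x
    simp [inv_mul_cancel_left₀ hc]
  have hZ : ∫ x, Real.exp (g (c * x)) = |c⁻¹| * ∫ x, Real.exp (g x) :=
    Measure.integral_comp_mul_left (fun x => Real.exp (g x)) c
  have hemb : MeasurableEmbedding fun y : ℝ => c * y :=
    (Homeomorph.mulLeft₀ c hc).measurableEmbedding
  ext s hs
  rw [Measure.map_apply hm hs, tilted_apply' _ _ hs, tilted_apply' _ _ (hm hs), hZ]
  conv_rhs => rw [← Real.smul_map_volume_mul_left hc]
  rw [Measure.restrict_smul, lintegral_smul_measure, hemb.restrict_map, hemb.lintegral_map, hpre,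
    smul_eq_mul, ← lintegral_const_mul' _ _ ENNReal.ofReal_ne_top]
  refine lintegral_congr fun x => ?_
  rw [← ENNReal.ofReal_mul (abs_nonneg c), Real.smul_map_volume_mul_left hc, abs_inv]
  congr 1
  rw [div_mul_eq_div_div, div_inv_eq_mul]
  ring


/-- Both sides of `Y² ≤ E Y²` scale by `c²`, so the normalization of the limit variable is
irrelevant for the two-point laws. -/
theorem probSqLeMean_map_mul (ν : Measure ℝ) {c : ℝ} (hc : c ≠ 0) :
    probSqLeMean (ν.map (fun y => c * y)) = probSqLeMean ν := by
  have hm : Measurable fun y : ℝ => c * y := measurable_const_mul c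
  rw [probSqLeMean, probSqLeMean, integral_map hm.aemeasurable (by fun_prop),
    map_measureReal_apply hm (measurableSet_le (by fun_prop) measurable_const)]
  congr 1
  ext y
  simp only [mul_pow, integral_const_mul, Set.mem_preimage, Set.mem_ofPred_eq]
  exact mul_le_mul_iff_right₀ (by positivity)

/-! ### The limit laws in terms of the critical point -/

section

variable {κ : ℝ} {k : ℕ}

theorem limitLaw_map_neg (hk : Even k) (θ : ℝ) :
    (limitLaw κ k θ).map (fun y => -y) = limitLaw κ k (-θ) := by
  have h := tilted_comp_mul_left (c := -1) (by norm_num) (logDensity κ k θ)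
  have e : (fun x => logDensity κ k θ (-1 * x)) = logDensity κ k (-θ) := by
    funext x
    unfold logDensity
    rw [neg_one_mul, hk.neg_pow]
    ring
  rw [e] at h
  rw [limitLaw, limitLaw, h]
  congr 1
  funext y
  norm_num

theorem limitLaw_Ici_neg (hk : Even k) (v : ℝ) :
    (limitLaw κ k 0).real (Set.Ici (-v)) = (limitLaw κ k 0).real (Set.Iic v) := by
  have h := limitLaw_map_neg (κ := κ) hk 0
  rw [neg_zero] at h
  conv_rhs => rw [← h]
  rw [map_measureReal_apply measurable_neg measurableSet_Iic]
  congr 1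
  ext y
  simp

theorem integral_limitLaw_neg (hk : Even k) (θ : ℝ) :
    ∫ x, x ∂(limitLaw κ k (-θ)) = -∫ x, x ∂(limitLaw κ k θ) := by
  rw [← limitLaw_map_neg hk, integral_map measurable_neg.aemeasurable (by fun_prop),
    integral_neg]

end

/-! ### The mean of the limit law as a function of the tilt -/

section

open ProbabilityTheory

variable {κ : ℝ} {k : ℕ} (hκ : 0 < κ) (hk : Even k) (hk4 : 4 ≤ k)

include hκ hk hk4

theorem limitLaw_eq_tilted (θ : ℝ) :
    limitLaw κ k θ = (limitLaw κ k 0).tilted (fun x => θ * id x) := by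
  rw [limitLaw, limitLaw, tilted_tilted (integrable_exp_logDensity hκ hk hk4 0)]
  congr 1
  funext x
  simp [logDensity]

theorem integrable_exp_mul_limitLaw (θ : ℝ) :
    Integrable (fun x => Real.exp (θ * id x)) (limitLaw κ k 0) := by
  rw [limitLaw, integrable_tilted_iff (integrable_exp_logDensity hκ hk hk4 0)]
  refine (integrable_exp_logDensity hκ hk hk4 θ).congr (Eventually.of_forall fun x => ?_)
  simp only [smul_eq_mul, id]
  rw [← Real.exp_add]
  congr 1
  simp [logDensity]

theorem mem_interior_integrableExpSet_limitLaw (θ : ℝ) :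
    θ ∈ interior (integrableExpSet id (limitLaw κ k 0)) := by
  have : integrableExpSet id (limitLaw κ k 0) = Set.univ :=
    Set.eq_univ_of_forall fun θ => integrable_exp_mul_limitLaw hκ hk hk4 θ
  rw [this, interior_univ]
  trivial

/-- The tilted laws form an exponential family, so analyticity of the cumulant generating function
gives continuity of the mean, and the variance as second derivative gives its monotonicity. -/
theorem integral_limitLaw_eq_deriv_cgf (θ : ℝ) :
    ∫ x, x ∂(limitLaw κ k θ) = deriv (cgf id (limitLaw κ k 0)) θ := by
  rw [limitLaw_eq_tilted hκ hk hk4,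
    ← integral_tilted_mul_self (mem_interior_integrableExpSet_limitLaw hκ hk hk4 θ)]
  rfl

theorem differentiableAt_cgf_limitLaw (θ : ℝ) :
    DifferentiableAt ℝ (cgf id (limitLaw κ k 0)) θ :=
  (analyticAt_cgf (mem_interior_integrableExpSet_limitLaw hκ hk hk4 θ)).differentiableAt

theorem continuous_integral_limitLaw : Continuous fun θ => ∫ x, x ∂(limitLaw κ k θ) := by
  simp only [integral_limitLaw_eq_deriv_cgf hκ hk hk4]
  exact continuous_iff_continuousAt.2 fun θ =>
    (analyticAt_cgf (mem_interior_integrableExpSet_limitLaw hκ hk hk4 θ)).deriv.continuousAt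

theorem monotone_integral_limitLaw : Monotone fun θ => ∫ x, x ∂(limitLaw κ k θ) := by
  simp only [integral_limitLaw_eq_deriv_cgf hκ hk hk4]
  refine monotone_of_deriv_nonneg (fun θ =>
    (analyticAt_cgf
      (mem_interior_integrableExpSet_limitLaw hκ hk hk4 θ)).deriv.differentiableAt) fun θ => ?_
  have h := variance_tilted_mul (mem_interior_integrableExpSet_limitLaw hκ hk hk4 θ)
  rw [iteratedDeriv_succ, iteratedDeriv_one] at h
  rw [← h]
  exact variance_nonneg _ _

/-- If all means were at most `R`, the cumulant generating function would be at most `R θ`, and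
Chernoff's bound would give mass at most `exp (-θ)` to `[R + 1, ∞)` for every `θ ≥ 0`, although the
density is positive. -/
theorem exists_lt_integral_limitLaw (R : ℝ) : ∃ θ, R < ∫ x, x ∂(limitLaw κ k θ) := by
  by_contra! hcon
  have hpr := isProbabilityMeasure_limitLaw hκ hk hk4 0
  have hcgf : ∀ θ : ℝ, 0 ≤ θ → cgf id (limitLaw κ k 0) θ ≤ R * θ := by
    intro θ hθ
    have h := (convex_Icc (0 : ℝ) θ).image_sub_le_mul_sub_of_deriv_le
      (f := cgf id (limitLaw κ k 0)) (C := R)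
      (fun y _ => (differentiableAt_cgf_limitLaw hκ hk hk4 y).continuousAt.continuousWithinAt)
      (fun y _ => (differentiableAt_cgf_limitLaw hκ hk hk4 y).differentiableWithinAt)
      (fun y _ => by rw [← integral_limitLaw_eq_deriv_cgf hκ hk hk4]; exact hcon y)
      0 (Set.left_mem_Icc.2 hθ) θ (Set.right_mem_Icc.2 hθ) hθ
    rwa [cgf_zero, sub_zero, sub_zero] at h
  have hpos : 0 < (limitLaw κ k 0).real {x | R + 1 ≤ id x} :=
    (limitLaw_pos_of_isOpen hκ hk hk4 isOpen_Ioi ⟨R + 2, by simp⟩ 0).trans_le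
      (measureReal_mono fun z (hz : R + 1 < z) => hz.le)
  have hle : ∀ θ : ℝ, 0 ≤ θ → (limitLaw κ k 0).real {x | R + 1 ≤ id x} ≤ Real.exp (-θ) := by
    intro θ hθ
    refine (measure_ge_le_exp_cgf (R + 1) hθ (integrable_exp_mul_limitLaw hκ hk hk4 θ)).trans
      (Real.exp_le_exp.2 ?_)
    have := hcgf θ hθ
    linarith
  have h0 : Tendsto (fun θ : ℝ => Real.exp (-θ)) atTop (𝓝 0) :=
    Real.tendsto_exp_neg_atTop_nhds_zero
  exact hpos.not_ge (ge_of_tendsto h0 ((eventually_ge_atTop 0).mono hle))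

theorem tendsto_integral_limitLaw_atTop :
    Tendsto (fun θ => ∫ x, x ∂(limitLaw κ k θ)) atTop atTop :=
  tendsto_atTop_atTop_of_monotone (monotone_integral_limitLaw hκ hk hk4) fun R =>
    (exists_lt_integral_limitLaw hκ hk hk4 R).imp fun _ h => h.le

theorem tendsto_integral_limitLaw_atBot :
    Tendsto (fun θ => ∫ x, x ∂(limitLaw κ k θ)) atBot atBot := by
  have h := tendsto_neg_atTop_atBot.comp
    ((tendsto_integral_limitLaw_atTop hκ hk hk4).comp tendsto_neg_atBot_atTop)
  refine h.congr fun θ => ?_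
  simp only [Function.comp]
  rw [integral_limitLaw_neg hk, neg_neg]

/-- The probability law whose distribution function is that of the untilted limit law evaluated at
the means of the tilted limit laws. -/
theorem exists_law_of_means {c : ℝ} (hc : 0 < c) : ∃ L : ProbabilityMeasure ℝ, ∀ t : ℝ,
    (L : Measure ℝ).real (Set.Iic t)
      = (limitLaw κ k 0).real (Set.Iic (∫ x, x ∂(limitLaw κ k (t * c)))) := by
  have hpr := isProbabilityMeasure_limitLaw hκ hk hk4 0
  set M : ℝ → ℝ := fun t => ∫ x, x ∂(limitLaw κ k (t * c)) with hM
  have hmul : Monotone fun t : ℝ => t * c := fun x y hxy => mul_le_mul_of_nonneg_right hxy hc.le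
  have hmono : Monotone M := (monotone_integral_limitLaw hκ hk hk4).comp hmul
  have hcont : Continuous M := (continuous_integral_limitLaw hκ hk hk4).comp (by fun_prop)
  have htop : Tendsto M atTop atTop :=
    (tendsto_integral_limitLaw_atTop hκ hk hk4).comp (tendsto_id.atTop_mul_const hc)
  have hbot : Tendsto M atBot atBot :=
    (tendsto_integral_limitLaw_atBot hκ hk hk4).comp (tendsto_id.atBot_mul_const hc)
  -- The mean map is continuous and monotone, so composition keeps right continuity; its limits `±∞`
  -- give total mass one.
  let F : StieltjesFunction ℝ :=
    { toFun := fun t => cdf (limitLaw κ k 0) (M t)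
      mono' := (monotone_cdf _).comp hmono
      right_continuous' := fun t => by
        refine ((cdf (limitLaw κ k 0)).right_continuous (M t)).comp hcont.continuousWithinAt ?_
        exact fun u hu => hmono hu }
  have hF0 : Tendsto F atBot (𝓝 0) := (tendsto_cdf_atBot _).comp hbot
  have hF1 : Tendsto F atTop (𝓝 1) := (tendsto_cdf_atTop _).comp htop
  refine ⟨⟨F.measure, F.isProbabilityMeasure hF0 hF1⟩, fun t => ?_⟩
  rw [ProbabilityMeasure.coe_mk, Measure.real, F.measure_Iic hF0, sub_zero,
    ENNReal.toReal_ofReal (cdf_nonneg _ _), ← cdf_eq_real]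

end

/-! ### Identification of the limit laws of the statement -/

theorem lawF_zero : lawF 0 = limitLaw (64 / 5) 6 0 := by
  unfold lawF limitLaw
  congr 1
  funext x
  unfold logDensity
  norm_num

section

variable {p q : ℕ} [NeZero q] (hp : 2 ≤ p) (hq : 2 ≤ q) {β h s : ℝ} (hs : s ∈ Set.Ico (0 : ℝ) 1)

include hp hq hs

/-- The variable of the statement is `-T / (q - 1)`: it measures the displacement along `u`, whose
first entry is `1 - q`. This accounts for the factor `q⁴` and for the sign of the linear term. -/
theorem lawT_eq_map (t : ℝ) : lawT p q β h s t 0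
    = (limitLaw (-profileDerivFour p q β (entry q s) / 6) 4
        (t * p * (entry q s ^ (p - 1) - ((1 - s) / q) ^ (p - 1)))).map
      (fun y => (-((q : ℝ) - 1))⁻¹ * y) := by
  have hq' : (2 : ℝ) ≤ q := by exact_mod_cast hq
  rw [limitLaw, ← tilted_comp_mul_left (by linarith), lawT, iteratedDeriv_four_fred hp hq hs]
  congr 1
  funext x
  have hsum : ∑ r, xvec q s r ^ (p - 1) * uvec q r
      = -(((q : ℝ) - 1) * (entry q s ^ (p - 1) - ((1 - s) / q) ^ (p - 1))) := by
    rw [← Finset.add_sum_erase _ _ (Finset.mem_univ (0 : Fin q)),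
      Finset.sum_congr rfl fun r hr => by
        rw [xvec, if_neg (Finset.ne_of_mem_erase hr), uvec, if_neg (Finset.ne_of_mem_erase hr)],
      Finset.sum_const, nsmul_eq_mul, card_erase_zero, xvec, if_pos rfl, uvec, if_pos rfl]
    unfold entry
    ring
  rw [hsum, logDensity]
  have : (q : ℝ) ≠ 0 := by linarith
  push_cast
  field_simp
  ring

end

/-! ### Two-point laws and laws on the real line -/

theorem exists_isTwoPointLaw {c : ℝ} (hc : c ∈ Set.Icc (0 : ℝ) 1) :
    ∃ L : ProbabilityMeasure EReal, IsTwoPointLaw c L := by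
  refine ⟨⟨ENNReal.ofReal c • Measure.dirac ⊥ + ENNReal.ofReal (1 - c) • Measure.dirac ⊤, ⟨?_⟩⟩,
    hc, rfl⟩
  rw [Measure.add_apply, Measure.smul_apply, Measure.smul_apply, measure_univ, measure_univ,
    smul_eq_mul, smul_eq_mul, mul_one, mul_one, ← ENNReal.ofReal_add hc.1 (by linarith [hc.2])]
  norm_num

theorem IsTwoPointLaw.real_Iic {c : ℝ} {L : ProbabilityMeasure EReal} (hL : IsTwoPointLaw c L)
    (t : ℝ) : (L : Measure EReal).real (Set.Iic (t : EReal)) = c := by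
  rw [hL.2, Measure.real, Measure.add_apply, Measure.smul_apply, Measure.smul_apply,
    Measure.dirac_apply' _ measurableSet_Iic, Measure.dirac_apply' _ measurableSet_Iic]
  simp [hL.1.1]

theorem probabilityMeasure_map_coe_real_Iic (L : ProbabilityMeasure ℝ) (t : ℝ) :
    ((L.map (f := fun y : ℝ => (y : EReal)) measurable_coe_real_ereal.aemeasurable :
      ProbabilityMeasure EReal) : Measure EReal).real (Set.Iic (t : EReal))
      = (L : Measure ℝ).real (Set.Iic t) := by
  rw [ProbabilityMeasure.toMeasure_map, map_measureReal_apply measurable_coe_real_ereal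
    measurableSet_Iic]
  congr 1
  ext y
  simp

theorem probSqLeMean_mem_Icc (ν : Measure ℝ) [IsProbabilityMeasure ν] :
    probSqLeMean ν ∈ Set.Icc (0 : ℝ) 1 :=
  ⟨measureReal_nonneg, measureReal_le_one⟩

/-! ### The law of the statement for type-I points -/

section

variable {p q : ℕ} [NeZero q] (hp : 2 ≤ p) (hq : 2 ≤ q) {β h s : ℝ} (hs : s ∈ Set.Ico (0 : ℝ) 1)
  (h4 : profileDerivFour p q β (entry q s) < 0)

include hp hq hs

theorem probSqLeMean_lawT_zero : probSqLeMean (lawT p q β h s 0 0)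
    = probSqLeMean (limitLaw (-profileDerivFour p q β (entry q s) / 6) 4 0) := by
  have hq' : (2 : ℝ) ≤ q := by exact_mod_cast hq
  rw [lawT_eq_map hp hq hs, probSqLeMean_map_mul _ (inv_ne_zero (by linarith)), zero_mul, zero_mul]

include h4

theorem isProbabilityMeasure_lawT (t : ℝ) : IsProbabilityMeasure (lawT p q β h s t 0) := by
  rw [lawT_eq_map hp hq hs]
  have := isProbabilityMeasure_limitLaw (κ := -profileDerivFour p q β (entry q s) / 6) (k := 4)
    (by linarith) (by decide) le_rfl
    (t * p * (entry q s ^ (p - 1) - ((1 - s) / q) ^ (p - 1)))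
  exact Measure.isProbabilityMeasure_map (by fun_prop)

theorem integrable_pow_lawT (t : ℝ) (j : ℕ) :
    Integrable (fun u => u ^ j) (lawT p q β h s t 0) := by
  rw [lawT_eq_map hp hq hs, integrable_map_measure (by fun_prop) (by fun_prop)]
  have := integrable_pow_limitLaw (κ := -profileDerivFour p q β (entry q s) / 6) (k := 4)
    (by linarith) (by decide) le_rfl
    (t * p * (entry q s ^ (p - 1) - ((1 - s) / q) ^ (p - 1))) j
  refine (this.const_mul ((-((q : ℝ) - 1))⁻¹ ^ j)).congr (Eventually.of_forall fun x => ?_)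
  simp [mul_pow]

omit h4 in
-- The dilation has a negative factor, so a lower half-line pulls back to an upper one; symmetry of
-- the untilted law turns it back, which explains the minus sign before the mean in `L₁`.
theorem lawT_Iic_neg_mean (t : ℝ) :
    (lawT p q β h s 0 0).real (Set.Iic (-∫ u, u ∂(lawT p q β h s t 0)))
      = (limitLaw (-profileDerivFour p q β (entry q s) / 6) 4 0).real (Set.Iic
        (∫ x, x ∂(limitLaw (-profileDerivFour p q β (entry q s) / 6) 4
          (t * (p * (entry q s ^ (p - 1) - ((1 - s) / q) ^ (p - 1))))))) := by
  have hq' : (2 : ℝ) ≤ q := by exact_mod_cast hq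
  have hn : (0 : ℝ) < (q : ℝ) - 1 := by linarith
  have hm : Measurable fun y : ℝ => (-((q : ℝ) - 1))⁻¹ * y := measurable_const_mul _
  rw [lawT_eq_map hp hq hs, lawT_eq_map hp hq hs t, zero_mul, zero_mul,
    integral_map hm.aemeasurable (by fun_prop), integral_const_mul,
    map_measureReal_apply hm measurableSet_Iic, ← limitLaw_Ici_neg (by decide), mul_assoc]
  congr 1
  ext y
  simp only [Set.mem_preimage, Set.mem_Iic, Set.mem_Ici, inv_neg]
  rw [neg_mul, neg_mul, neg_neg, neg_le, ← mul_neg, mul_le_mul_iff_right₀ (inv_pos.2 hn)]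

end

/-! ### The sufficient statistic for two colours -/

/-- With `x 1 = 1 - x 0` the power sum is even around `1/2`: exactly quadratic for `p = 2, 3`, with
a quartic remainder for `p = 4`. -/
theorem exists_powSum_quadratic {p q : ℕ} [NeZero q] (hp : p = 2 ∨ p = 3 ∨ p = 4) (hq : q = 2) :
    ∃ σ c C : ℝ, 0 < c ∧ 0 ≤ C ∧ ∀ x ∈ stdSimplex ℝ (Fin q),
      |powSum p x - σ - c * (x 0 - 1 / 2) ^ 2| ≤ C * (x 0 - 1 / 2) ^ 4 := by
  subst hq
  have hx1 : ∀ x ∈ stdSimplex ℝ (Fin 2), x 1 = 1 - x 0 := by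
    intro x hx
    have := hx.2
    rw [Fin.sum_univ_two] at this
    linarith
  rcases hp with rfl | rfl | rfl
  · refine ⟨1 / 2, 2, 0, by norm_num, le_rfl, fun x hx => ?_⟩
    rw [powSum, Fin.sum_univ_two, hx1 x hx, zero_mul, abs_nonpos_iff]
    ring
  · refine ⟨1 / 4, 3, 0, by norm_num, le_rfl, fun x hx => ?_⟩
    rw [powSum, Fin.sum_univ_two, hx1 x hx, zero_mul, abs_nonpos_iff]
    ring
  · refine ⟨1 / 8, 3, 2, by norm_num, by norm_num, fun x hx => ?_⟩
    rw [powSum, Fin.sum_univ_two, hx1 x hx]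
    have e : x 0 ^ 4 + (1 - x 0) ^ 4 - 1 / 8 - 3 * (x 0 - 1 / 2) ^ 2
        = 2 * (x 0 - 1 / 2) ^ 4 := by ring
    rw [e, abs_of_nonneg (by positivity)]

/-- The limiting distribution function is the same at every real `t`, so no mass stays on the real
line and the constant is the mass at `-∞`. -/
theorem CriticalPoint.exists_twoPointLaw {p q : ℕ} [NeZero q] {β h κ : ℝ} {k : ℕ}
    (H : CriticalPoint p q β h (1 / 2) (1 / 2) κ k) (hp : p = 2 ∨ p = 3 ∨ p = 4) (hq : q = 2)
    {βhat : (N : ℕ) → (Fin N → Fin q) → EReal} (hβhat : IsMLE p q h βhat) :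
    ∃ L : ProbabilityMeasure EReal, IsTwoPointLaw (probSqLeMean (limitLaw κ k 0)) L ∧
      RescaledErrorTendsto p q β h (((k : ℝ) - 1) / k) βhat L := by
  have := isProbabilityMeasure_limitLaw H.kappa_pos H.even_k H.four_le_k 0
  obtain ⟨L, hL⟩ := exists_isTwoPointLaw (probSqLeMean_mem_Icc (limitLaw κ k 0))
  obtain ⟨σ, c, C, hc, hC, hpow⟩ := exists_powSum_quadratic hp hq
  refine ⟨L, hL, rescaledErrorTendsto_of_tendsto fun t => ?_⟩
  rw [hL.real_Iic]
  exact H.tendsto_distribution_of_symmetric hβhat rfl hc hC hpow t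

/-- The data at a special point with maximizer `x_s`. -/
theorem IsSpecial.profileDerivTwo_eq_zero {p q : ℕ} [NeZero q] (hp : 2 ≤ p) (hq : 2 ≤ q)
    {β h s : ℝ} (hsp : IsSpecial p q β h) (hs : s ∈ Set.Ico (0 : ℝ) 1)
    (hmax : IsUniqueMaximizer p q β h (xvec q s)) : profileDerivTwo p q β (entry q s) = 0 := by
  obtain ⟨hβ, -, m, hm, hsing⟩ := hsp
  rw [hm.eq hmax] at hsing
  exact CWPotts.profileDerivTwo_eq_zero hp hq hβ hs hmax hsing

theorem IsTypeI.profileDerivFour_neg {p q : ℕ} [NeZero q] (hp : 2 ≤ p) (hq : 2 ≤ q) {β h s : ℝ}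
    (hI : IsTypeI p q β h) (hs : s ∈ Set.Ico (0 : ℝ) 1)
    (hmax : IsUniqueMaximizer p q β h (xvec q s)) : profileDerivFour p q β (entry q s) < 0 := by
  obtain ⟨-, s', hs', hmax', h4⟩ := hI
  obtain rfl : s' = s := xvec_injective hq (hmax'.eq hmax)
  have hq' : (2 : ℝ) ≤ q := by exact_mod_cast hq
  have hc : 0 < ((q : ℝ) - 1) / q := div_pos (by linarith) (by linarith)
  rw [iteratedDeriv_four_fred hp hq hs] at h4
  exact (pos_iff_neg_of_mul_neg h4).1 (pow_pos hc 4)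

theorem tendsto_of_typeI_asymmetric {p q : ℕ} [NeZero q] (hp : 2 ≤ p) (hq : 2 ≤ q) {β h s : ℝ}
    {βhat : (N : ℕ) → (Fin N → Fin q) → EReal} (hβhat : IsMLE p q h βhat)
    (hI : IsTypeI p q β h) (hs : s ∈ Set.Ico (0 : ℝ) 1)
    (hmax : IsUniqueMaximizer p q β h (xvec q s))
    (hpq : (p, q) ∉ ({(2, 2), (3, 2)} : Set (ℕ × ℕ))) :
    ∃ L₁ : ProbabilityMeasure ℝ,
      (∀ t : ℝ, (L₁ : Measure ℝ).real (Set.Iic t) =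
        (lawT p q β h s 0 0).real (Set.Iic (-∫ u, u ∂(lawT p q β h s t 0)))) ∧
      RescaledErrorTendsto p q β h (3 / 4) βhat
        (L₁.map (f := fun y : ℝ => (y : EReal)) measurable_coe_real_ereal.aemeasurable) := by
  have h2 := hI.1.profileDerivTwo_eq_zero hp hq hs hmax
  have h4 := hI.profileDerivFour_neg hp hq hs hmax
  -- The excluded pairs are exactly those with `s = 0`; here the first entry is strictly largest, so
  -- the statistic has a nonzero linear term.
  have hs0 : s ≠ 0 := fun h0 => hpq ((pair_mem_iff_eq_zero hp hq hI.1.1 hs hmax h2 h4).2 h0)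
  have hlt := entry_gt hp hq ⟨lt_of_le_of_ne hs.1 (Ne.symm hs0), hs.2⟩
  have H := criticalPoint_four hp hq hI.1.1 hs hmax h2 h4
  have hc : 0 < (p : ℝ) * (entry q s ^ (p - 1) - ((1 - s) / q) ^ (p - 1)) := by
    have h1 : ((1 - s) / (q : ℝ)) ^ (p - 1) < entry q s ^ (p - 1) :=
      pow_lt_pow_left₀ hlt H.b_pos.le (by omega)
    have h3 : (0 : ℝ) < p := by exact_mod_cast (by omega : 0 < p)
    exact mul_pos h3 (by linarith)
  obtain ⟨L, hL⟩ := exists_law_of_means H.kappa_pos H.even_k H.four_le_k hc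
  refine ⟨L, fun t => ?_, rescaledErrorTendsto_of_tendsto fun t => ?_⟩
  · rw [hL, lawT_Iic_neg_mean hp hq hs]
  · rw [probabilityMeasure_map_coe_real_Iic, hL, ← mul_assoc]
    have := H.tendsto_distribution_of_lt hβhat hlt t
    norm_num at this
    exact this

theorem tendsto_of_typeI_symmetric {p q : ℕ} [NeZero q] (hp : 2 ≤ p) (hq : 2 ≤ q) {β h s : ℝ}
    {βhat : (N : ℕ) → (Fin N → Fin q) → EReal} (hβhat : IsMLE p q h βhat)
    (hI : IsTypeI p q β h) (hs : s ∈ Set.Ico (0 : ℝ) 1)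
    (hmax : IsUniqueMaximizer p q β h (xvec q s))
    (hpq : (p, q) ∈ ({(2, 2), (3, 2)} : Set (ℕ × ℕ))) :
    ∃ L : ProbabilityMeasure EReal, IsTwoPointLaw (probSqLeMean (lawT p q β h s 0 0)) L ∧
      RescaledErrorTendsto p q β h (3 / 4) βhat L := by
  have h2 := hI.1.profileDerivTwo_eq_zero hp hq hs hmax
  have h4 := hI.profileDerivFour_neg hp hq hs hmax
  have hs0 := (pair_mem_iff_eq_zero hp hq hI.1.1 hs hmax h2 h4).1 hpq
  have H := criticalPoint_four hp hq hI.1.1 hs hmax h2 h4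
  rw [probSqLeMean_lawT_zero hp hq hs]
  have hpq' : (p = 2 ∧ q = 2) ∨ (p = 3 ∧ q = 2) := by simpa using hpq
  have hq2 : q = 2 := by tauto
  have ha : entry q s = 1 / 2 := by rw [hs0, hq2, entry]; norm_num
  have hb : (1 - s) / (q : ℝ) = 1 / 2 := by rw [hs0, hq2]; norm_num
  rw [ha, hb] at H
  rw [ha]
  have := H.exists_twoPointLaw (by tauto) hq2 hβhat
  norm_num at this
  exact this

theorem tendsto_of_typeII {p q : ℕ} [NeZero q] (hp : 2 ≤ p) (hq : 2 ≤ q) {β h : ℝ}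
    {βhat : (N : ℕ) → (Fin N → Fin q) → EReal} (hβhat : IsMLE p q h βhat)
    (hII : IsTypeII p q β h) :
    ∃ L : ProbabilityMeasure EReal, IsTwoPointLaw (probSqLeMean (lawF 0)) L ∧
      RescaledErrorTendsto p q β h (5 / 6) βhat L := by
  obtain ⟨hsp, s, hs, hmax, h4⟩ := hII
  have h2 := hsp.profileDerivTwo_eq_zero hp hq hs hmax
  rw [iteratedDeriv_four_fred hp hq hs] at h4
  have hq' : (2 : ℝ) ≤ q := by exact_mod_cast hq
  have hc : 0 < ((q : ℝ) - 1) / q := div_pos (by linarith) (by linarith)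
  obtain ⟨rfl, rfl, rfl, rfl⟩ := flat_of_fourth_eq_zero hp hq hsp.1 hs hmax h2
    ((mul_eq_zero.1 h4).resolve_left (pow_pos hc 4).ne')
  rw [lawF_zero]
  have := (criticalPoint_six hmax).exists_twoPointLaw (by tauto) rfl hβhat
  norm_num at this ⊢
  exact this

end CWPotts

end

theorem theorem3p5 (p q : ℕ) [NeZero q] (hp : 2 ≤ p) (hq : 2 ≤ q) (β h : ℝ)
    (βhat : (N : ℕ) → (Fin N → Fin q) → EReal) (hβhat : CWPotts.IsMLE p q h βhat) :
    -- type-I special points; the unique maximizer is `x_s`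
    (CWPotts.IsTypeI p q β h → ∀ s ∈ Set.Ico (0 : ℝ) 1,
      CWPotts.IsUniqueMaximizer p q β h (CWPotts.xvec q s) →
      -- (p,q) not in {(2,2),(3,2)}: limit law `L₁` given by its distribution function
      ((p, q) ∉ ({(2, 2), (3, 2)} : Set (ℕ × ℕ)) →
        (∀ t : ℝ, MeasureTheory.IsProbabilityMeasure (CWPotts.lawT p q β h s t 0) ∧
          MeasureTheory.Integrable (fun u : ℝ => u) (CWPotts.lawT p q β h s t 0)) ∧
        ∃ L₁ : MeasureTheory.ProbabilityMeasure ℝ,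
          (∀ t : ℝ, (L₁ : MeasureTheory.Measure ℝ).real (Set.Iic t) =
            (CWPotts.lawT p q β h s 0 0).real
              (Set.Iic (-∫ u, u ∂(CWPotts.lawT p q β h s t 0)))) ∧
          CWPotts.RescaledErrorTendsto p q β h (3 / 4) βhat
            (L₁.map (f := fun y : ℝ => (y : EReal)) measurable_coe_real_ereal.aemeasurable)) ∧
      -- (p,q) in {(2,2),(3,2)}: two-point limit law at ±∞
      ((p, q) ∈ ({(2, 2), (3, 2)} : Set (ℕ × ℕ)) →
        MeasureTheory.IsProbabilityMeasure (CWPotts.lawT p q β h s 0 0) ∧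
        MeasureTheory.Integrable (fun u : ℝ => u ^ 2) (CWPotts.lawT p q β h s 0 0) ∧
        ∃ L : MeasureTheory.ProbabilityMeasure EReal,
          CWPotts.IsTwoPointLaw (CWPotts.probSqLeMean (CWPotts.lawT p q β h s 0 0)) L ∧
          CWPotts.RescaledErrorTendsto p q β h (3 / 4) βhat L)) ∧
    -- type-II special points
    (CWPotts.IsTypeII p q β h →
      MeasureTheory.IsProbabilityMeasure (CWPotts.lawF 0) ∧
      MeasureTheory.Integrable (fun u : ℝ => u ^ 2) (CWPotts.lawF 0) ∧
      ∃ L : MeasureTheory.ProbabilityMeasure EReal,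
        CWPotts.IsTwoPointLaw (CWPotts.probSqLeMean (CWPotts.lawF 0)) L ∧
        CWPotts.RescaledErrorTendsto p q β h (5 / 6) βhat L) := by
  refine ⟨fun hI s hs hmax => ?_, fun hII => ?_⟩
  · have h4 := hI.profileDerivFour_neg hp hq hs hmax
    refine ⟨fun hpq => ⟨fun t => ⟨CWPotts.isProbabilityMeasure_lawT hp hq hs h4 t, ?_⟩,
      CWPotts.tendsto_of_typeI_asymmetric hp hq hβhat hI hs hmax hpq⟩, fun hpq =>
      ⟨CWPotts.isProbabilityMeasure_lawT hp hq hs h4 0,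
        CWPotts.integrable_pow_lawT hp hq hs h4 0 2,
        CWPotts.tendsto_of_typeI_symmetric hp hq hβhat hI hs hmax hpq⟩⟩
    simpa using CWPotts.integrable_pow_lawT (h := h) hp hq hs h4 t 1
  · refine ⟨?_, ?_, CWPotts.tendsto_of_typeII hp hq hβhat hII⟩
    · rw [CWPotts.lawF_zero]
      exact CWPotts.isProbabilityMeasure_limitLaw (by norm_num) (by decide) (by norm_num) 0
    · rw [CWPotts.lawF_zero]
      exact CWPotts.integrable_pow_limitLaw (by norm_num) (by decide) (by norm_num) 0 2
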